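/- Let $b,c$ be positive integers with $bc>4$ (the wild case). Let $\mathcal F=\mathbb Q(x_1,x_2)$ and define $x_m\in\mathcal F$ for all $m\in\mathbb Z$ by $x_{m-1}x_{m+1}=x_m^b+1$ for $m$ odd and $x_{m-1}x_{m+1}=x_m^c+1$ for $m$ even. The cluster algebra $\mathcal A(b,c)$ is the subring of $\mathcal F$ generated by all the cluster variables $x_m$. A nonzero element of $\mathcal A(b,c)$ is called positive if, for every $m\in\mathbb Z$, all the coefficients occurring in its expansion as a Laurent polynomial with integer coefficients in $x_m,x_{m+1}$ are positive. For $(a_1,a_2)\in\mathbb Z^2$ the greedy element $x[a_1,a_2]$ is $$x[a_1,a_2]=x_1^{-a_1}x_2^{-a_2}\sum_{(S_1,S_2)}x_1^{b|S_2|}x_2^{c|S_1|},$$ where the sum is over all compatible pairs in the maximal Dyck path $\mathcal D$ of type $[a_1]_+\times[a_2]_+$, with $[a]_+=\max(a,0)$. Here $\mathcal D$ is the highest lattice path with unit steps right and up from $(0,0)$ to $([a_1]_+,[a_2]_+)$ that never goes above the straight segment joining these two points. A pair of a set $S_1$ of horizontal edges and a set $S_2$ of vertical edges of $\mathcal D$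 is compatible if for all $u\in S_1$, $v\in S_2$, with $E$ the left endpoint of $u$ and $F$ the upper endpoint of $v$, there is a lattice point $A\neq E,F$ on the subpath $EF$ such that the number of horizontal edges of $AF$ is $b$ times the number of edges of $AF$ in $S_2$, or the number of vertical edges of $EA$ is $c$ times the number of edges of $EA$ in $S_1$. (Subpaths run in the north-east direction; the two endpoints of $\mathcal D$ are identified, so that a subpath may continue from the end of $\mathcal D$ to its beginning; if $E=F$, then $EF$ is the whole closed path.) Define $$p=\begin{cases}x[bc-b+1,c+1]+x[b+1,bc-c+1]-x[1,1] & \text{if }\min(b,c)>1,\\ x[b+2,3]+x[b+2,b-1]-x[2,1] & \text{if }c=1,\\ x[3,c+2]+x[c-1,c+2]-x[1,2] & \text{if }b=1.\end{cases}$$ Then $p$ is a positive element of $\mathcal A(b,c)$. Moreover, the greedy elements $x[a_1,a_2]$, $(a_1,a_2)\in\mathbb Z^2$, form a $\mathbb Z$-basis of $\mathcal A(b,c)$, and the expansion of $p$ in this basis has at least one negative coefficient. -/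

import Mathlib

namespace RankTwoCluster

noncomputable section

/-- The ambient field `ℚ(x₁, x₂)`. -/
abbrev AmbientField : Type := FractionRing (MvPolynomial (Fin 2) ℚ)

/-- The initial cluster variable `x₁`. -/
def x₁ : AmbientField := algebraMap (MvPolynomial (Fin 2) ℚ) AmbientField (MvPolynomial.X 0)

/-- The initial cluster variable `x₂`. -/
def x₂ : AmbientField := algebraMap (MvPolynomial (Fin 2) ℚ) AmbientField (MvPolynomial.X 1)

/-- The exponent in the exchange relation `x_{m-1} x_{m+1} = x_m ^ (exchangeExp b c m) + 1`:
it is `b` for `m` odd and `c` for `m` even. -/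
def exchangeExp (b c : ℕ) (m : ℤ) : ℕ := if Odd m then b else c

/-- The cluster variables to the right: `forwardVar b c n` is `x_{n+1}`. -/
def forwardVar (b c : ℕ) : ℕ → AmbientField
  | 0 => x₁
  | 1 => x₂
  | n + 2 => (forwardVar b c (n + 1) ^ exchangeExp b c (n + 2) + 1) / forwardVar b c n

/-- The cluster variables to the left: `backwardVar b c n` is `x_{2-n}`. -/
def backwardVar (b c : ℕ) : ℕ → AmbientField
  | 0 => x₂
  | 1 => x₁
  | n + 2 => (backwardVar b c (n + 1) ^ exchangeExp b c (1 - n) + 1) / backwardVar b c n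

/-- The two-sided sequence of cluster variables `x_m`, `m ∈ ℤ`, determined by `x₁`, `x₂` and
the exchange relations `x_{m-1} x_{m+1} = x_m ^ b + 1` (`m` odd), `x_m ^ c + 1` (`m` even). -/
def clusterVar (b c : ℕ) (m : ℤ) : AmbientField :=
  if 1 ≤ m then forwardVar b c (m - 1).toNat else backwardVar b c (2 - m).toNat

/-- The cluster algebra `𝒜(b,c)`: the subring of `ℚ(x₁, x₂)` generated by all cluster
variables. -/
def clusterAlgebra (b c : ℕ) : Subring AmbientField :=
  Subring.closure (Set.range (clusterVar b c))

/-- The value at `(y, z)` of the Laurent polynomial with integer coefficients `f`, where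
`f (i, j)` is the coefficient of `y ^ i * z ^ j`. -/
def laurentEval (y z : AmbientField) (f : ℤ × ℤ →₀ ℤ) : AmbientField :=
  f.sum fun e k => (k : AmbientField) * (y ^ e.1 * z ^ e.2)

/-- `x` is positive at the cluster `{x_m, x_{m+1}}`: it is a nonzero element of `𝒜(b,c)`, and
all the coefficients occurring in its expansion as a Laurent polynomial in `x_m`, `x_{m+1}` are
positive. (The expansion is unique, `x_m` and `x_{m+1}` being algebraically independent.) -/
def IsPositiveAt (b c : ℕ) (m : ℤ) (x : AmbientField) : Prop :=
  x ∈ clusterAlgebra b c ∧ x ≠ 0 ∧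
    ∃ f : ℤ × ℤ →₀ ℤ, laurentEval (clusterVar b c m) (clusterVar b c (m + 1)) f = x ∧
      ∀ e ∈ f.support, 0 < f e

/-- `x` is a positive element of `𝒜(b,c)`: it is positive at every cluster. -/
def IsPositive (b c : ℕ) (x : AmbientField) : Prop :=
  ∀ m : ℤ, IsPositiveAt b c m x

end

/-- The lattice points of the maximal Dyck path of type `a₁ × a₂` in the order in which the path
runs from `(0,0)` (step `0`) to `(a₁,a₂)` (step `a₁ + a₂`). The maximal path goes up whenever
the lattice point above is not above the main diagonal, and goes right otherwise. -/
def dyckPoint (a₁ a₂ : ℕ) : ℕ → ℕ × ℕ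
  | 0 => (0, 0)
  | k + 1 =>
    let P := dyckPoint a₁ a₂ k
    if P.2 < a₂ ∧ (P.2 + 1) * a₁ ≤ P.1 * a₂ then (P.1, P.2 + 1) else (P.1 + 1, P.2)

/-- The horizontal edges of the maximal Dyck path; the edge numbered `k < a₁ + a₂` joins
`dyckPoint a₁ a₂ k` to `dyckPoint a₁ a₂ (k + 1)`. -/
def horizontalEdges (a₁ a₂ : ℕ) : Finset ℕ :=
  (Finset.range (a₁ + a₂)).filter fun k =>
    (dyckPoint a₁ a₂ (k + 1)).2 = (dyckPoint a₁ a₂ k).2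

/-- The vertical edges of the maximal Dyck path. -/
def verticalEdges (a₁ a₂ : ℕ) : Finset ℕ :=
  (Finset.range (a₁ + a₂)).filter fun k =>
    (dyckPoint a₁ a₂ (k + 1)).1 = (dyckPoint a₁ a₂ k).1

/-- Consider a path with `N` edges, closed up by identifying its two endpoints. This is the number
of edges in `T` among those reached from the lattice point numbered `s` after at least `i` and
fewer than `j` steps, i.e. on the subpath from the point `s + i` to the point `s + j` (mod `N`). -/
def edgeCount (N : ℕ) (T : Finset ℕ) (s i j : ℕ) : ℕ :=
  ((Finset.Ico i j).filter fun k => (s + k) % N ∈ T).card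

/-- The length of the (cyclic) subpath `EF`, where `E` is the left endpoint of the edge `u` and
`F` is the upper endpoint of the edge `v`; it is the whole closed path if `E = F`. -/
def subpathLength (N u v : ℕ) : ℕ := (v + N - u) % N + 1

/-- Compatibility of `S₁` (horizontal edges) and `S₂` (vertical edges): for every `u ∈ S₁` and
`v ∈ S₂`, with `E` the left endpoint of `u` and `F` the upper endpoint of `v`, there is a lattice
point `A` on the subpath `EF`, different from its endpoints (`A` is reached from `E` after `l`
steps), such that `|(AF)₁| = b |(AF)₂ ∩ S₂|` or `|(EA)₂| = c |(EA)₁ ∩ S₁|`. -/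
def Compatible (b c a₁ a₂ : ℕ) (S₁ S₂ : Finset ℕ) : Prop :=
  ∀ u ∈ S₁, ∀ v ∈ S₂, ∃ l ∈ Finset.Ioo 0 (subpathLength (a₁ + a₂) u v),
    edgeCount (a₁ + a₂) (horizontalEdges a₁ a₂) u l (subpathLength (a₁ + a₂) u v) =
        b * edgeCount (a₁ + a₂) S₂ u l (subpathLength (a₁ + a₂) u v) ∨
      edgeCount (a₁ + a₂) (verticalEdges a₁ a₂) u 0 l = c * edgeCount (a₁ + a₂) S₁ u 0 l

instance (b c a₁ a₂ : ℕ) (S₁ S₂ : Finset ℕ) : Decidable (Compatible b c a₁ a₂ S₁ S₂) := by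
  unfold Compatible; infer_instance

/-- All compatible pairs `(S₁, S₂)` in the maximal Dyck path of type `a₁ × a₂`. -/
def compatiblePairs (b c a₁ a₂ : ℕ) : Finset (Finset ℕ × Finset ℕ) :=
  ((horizontalEdges a₁ a₂).powerset ×ˢ (verticalEdges a₁ a₂).powerset).filter fun S =>
    Compatible b c a₁ a₂ S.1 S.2

noncomputable section

/-- The greedy element `x[a₁, a₂]`, for `(a₁, a₂) ∈ ℤ²`. The sum is over the compatible pairs in
the maximal Dyck path of type `[a₁]₊ × [a₂]₊`, where `[a]₊ = max(a, 0)`. -/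
def greedy (b c : ℕ) (a : ℤ × ℤ) : AmbientField :=
  x₁ ^ (-a.1) * x₂ ^ (-a.2) *
    ∑ S ∈ compatiblePairs b c a.1.toNat a.2.toNat, x₁ ^ (b * S.2.card) * x₂ ^ (c * S.1.card)

/-- The explicit element `p`. -/
def explicitElement (b c : ℕ) : AmbientField :=
  if 1 < min b c then
    greedy b c ((b : ℤ) * c - b + 1, (c : ℤ) + 1) + greedy b c ((b : ℤ) + 1, (b : ℤ) * c - c + 1)
      - greedy b c (1, 1)
  else if c = 1 then
    greedy b c ((b : ℤ) + 2, 3) + greedy b c ((b : ℤ) + 2, (b : ℤ) - 1) - greedy b c (2, 1)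
  else
    greedy b c (3, (c : ℤ) + 2) + greedy b c ((c : ℤ) - 1, (c : ℤ) + 2) - greedy b c (1, 2)

end

end RankTwoCluster

/-! The element p has the form x[n+be, h+cn] + x[n+bh, h+ck] - x[n, h], where e, n, h, k are
consecutive terms of a sequence with e + h = cn and n + k = bh, and D = beh - cn² is a positive
invariant. When the cluster changes, the type (a₁, a₂) of a greedy element becomes (a₂, b a₂ - a₁),
with b and c exchanged, as long as the entries stay positive. This carries the three types to types
of the same shape for the shifted sequence n, h, k, ck - h (`HasDominatedExpansion.next`).
Positivity in all clusters thus becomes one inequality between numbers of compatible pairs, to be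
proved in every state of the recursion. The negative coefficient is the visible -1 at x[n, h].

Greedy elements. Extend the Dyck path periodically and give the abscissa x the potential x - b
(number of selected vertical edges up to there). A horizontal edge is shadowed if the potential
later returns to its level or below. Compatibility involves only the shadowed edges of S₁, and if S₂
has q edges there are exactly max(a₁ - bq, 0) unshadowed edges per period. So the q-th row of
coefficients is (1 + X)^(a₁ - bq) times the generating polynomial of the local pairs, those with S₁
in the shadow (`rowPoly_eq`). By reflection the columns factor likewise. The cluster algebra
consists of the Laurent polynomials with divisibilities of this kind (`mem_clusterAlgebra_iff`), so
it contains the greedy elements. Each of these has coefficient 1 at the exponent -a and its support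
in a controlled box, whence lexicographic elimination makes them a basis. A slope bound for local
pairs (`Admissible.slope_bound`) confines the support to a region in which a Laurent polynomial with
the divisibilities vanishes as soon as its corner coefficient does (`eq_zero_of_greedyRegion`).
Hence the mutation of a greedy element is greedy (`mutation_eq`).

The inequality (`pairCount_le_add`). The coefficient of x[n, h] with sizes (p, q) stands at the same
exponent as those of the two larger elements with sizes (p+n, q+e) and (p+k, q+h). The columns with
cp < h are dominated by the second larger element: such columns come by mutation from rows whose
support lies in columns of the same kind, so domination is inherited, and at the start only the
column p = 0 is concerned. The row q = 0 is binomial and is dominated by the first larger element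
through one explicit local pair (`choose_le_pairCount`). In the remaining rows, 0 < q and bq < n,
local pairs are transplanted injectively into the larger path: the old pair is kept near the origin,
where the old and new paths coincide, and h consecutive vertical edges are added (`localCount_le`).
That the result is compatible is arithmetic. It uses be ≤ 2n and a gap property: bhq - cnp takes
values in (0, D] for positive q only if q ≥ e. Both conditions are inherited along the recursion; in
the first two states no such rows exist. -/

namespace RankTwoCluster

/-! ### The periodic Dyck path and periodic counting functions. -/

/-- The height of the maximal Dyck path of type `a₁ × a₂`, extended periodically, above `x`. -/
def height (a₁ a₂ : ℕ) (x : ℤ) : ℤ := x * a₂ / a₁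

/-- The abscissa of the vertical edge numbered `j` of the periodically extended Dyck path. -/
def abscissa (a₁ a₂ : ℕ) (j : ℤ) : ℤ := -height a₂ a₁ (-(j + 1))

/-- Height is a linear function rounded down and abscissa one rounded up, so they form a Galois
connection. Comparisons of horizontal with vertical positions go through it. -/
theorem abscissa_le_iff {a₁ a₂ : ℕ} (h₁ : 0 < a₁) (h₂ : 0 < a₂) {j x : ℤ} :
    abscissa a₁ a₂ j ≤ x ↔ j < height a₁ a₂ x := by
  have h₁' : (0 : ℤ) < a₁ := by exact_mod_cast h₁
  have h₂' : (0 : ℤ) < a₂ := by exact_mod_cast h₂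
  unfold abscissa height
  rw [neg_le, Int.le_ediv_iff_mul_le h₂', ← Int.add_one_le_iff, Int.le_ediv_iff_mul_le h₁']
  constructor <;> intro h <;> linarith

theorem lt_height_iff {a₁ a₂ : ℕ} (h₁ : 0 < a₁) {j x : ℤ} :
    j < height a₁ a₂ x ↔ (j + 1) * a₁ ≤ x * a₂ := by
  have h₁' : (0 : ℤ) < a₁ := by exact_mod_cast h₁
  unfold height
  rw [← Int.add_one_le_iff, Int.le_ediv_iff_mul_le h₁']

theorem le_height_iff {a₁ a₂ : ℕ} (h₁ : 0 < a₁) {j x : ℤ} :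
    j ≤ height a₁ a₂ x ↔ j * a₁ ≤ x * a₂ := by
  have h₁' : (0 : ℤ) < a₁ := by exact_mod_cast h₁
  unfold height
  rw [Int.le_ediv_iff_mul_le h₁']

theorem abscissa_le_iff_mul {a₁ a₂ : ℕ} (h₁ : 0 < a₁) (h₂ : 0 < a₂) {j x : ℤ} :
    abscissa a₁ a₂ j ≤ x ↔ (j + 1) * a₁ ≤ x * a₂ := by
  rw [abscissa_le_iff h₁ h₂, lt_height_iff h₁]

theorem lt_abscissa_iff {a₁ a₂ : ℕ} (h₁ : 0 < a₁) (h₂ : 0 < a₂) {j x : ℤ} :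
    x < abscissa a₁ a₂ j ↔ height a₁ a₂ x ≤ j := by
  rw [← not_le, abscissa_le_iff h₁ h₂, not_lt]

theorem height_abscissa {a₁ a₂ : ℕ} (h₁ : 0 < a₁) (h₂ : 0 < a₂) (j : ℤ) :
    j < height a₁ a₂ (abscissa a₁ a₂ j) := (abscissa_le_iff h₁ h₂).1 le_rfl

theorem height_mono {a₁ a₂ : ℕ} (h₁ : 0 < a₁) : Monotone (height a₁ a₂) := by
  intro x y h
  have h₁' : (0 : ℤ) < a₁ := by exact_mod_cast h₁
  unfold height
  exact Int.ediv_le_ediv h₁' (by nlinarith [Int.natCast_nonneg a₂])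

theorem abscissa_mono {a₁ a₂ : ℕ} (h₂ : 0 < a₂) : Monotone (abscissa a₁ a₂) := by
  intro x y h
  unfold abscissa
  have := height_mono (a₁ := a₂) (a₂ := a₁) h₂ (show -(y + 1) ≤ -(x + 1) by omega)
  omega

theorem height_add_period {a₁ a₂ : ℕ} (h₁ : 0 < a₁) (x : ℤ) :
    height a₁ a₂ (x + a₁) = height a₁ a₂ x + a₂ := by
  have h₁' : (a₁ : ℤ) ≠ 0 := by positivity
  unfold height
  rw [show (x + a₁) * (a₂ : ℤ) = x * a₂ + a₂ * a₁ by ring, Int.add_mul_ediv_right _ _ h₁']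

theorem abscissa_add_period {a₁ a₂ : ℕ} (h₂ : 0 < a₂) (j : ℤ) :
    abscissa a₁ a₂ (j + a₂) = abscissa a₁ a₂ j + a₁ := by
  unfold abscissa
  have := height_add_period (a₁ := a₂) (a₂ := a₁) h₂ (-(j + a₂ + 1))
  rw [show -(j + a₂ + 1) + (a₂ : ℤ) = -(j + 1) by ring] at this
  omega

@[simp] theorem height_zero (a₁ a₂ : ℕ) : height a₁ a₂ 0 = 0 := by simp [height]

/-- The signed number of elements of `[0, x)` that are congruent modulo `N` to an element
of `S`. -/
def cum (N : ℕ) (S : Finset ℕ) (x : ℤ) : ℤ := ∑ i ∈ S, ((x - 1 - i) / N + 1)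

theorem cum_add_period {N : ℕ} (hN : 0 < N) (S : Finset ℕ) (x : ℤ) :
    cum N S (x + N) = cum N S x + S.card := by
  have hN' : (N : ℤ) ≠ 0 := by positivity
  unfold cum
  rw [Finset.card_eq_sum_ones, Nat.cast_sum, ← Finset.sum_add_distrib]
  refine Finset.sum_congr rfl fun i _ => ?_
  rw [show x + N - 1 - (i : ℤ) = x - 1 - i + 1 * N by ring, Int.add_mul_ediv_right _ _ hN']
  push_cast; ring

theorem div_succ_eq {N : ℕ} (hN : 0 < N) (t : ℤ) :
    t / N = (t - 1) / N + if (N : ℤ) ∣ t then 1 else 0 := by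
  have hN' : (0 : ℤ) < N := by exact_mod_cast hN
  have h1 := Int.emod_add_mul_ediv t N
  have h2 := Int.emod_nonneg t hN'.ne'
  have h3 := Int.emod_lt_of_pos t hN'
  split_ifs with h
  · obtain ⟨k, rfl⟩ := h
    rw [Int.mul_ediv_cancel_left _ hN'.ne', show (N : ℤ) * k - 1 = -1 + k * N by ring,
      Int.add_mul_ediv_right _ _ hN'.ne', Int.ediv_eq_neg_one_of_neg_of_le (by norm_num) (by omega)]
    ring
  · have h4 : t % N ≠ 0 := fun h' => h (Int.dvd_of_emod_eq_zero h')
    have : (t - 1) / N = t / N := by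
      rw [show t - 1 = (t % N - 1) + t / N * N by linarith, Int.add_mul_ediv_right _ _ hN'.ne',
        Int.ediv_eq_zero_of_lt (by omega) (by omega)]
      ring
    omega

theorem cum_succ {N : ℕ} {S : Finset ℕ} (hS : S ⊆ Finset.range N) (x : ℤ) :
    cum N S (x + 1) = cum N S x + if (x % N).toNat ∈ S then 1 else 0 := by
  rcases Nat.eq_zero_or_pos N with rfl | hN
  · have : S = ∅ := by simpa using hS
    simp [this, cum]
  have hN' : (0 : ℤ) < N := by exact_mod_cast hN
  have h2 := Int.emod_nonneg x hN'.ne'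
  have h3 := Int.emod_lt_of_pos x hN'
  have h1 := Int.emod_add_mul_ediv x N
  have key : ∀ i ∈ S, ((N : ℤ) ∣ x - i ↔ i = (x % N).toNat) := by
    intro i hi
    have hi' : i < N := by simpa using hS hi
    constructor
    · rintro ⟨k, hk⟩
      have : x % N = i := by
        rw [show x = i + N * k by linarith, Int.add_mul_emod_self_left]
        exact Int.emod_eq_of_lt (by omega) (by omega)
      omega
    · intro h
      exact ⟨x / N, by have : (i : ℤ) = x % N := by omega
                       linarith⟩
  unfold cum
  have : ∀ i ∈ S, ((x + 1 - 1 - (i : ℤ)) / N + 1) =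
      ((x - 1 - i) / N + 1) + if i = (x % N).toNat then 1 else 0 := by
    intro i hi
    rw [show x + 1 - 1 - (i : ℤ) = x - i by ring, div_succ_eq hN (x - i),
      show x - (i : ℤ) - 1 = x - 1 - i by ring]
    simp only [key i hi]
    ring
  rw [Finset.sum_congr rfl this, Finset.sum_add_distrib, Finset.sum_ite_eq']

theorem cum_zero {N : ℕ} {S : Finset ℕ} (hS : S ⊆ Finset.range N) : cum N S 0 = 0 := by
  unfold cum
  refine Finset.sum_eq_zero fun i hi => ?_
  have hi' : i < N := by simpa using hS hi
  rw [Int.ediv_eq_neg_one_of_neg_of_le (by omega) (by omega)]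
  ring

theorem cum_period {N : ℕ} {S : Finset ℕ} (hN : 0 < N) (hS : S ⊆ Finset.range N) :
    cum N S N = S.card := by
  have := cum_add_period hN S 0
  rw [cum_zero hS] at this
  simpa using this

/-- The index i becomes N - 1 - i because an edge is numbered by its starting point, which
reflection turns into its end point. -/
theorem cum_reflect {N : ℕ} {S : Finset ℕ} (hN : 0 < N) (hS : S ⊆ Finset.range N) (x : ℤ) :
    cum N (S.image fun i => N - 1 - i) x = -cum N S (-x) := by
  have hN' : (N : ℤ) ≠ 0 := by positivity
  unfold cum
  rw [Finset.sum_image, ← Finset.sum_neg_distrib]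
  · refine Finset.sum_congr rfl fun i hi => ?_
    have hi' : i < N := by simpa using hS hi
    have e : ((N - 1 - i : ℕ) : ℤ) = N - 1 - i := by omega
    rw [e, show x - 1 - ((N : ℤ) - 1 - i) = (x + i) + (-1) * N by ring,
      Int.add_mul_ediv_right _ _ hN', show -x - 1 - (i : ℤ) = -(x + i) - 1 by ring]
    have := div_succ_eq hN (-(x + i : ℤ))
    have h2 := Int.emod_add_mul_ediv (x + i : ℤ) N
    by_cases hd : (N : ℤ) ∣ x + i
    · rw [if_pos (by rwa [dvd_neg])] at this
      obtain ⟨k, hk⟩ := hd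
      rw [hk] at this ⊢
      rw [show -((N : ℤ) * k) = N * (-k) by ring, Int.mul_ediv_cancel_left _ hN'] at this
      rw [Int.mul_ediv_cancel_left _ hN', show -((N : ℤ) * k) = N * (-k) by ring]
      omega
    · rw [if_neg (by rwa [dvd_neg])] at this
      have : (-(x + i : ℤ)) / N = -((x + i : ℤ) / N) - 1 := by
        have hp : (0 : ℤ) < N := by exact_mod_cast hN
        have h4 := Int.emod_nonneg (x + i : ℤ) hN'
        have h5 := Int.emod_lt_of_pos (x + i : ℤ) hp
        have h6 : (x + i : ℤ) % N ≠ 0 := fun h' => hd (Int.dvd_of_emod_eq_zero h')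
        rw [show -(x + i : ℤ) = (N - (x + i : ℤ) % N) + (-((x + i : ℤ) / N) - 1) * N by linarith,
          Int.add_mul_ediv_right _ _ hN', Int.ediv_eq_zero_of_lt (by omega) (by omega)]
        ring
      omega
  · intro i hi j hj h
    have hi' : i < N := by simpa using hS hi
    have hj' : j < N := by simpa using hS hj
    simp only at h
    omega

/-- An integer-valued function all of whose steps are `0` or `1`. -/
def UnitSteps (C : ℤ → ℤ) : Prop := ∀ x, C (x + 1) = C x ∨ C (x + 1) = C x + 1

theorem unitSteps_cum {N : ℕ} {S : Finset ℕ} (hS : S ⊆ Finset.range N) : UnitSteps (cum N S) := by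
  intro x
  rw [cum_succ hS]
  split_ifs <;> simp

theorem cum_succ_ne_iff {N : ℕ} {S : Finset ℕ} (hS : S ⊆ Finset.range N) (x : ℤ) :
    cum N S (x + 1) ≠ cum N S x ↔ (x % N).toNat ∈ S := by
  rw [cum_succ hS]
  split_ifs with h <;> simp [h]

theorem UnitSteps.monotone {C : ℤ → ℤ} (h : UnitSteps C) : Monotone C :=
  monotone_int_of_le_succ fun x => by rcases h x with h | h <;> omega

end RankTwoCluster

/-! ### Compatibility, potentials and shadows. -/

namespace RankTwoCluster

/-- Compatibility in terms of the cumulative counting functions of the two sets of edges of the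
periodically extended Dyck path. -/
def Admissible (b c a₁ a₂ : ℕ) (C₁ C₂ : ℤ → ℤ) : Prop :=
  ∀ k j, C₁ (k + 1) ≠ C₁ k → C₂ (j + 1) ≠ C₂ j → k < abscissa a₁ a₂ j →
    abscissa a₁ a₂ j ≤ k + a₁ →
    (∃ j', height a₁ a₂ k ≤ j' ∧ j' < j ∧
      c * (C₁ (abscissa a₁ a₂ j') - C₁ k) ≤ j' + 1 - height a₁ a₂ k) ∨
    ∃ k', k < k' ∧ k' < abscissa a₁ a₂ j ∧
      b * (C₂ (j + 1) - C₂ (height a₁ a₂ k')) ≤ abscissa a₁ a₂ j - k'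

/-- The reflection (x, y) ↦ (-y, -x) maps the periodic path of type a₁ × a₂ to that of type a₂ × a₁,
keeps the side of the diagonal, and reverses the direction. It therefore exchanges the two
alternatives. -/
theorem Admissible.reflect {b c a₁ a₂ : ℕ} (h₁ : 0 < a₁) (h₂ : 0 < a₂) {C₁ C₂ : ℤ → ℤ}
    (h : Admissible b c a₁ a₂ C₁ C₂) :
    Admissible c b a₂ a₁ (fun x => -C₂ (-x)) (fun x => -C₁ (-x)) := by
  have hX : ∀ j, abscissa a₂ a₁ j = -height a₁ a₂ (-(j + 1)) := fun j => rfl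
  have hY : ∀ k, height a₂ a₁ k = -abscissa a₁ a₂ (-k - 1) := fun k => by
    unfold abscissa
    rw [show -(-k - 1 + 1) = k by ring, neg_neg]
  intro k j hk hj hlt hle
  rw [hX] at hlt hle
  have e1 : -(k + 1) = -k - 1 := by ring
  have e2 : -(j + 1) = -j - 1 := by ring
  have hlt' : -j - 1 < abscissa a₁ a₂ (-k - 1) := by
    rw [lt_abscissa_iff h₁ h₂, ← e2]; omega
  have hle' : abscissa a₁ a₂ (-k - 1) ≤ (-j - 1) + a₁ := by
    have : -k - 1 - a₂ < height a₁ a₂ (-j - 1) := by rw [← e2]; omega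
    rw [← abscissa_le_iff h₁ h₂] at this
    have h3 := abscissa_add_period (a₁ := a₁) h₂ (-k - 1 - a₂)
    rw [sub_add_cancel] at h3
    omega
  rcases h (-j - 1) (-k - 1) (fun hh => hj (by
      simp only [e2, neg_inj]; rw [sub_add_cancel] at hh; exact hh.symm)) (fun hh => hk (by
      simp only [e1, neg_inj]; rw [sub_add_cancel] at hh; exact hh.symm)) hlt' hle' with
    ⟨j', h3, h4, h5⟩ | ⟨k', h3, h4, h5⟩
  · right
    refine ⟨-1 - j', by omega, ?_, ?_⟩
    · rw [hX, e2]; omega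
    · simp only
      rw [hX, hY, e2, show -(-1 - j') - 1 = j' by ring, neg_neg]
      have : c * (-C₁ (-j - 1) - -C₁ (abscissa a₁ a₂ j')) =
        c * (C₁ (abscissa a₁ a₂ j') - C₁ (-j - 1)) := by ring
      omega
  · left
    refine ⟨-1 - k', ?_, by omega, ?_⟩
    · rw [hY]; omega
    · simp only
      rw [hX, hY, show -(-1 - k' + 1) = k' by ring, neg_neg]
      rw [show -k - 1 + 1 = -k by ring] at h5
      have : b * (-C₂ (height a₁ a₂ k') - -C₂ (-k)) = b * (C₂ (-k) - C₂ (height a₁ a₂ k')) := by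
        ring
      omega

theorem Admissible.congr {b c a₁ a₂ : ℕ} {C₁ C₂ D₁ D₂ : ℤ → ℤ} (h : Admissible b c a₁ a₂ C₁ C₂)
    (e₁ : C₁ = D₁) (e₂ : C₂ = D₂) : Admissible b c a₁ a₂ D₁ D₂ := by subst e₁ e₂; exact h

/-- The potential at the top of the path above `x`. -/
def pot (b a₁ a₂ : ℕ) (C₂ : ℤ → ℤ) (x : ℤ) : ℤ := x - b * C₂ (height a₁ a₂ x)

/-- The horizontal edge `k` lies in the shadow of the set of vertical edges counted by `C₂`. -/
def Shadowed (b a₁ a₂ : ℕ) (C₂ : ℤ → ℤ) (k : ℤ) : Prop :=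
  ∃ x, k < x ∧ pot b a₁ a₂ C₂ x ≤ pot b a₁ a₂ C₂ k

/-- The horizontal edge `k` is reached from the vertical edge `j` before the numbers of
horizontal edges and of counted vertical edges balance. -/
def Reaches (b a₁ a₂ : ℕ) (C₂ : ℤ → ℤ) (k j : ℤ) : Prop :=
  ∀ k', k < k' → k' < abscissa a₁ a₂ j →
    abscissa a₁ a₂ j - k' < b * (C₂ (j + 1) - C₂ (height a₁ a₂ k'))

theorem UnitSteps.exists_last_step {C : ℤ → ℤ} (h : UnitSteps C) {p q : ℤ} (hpq : C p < C q) :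
    ∃ j, p ≤ j ∧ j < q ∧ C (j + 1) ≠ C j ∧ C (j + 1) = C q := by
  have hlt : p < q := by
    by_contra hh
    exact absurd (h.monotone (not_lt.1 hh)) (not_le.2 hpq)
  obtain ⟨n, rfl⟩ := Int.le.dest hlt.le
  induction n with
  | zero => simp at hpq
  | succ n ih =>
    push_cast at *
    rw [← add_assoc] at *
    by_cases hs : C (p + n + 1) = C (p + n)
    · rw [hs] at hpq
      have hlt' : p < p + n := by
        rcases Nat.eq_zero_or_pos n with rfl | h0
        · simp at hpq
        · omega
      obtain ⟨j, h1, h2, h3, h4⟩ := ih hpq hlt'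
      exact ⟨j, h1, by omega, h3, by rw [h4, hs]⟩
    · exact ⟨p + n, by omega, by omega, hs, rfl⟩

section
variable {b c a₁ a₂ : ℕ} {C₁ C₂ : ℤ → ℤ}

/-- The strict inequality at k' = k + 1 is between integers and absorbs the unit gained in passing
from k to k + 1. If j stands already at k + 1, then j itself is counted and outweighs that unit
because b ≥ 1. -/
theorem Reaches.pot_le (hb : 0 < b) (h₁ : 0 < a₁) (h₂ : 0 < a₂) (hC₂ : UnitSteps C₂) {k j : ℤ}
    (hj : C₂ (j + 1) ≠ C₂ j) (hk : k < abscissa a₁ a₂ j) (h : Reaches b a₁ a₂ C₂ k j) :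
    pot b a₁ a₂ C₂ (abscissa a₁ a₂ j) ≤ pot b a₁ a₂ C₂ k := by
  have hb' : (1 : ℤ) ≤ b := by exact_mod_cast hb
  have h1 : C₂ (j + 1) ≤ C₂ (height a₁ a₂ (abscissa a₁ a₂ j)) :=
    hC₂.monotone (height_abscissa h₁ h₂ j)
  have h2 : (b : ℤ) * C₂ (j + 1) ≤ b * C₂ (height a₁ a₂ (abscissa a₁ a₂ j)) := by gcongr
  unfold pot
  rcases lt_or_eq_of_le (show k + 1 ≤ abscissa a₁ a₂ j from hk) with hlt | heq
  · have h3 := h (k + 1) (by omega) hlt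
    have h4 : C₂ (height a₁ a₂ k) ≤ C₂ (height a₁ a₂ (k + 1)) :=
      hC₂.monotone (height_mono h₁ (by omega))
    have h5 : (b : ℤ) * C₂ (height a₁ a₂ k) ≤ b * C₂ (height a₁ a₂ (k + 1)) := by gcongr
    rw [mul_sub] at h3
    omega
  · have h3 : height a₁ a₂ k ≤ j := (lt_abscissa_iff h₁ h₂).1 hk
    have h4 := hC₂.monotone h3
    have h5 := hC₂ j
    have h6 : C₂ (height a₁ a₂ k) + 1 ≤ C₂ (j + 1) := by rcases h5 with h5 | h5 <;> omega
    have h7 : (b : ℤ) * (C₂ (height a₁ a₂ k) + 1) ≤ b * C₂ (j + 1) := by gcongr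
    rw [mul_add] at h7
    omega

theorem Reaches.shadowed (hb : 0 < b) (h₁ : 0 < a₁) (h₂ : 0 < a₂) (hC₂ : UnitSteps C₂) {k j : ℤ}
    (hj : C₂ (j + 1) ≠ C₂ j) (hk : k < abscissa a₁ a₂ j) (h : Reaches b a₁ a₂ C₂ k j) :
    Shadowed b a₁ a₂ C₂ k := ⟨_, hk, h.pot_le hb h₁ h₂ hC₂ hj hk⟩

theorem exists_first_le {f : ℤ → ℤ} {k x : ℤ} (hkx : k < x) {w : ℤ} (hx : f x ≤ w) :
    ∃ z, k < z ∧ z ≤ x ∧ f z ≤ w ∧ ∀ y, k < y → y < z → w < f y := by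
  obtain ⟨z, ⟨h1, h2⟩, h3⟩ := Int.exists_least_of_bdd (P := fun z => k < z ∧ f z ≤ w)
    ⟨k, fun z hz => hz.1.le⟩ ⟨x, hkx, hx⟩
  refine ⟨z, h1, h3 x ⟨hkx, hx⟩, h2, fun y hy hyz => ?_⟩
  by_contra hh
  exact absurd (h3 y ⟨hy, not_lt.1 hh⟩) (not_le.2 hyz)

/-- Let z be the first return of the potential to the level of k or below. The potential does not
increase in the step before z, so a counted vertical edge stands at z, and the minimality of z says
that this edge reaches k. -/
theorem exists_reaches (h₁ : 0 < a₁) (h₂ : 0 < a₂) (hC₂ : UnitSteps C₂) {k x : ℤ} (hkx : k < x)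
    (hx : pot b a₁ a₂ C₂ x ≤ pot b a₁ a₂ C₂ k) :
    ∃ j, C₂ (j + 1) ≠ C₂ j ∧ k < abscissa a₁ a₂ j ∧ abscissa a₁ a₂ j ≤ x ∧
      Reaches b a₁ a₂ C₂ k j := by
  obtain ⟨z, hkz, hzx, hz, hmin⟩ := exists_first_le hkx hx
  have hlt : C₂ (height a₁ a₂ (z - 1)) < C₂ (height a₁ a₂ z) := by
    have hW : pot b a₁ a₂ C₂ z ≤ pot b a₁ a₂ C₂ (z - 1) := by
      rcases lt_or_eq_of_le (show k ≤ z - 1 by omega) with h | h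
      · exact hz.trans (hmin _ h (by omega)).le
      · rwa [← h]
    unfold pot at hW
    by_contra hh
    have : (b : ℤ) * C₂ (height a₁ a₂ z) ≤ b * C₂ (height a₁ a₂ (z - 1)) := by
      have := not_lt.1 hh
      gcongr
    omega
  obtain ⟨j, h3, h4, h5, h6⟩ := hC₂.exists_last_step hlt
  have hX : abscissa a₁ a₂ j = z := by
    apply le_antisymm
    · rwa [abscissa_le_iff h₁ h₂]
    · rw [← lt_abscissa_iff h₁ h₂] at h3; omega
  refine ⟨j, h5, hX ▸ hkz, hX ▸ hzx, fun k' hk' hk'' => ?_⟩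
  rw [hX] at hk'' ⊢
  have := hmin k' hk' hk''
  rw [h6, mul_sub]
  unfold pot at this hz
  omega

/-- On a stretch of the path that ends where the potential is minimal, the edges in `S₁` are
balanced by fewer vertical edges than there are. -/
theorem Admissible.mul_sub_le (h₁ : 0 < a₁) (h₂ : 0 < a₂)
    (hC₂ : UnitSteps C₂) (h : Admissible b c a₁ a₂ C₁ C₂) {k₀ x₀ : ℤ} (hlt : k₀ < x₀)
    (hle : x₀ ≤ k₀ + a₁)
    (hmin : ∀ k, k₀ ≤ k → k < x₀ → pot b a₁ a₂ C₂ x₀ ≤ pot b a₁ a₂ C₂ k) :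
    c * (C₁ x₀ - C₁ k₀) ≤ height a₁ a₂ x₀ - 1 - height a₁ a₂ k₀ := by
  -- Induction leftwards from x₀. By minimality each k is reached by some counted vertical edge
  -- before x₀, which excludes the second alternative for a selected k; the first lets the induction
  -- jump to the abscissa of j'.
  suffices H : ∀ n : ℕ, ∀ k, k = x₀ - 1 - n → k₀ ≤ k →
      c * (C₁ x₀ - C₁ k) ≤ height a₁ a₂ x₀ - 1 - height a₁ a₂ k from
    H (x₀ - 1 - k₀).toNat k₀ (by omega) le_rfl
  intro n
  induction n using Nat.strong_induction_on with
  | _ n ih =>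
  intro k hk hk₀
  obtain ⟨j, hj, hkj, hjx, hr⟩ := exists_reaches h₁ h₂ hC₂ (show k < x₀ by omega)
    (hmin k hk₀ (by omega))
  have hyj : height a₁ a₂ k ≤ j := (lt_abscissa_iff h₁ h₂).1 hkj
  have hjy : j < height a₁ a₂ x₀ := (abscissa_le_iff h₁ h₂).1 hjx
  by_cases hm : C₁ (k + 1) = C₁ k
  · rcases Nat.eq_zero_or_pos n with rfl | hn
    · rw [show x₀ = k + 1 by omega] at hjy ⊢
      rw [hm]
      omega
    · have := ih (n - 1) (by omega) (k + 1) (by omega) (by omega)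
      rw [hm] at this
      have := height_mono (a₂ := a₂) h₁ (show k ≤ k + 1 by omega)
      omega
  · rcases h k j hm hj hkj (by omega) with ⟨j', h3, h4, h5⟩ | ⟨k', h3, h4, h5⟩
    · have h6 : k < abscissa a₁ a₂ j' := (lt_abscissa_iff h₁ h₂).2 h3
      have h7 : abscissa a₁ a₂ j' ≤ x₀ := (abscissa_mono h₂ h4.le).trans hjx
      rcases lt_or_eq_of_le h7 with h8 | h8
      · have := ih (x₀ - 1 - abscissa a₁ a₂ j').toNat (by omega) (abscissa a₁ a₂ j') (by omega)
          (by omega)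
        -- The edge j' ends at or below the height at its abscissa, so the bounds before and after
        -- it add up.
        have h9 := height_abscissa h₁ h₂ j'
        rw [mul_sub] at *
        omega
      · rw [h8] at h5
        omega
    · exact absurd h5 (not_le.2 (hr k' h3 h4))

/-- Compatibility depends only on the shadowed edges of `S₁`. -/
theorem Admissible.of_eq_on_shadow (hb : 0 < b) (h₁ : 0 < a₁) (h₂ : 0 < a₂)
    (hC₂ : UnitSteps C₂) (h : Admissible b c a₁ a₂ C₁ C₂) {C₁' : ℤ → ℤ}
    (heq : ∀ k, Shadowed b a₁ a₂ C₂ k → C₁' (k + 1) - C₁' k = C₁ (k + 1) - C₁ k) :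
    Admissible b c a₁ a₂ C₁' C₂ := by
  intro k j hk hj hkj hjk
  by_cases hG : Reaches b a₁ a₂ C₂ k j
  -- Every edge from k up to the abscissa of j is reached by j and hence shadowed, so the two
  -- counting functions have the same increments there.
  · left
    have hsh : ∀ z, k ≤ z → z < abscissa a₁ a₂ j → Shadowed b a₁ a₂ C₂ z := fun z hz hz' =>
      Reaches.shadowed hb h₁ h₂ hC₂ hj hz' fun k' h3 h4 => hG k' (by omega) h4
    have hagree : ∀ z, k ≤ z → z ≤ abscissa a₁ a₂ j → C₁' z - C₁' k = C₁ z - C₁ k := by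
      intro z hz
      induction z, hz using Int.leInduction with
      | base => simp
      | succ z hz ih =>
        intro hz'
        have h3 := ih (by omega)
        have h4 := heq z (hsh z hz (by omega))
        omega
    have hk' : C₁ (k + 1) ≠ C₁ k := by
      have := heq k (hsh k le_rfl hkj)
      omega
    rcases h k j hk' hj hkj hjk with ⟨j', h3, h4, h5⟩ | ⟨k', h3, h4, h5⟩
    · refine ⟨j', h3, h4, ?_⟩
      rw [hagree _ ((lt_abscissa_iff h₁ h₂).2 h3).le (abscissa_mono h₂ h4.le)]
      exact h5
    · exact absurd h5 (not_le.2 (hG k' h3 h4))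
  -- Not being reached is the second alternative itself, which does not involve the horizontal edges
  -- selected.
  · right
    unfold Reaches at hG
    push Not at hG
    exact hG

end

end RankTwoCluster

/-! ### Unshadowed edges: slopes and number. -/

namespace RankTwoCluster

section
variable {b c a₁ a₂ : ℕ} {C₁ C₂ : ℤ → ℤ}

theorem pot_succ_le (h₁ : 0 < a₁) (hC₂ : UnitSteps C₂) (x : ℤ) :
    pot b a₁ a₂ C₂ (x + 1) ≤ pot b a₁ a₂ C₂ x + 1 := by
  have := hC₂.monotone (height_mono (a₂ := a₂) h₁ (show x ≤ x + 1 by omega))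
  have : (b : ℤ) * C₂ (height a₁ a₂ x) ≤ b * C₂ (height a₁ a₂ (x + 1)) := by gcongr
  unfold pot
  omega

theorem pot_lt_of_not_shadowed {m x : ℤ} (hm : ¬Shadowed b a₁ a₂ C₂ m) (hx : m < x) :
    pot b a₁ a₂ C₂ m < pot b a₁ a₂ C₂ x := by
  by_contra hh
  exact hm ⟨x, hx, not_lt.1 hh⟩

/-- Follow a shadowed edge to a later position of no larger potential. Either this is still inside
the run and the argument repeats, or it is m' or beyond, where the potential is at least that of the
unshadowed m'. -/
theorem pot_le_of_run {m₁ m' : ℤ} (hm' : ¬Shadowed b a₁ a₂ C₂ m')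
    (hrun : ∀ k, m₁ < k → k < m' → Shadowed b a₁ a₂ C₂ k) {k : ℤ} (hk : m₁ < k) (hk' : k < m') :
    pot b a₁ a₂ C₂ m' ≤ pot b a₁ a₂ C₂ k := by
  suffices H : ∀ n : ℕ, ∀ k, k = m' - 1 - n → m₁ < k → pot b a₁ a₂ C₂ m' ≤ pot b a₁ a₂ C₂ k from
    H (m' - 1 - k).toNat k (by omega) hk
  intro n
  induction n using Nat.strong_induction_on with
  | _ n ih =>
  intro k hkn hk
  obtain ⟨z, hkz, hz⟩ := hrun k hk (by omega)
  rcases lt_trichotomy z m' with h | h | h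
  · exact (ih (m' - 1 - z).toNat (by omega) z (by omega) (by omega)).trans hz
  · rwa [← h]
  · exact (pot_lt_of_not_shadowed hm' h).le.trans hz

/-- Between two edges outside the shadow, the edges in `S₁` are fewer than the slope predicts. -/
theorem Admissible.slope_bound (hb : 0 < b) (h₁ : 0 < a₁) (h₂ : 0 < a₂) (hC₂ : UnitSteps C₂)
    (h : Admissible b c a₁ a₂ C₁ C₂)
    (hloc : ∀ k, ¬Shadowed b a₁ a₂ C₂ k → C₁ (k + 1) = C₁ k) {m m' : ℤ}
    (hm : ¬Shadowed b a₁ a₂ C₂ m) (hm' : ¬Shadowed b a₁ a₂ C₂ m') (hle : m ≤ m')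
    (hper : m' ≤ m + a₁) :
    m' - m = (pot b a₁ a₂ C₂ m' - pot b a₁ a₂ C₂ m) +
        b * (C₂ (height a₁ a₂ m') - C₂ (height a₁ a₂ m)) ∧
      c * a₁ * (C₁ m' - C₁ m) ≤ b * a₂ * (C₂ (height a₁ a₂ m') - C₂ (height a₁ a₂ m)) ∧
      (C₂ (height a₁ a₂ m) ≠ C₂ (height a₁ a₂ m') →
        c * a₁ * (C₁ m' - C₁ m) < b * a₂ * (C₂ (height a₁ a₂ m') - C₂ (height a₁ a₂ m))) := by
  refine ⟨by unfold pot; ring, ?_⟩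
  have h₁' : (0 : ℤ) < a₁ := by exact_mod_cast h₁
  suffices H : ∀ n : ℕ, ∀ m', m' = m + n → m' ≤ m + a₁ → ¬Shadowed b a₁ a₂ C₂ m' →
      c * a₁ * (C₁ m' - C₁ m) ≤ b * a₂ * (C₂ (height a₁ a₂ m') - C₂ (height a₁ a₂ m)) ∧
      (C₂ (height a₁ a₂ m) ≠ C₂ (height a₁ a₂ m') →
        c * a₁ * (C₁ m' - C₁ m) < b * a₂ * (C₂ (height a₁ a₂ m') - C₂ (height a₁ a₂ m))) from
    H (m' - m).toNat m' (by omega) hper hm'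
  intro n
  induction n using Nat.strong_induction_on with
  | _ n ih =>
  intro m' hn hper hm'
  rcases Nat.eq_zero_or_pos n with rfl | hpos
  · simp only [Nat.cast_zero, add_zero] at hn
    subst hn
    simp
  -- Cut at the last unshadowed position before m'. Since the potential rises by at most one per
  -- step and the run in between never drops below its end, it rises by exactly one from m₁ to m'.
  obtain ⟨m₁, ⟨h3, h4, h5⟩, h6⟩ := Int.exists_greatest_of_bdd
    (P := fun z => m ≤ z ∧ z < m' ∧ ¬Shadowed b a₁ a₂ C₂ z) ⟨m', fun z hz => hz.2.1.le⟩
    ⟨m, le_rfl, by omega, hm⟩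
  have hrun : ∀ k, m₁ < k → k < m' → Shadowed b a₁ a₂ C₂ k := by
    intro k hk hk'
    by_contra hh
    exact absurd (h6 k ⟨by omega, hk', hh⟩) (not_le.2 hk)
  obtain ⟨ih1, ih2⟩ := ih (m₁ - m).toNat (by omega) m₁ (by omega) (by omega) h5
  have hp1 := pot_lt_of_not_shadowed h5 h4
  have hstep := pot_succ_le (b := b) (a₂ := a₂) h₁ hC₂ m₁
  have hl := hloc m₁ h5
  rcases lt_or_eq_of_le (show m₁ + 1 ≤ m' from h4) with hlt | heq
  · have hp2 := pot_le_of_run hm' hrun (show m₁ < m₁ + 1 by omega) hlt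
    have hcl := h.mul_sub_le h₁ h₂ hC₂ hlt (by omega) fun k hk hk' =>
      pot_le_of_run hm' hrun (by omega) hk'
    have hb : (b : ℤ) * (C₂ (height a₁ a₂ m') - C₂ (height a₁ a₂ m₁)) = m' - m₁ - 1 := by
      unfold pot at *
      rw [mul_sub]
      omega
    have e1 : height a₁ a₂ m' * a₁ ≤ m' * a₂ := (le_height_iff h₁).1 le_rfl
    have e2 : (m₁ + 1) * a₂ < (height a₁ a₂ (m₁ + 1) + 1) * a₁ := by
      have := (lt_height_iff (a₂ := a₂) h₁ (j := height a₁ a₂ (m₁ + 1)) (x := m₁ + 1)).not.1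
        (lt_irrefl _)
      exact not_le.1 this
    rw [hl] at hcl
    -- The run ends where its potential is minimal, so c times its S₁-count is at most the number of
    -- vertical edges less one. That missing one pays for rounding both heights and leaves a strict
    -- inequality.
    have key : c * a₁ * (C₁ m' - C₁ m₁) <
        b * a₂ * (C₂ (height a₁ a₂ m') - C₂ (height a₁ a₂ m₁)) := by
      calc c * a₁ * (C₁ m' - C₁ m₁) = a₁ * (c * (C₁ m' - C₁ m₁)) := by ring
        _ ≤ a₁ * (height a₁ a₂ m' - 1 - height a₁ a₂ (m₁ + 1)) := by gcongr
        _ < (m' - m₁ - 1) * a₂ := by linarith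
        _ = b * a₂ * (C₂ (height a₁ a₂ m') - C₂ (height a₁ a₂ m₁)) := by rw [← hb]; ring
    constructor
    · linarith
    · intro _; linarith
  · rw [← heq] at hp1 ⊢
    have hb' : C₂ (height a₁ a₂ (m₁ + 1)) = C₂ (height a₁ a₂ m₁) := by
      have : (b : ℤ) * (C₂ (height a₁ a₂ (m₁ + 1)) - C₂ (height a₁ a₂ m₁)) = 0 := by
        have := hC₂.monotone (height_mono (a₂ := a₂) h₁ (show m₁ ≤ m₁ + 1 by omega))
        have : (b : ℤ) * C₂ (height a₁ a₂ m₁) ≤ b * C₂ (height a₁ a₂ (m₁ + 1)) := by gcongr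
        unfold pot at *
        rw [mul_sub]
        omega
      rcases mul_eq_zero.1 this with h | h
      · exact absurd (by exact_mod_cast h) hb.ne'
      · omega
    rw [hl, hb']
    exact ⟨ih1, ih2⟩

end

theorem pot_add_period {b a₁ a₂ : ℕ} (h₁ : 0 < a₁) (h₂ : 0 < a₂) (S₂ : Finset ℕ) (x : ℤ) :
    pot b a₁ a₂ (cum a₂ S₂) (x + a₁) = pot b a₁ a₂ (cum a₂ S₂) x + (a₁ - b * S₂.card) := by
  unfold pot
  rw [height_add_period h₁, cum_add_period h₂]
  ring

theorem pot_add_mul_period {b a₁ a₂ : ℕ} (h₁ : 0 < a₁) (h₂ : 0 < a₂) (S₂ : Finset ℕ) (x t : ℤ) :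
    pot b a₁ a₂ (cum a₂ S₂) (x + t * a₁) =
      pot b a₁ a₂ (cum a₂ S₂) x + t * (a₁ - b * S₂.card) := by
  induction t using Int.induction_on with
  | zero => simp
  | succ t ih =>
    have := pot_add_period (b := b) h₁ h₂ S₂ (x + t * a₁)
    rw [show x + ((t : ℤ) + 1) * a₁ = x + t * a₁ + a₁ by ring, this, ih]
    ring
  | pred t ih =>
    have := pot_add_period (b := b) h₁ h₂ S₂ (x + (-t - 1) * a₁)
    rw [show x + (-(t : ℤ) - 1) * a₁ + a₁ = x + -t * a₁ by ring, ih] at this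
    linarith

theorem shadowed_add_mul_period {b a₁ a₂ : ℕ} (h₁ : 0 < a₁) (h₂ : 0 < a₂) (S₂ : Finset ℕ)
    (k t : ℤ) : Shadowed b a₁ a₂ (cum a₂ S₂) (k + t * a₁) ↔ Shadowed b a₁ a₂ (cum a₂ S₂) k := by
  have key : ∀ k t : ℤ, Shadowed b a₁ a₂ (cum a₂ S₂) k →
      Shadowed b a₁ a₂ (cum a₂ S₂) (k + t * a₁) := by
    rintro k t ⟨x, hx, hx'⟩
    exact ⟨x + t * a₁, by omega, by
      rw [pot_add_mul_period h₁ h₂, pot_add_mul_period h₁ h₂]; omega⟩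
  refine ⟨fun h => ?_, key k t⟩
  have := key _ (-t) h
  rwa [show k + t * a₁ + -t * (a₁ : ℤ) = k by ring] at this

open Classical in
/-- The horizontal edges outside the shadow of `S₂`. -/
noncomputable def freeEdges (b a₁ a₂ : ℕ) (S₂ : Finset ℕ) : Finset ℕ :=
  (Finset.range a₁).filter fun k => ¬Shadowed b a₁ a₂ (cum a₂ S₂) k

theorem mem_freeEdges {b a₁ a₂ : ℕ} {S₂ : Finset ℕ} {k : ℕ} :
    k ∈ freeEdges b a₁ a₂ S₂ ↔ k < a₁ ∧ ¬Shadowed b a₁ a₂ (cum a₂ S₂) k := by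
  simp [freeEdges]

/-- Take the last position with potential at most w. As the potential rises by at most one per step,
it equals w there, and it exceeds w ever after. -/
theorem exists_not_shadowed_of_level {b a₁ a₂ : ℕ} (h₁ : 0 < a₁) (h₂ : 0 < a₂) {S₂ : Finset ℕ}
    (hS : S₂ ⊆ Finset.range a₂) (hlt : b * S₂.card < a₁) (w : ℤ) :
    ∃ x, pot b a₁ a₂ (cum a₂ S₂) x = w ∧ ¬Shadowed b a₁ a₂ (cum a₂ S₂) x := by
  have hf : (1 : ℤ) ≤ a₁ - b * S₂.card := by
    have : ((b * S₂.card : ℕ) : ℤ) < a₁ := by exact_mod_cast hlt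
    push_cast at this
    omega
  have h₁' : (0 : ℤ) < a₁ := by exact_mod_cast h₁
  have hU := unitSteps_cum hS
  set f : ℤ := a₁ - b * S₂.card with hfdef
  obtain ⟨x, hx, hx'⟩ := Int.exists_greatest_of_bdd
    (P := fun z => pot b a₁ a₂ (cum a₂ S₂) z ≤ w) (by
      -- Beyond this point the completed periods, each gaining at least 1, outweigh both |w| and the
      -- loss of at most b |S₂| inside the last incomplete period.
      refine ⟨a₁ * (|w| + b * S₂.card + 1), fun z hz => ?_⟩
      by_contra hh
      have e := Int.emod_add_mul_ediv z a₁
      have hr := Int.emod_nonneg z h₁'.ne'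
      have hr' := Int.emod_lt_of_pos z h₁'
      have hp := pot_add_mul_period (b := b) h₁ h₂ S₂ (z % a₁) (z / a₁)
      rw [show z % a₁ + z / a₁ * a₁ = z by linarith, ← hfdef] at hp
      have ht : |w| + b * S₂.card + 1 ≤ z / a₁ := by
        rw [Int.le_ediv_iff_mul_le h₁']
        linarith
      have hq : cum a₂ S₂ (height a₁ a₂ (z % a₁)) ≤ S₂.card := by
        have := hU.monotone (height_mono (a₂ := a₂) h₁ hr'.le)
        have e3 := height_add_period (a₂ := a₂) h₁ 0
        rw [zero_add, height_zero, zero_add] at e3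
        rwa [e3, cum_period h₂ hS] at this
      have hq' : (b : ℤ) * cum a₂ S₂ (height a₁ a₂ (z % a₁)) ≤ b * S₂.card := by gcongr
      have hw : w ≤ |w| := le_abs_self w
      have : (|w| + b * S₂.card + 1) * 1 ≤ z / a₁ * f := by
        have : 0 ≤ |w| + (b : ℤ) * S₂.card + 1 := by positivity
        exact mul_le_mul ht hf (by norm_num) (by linarith)
      unfold pot at hp hz
      linarith) (by
      refine ⟨0 + (-|w|) * a₁, ?_⟩
      rw [pot_add_mul_period h₁ h₂]
      have : pot b a₁ a₂ (cum a₂ S₂) 0 = 0 := by simp [pot, cum_zero hS]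
      rw [this]
      have := neg_abs_le w
      have : |w| * 1 ≤ |w| * f := by gcongr
      linarith)
  have h1 := pot_succ_le (b := b) (a₂ := a₂) h₁ hU x
  have h2 : w < pot b a₁ a₂ (cum a₂ S₂) (x + 1) := by
    by_contra hh
    exact absurd (hx' _ (not_lt.1 hh)) (by omega)
  refine ⟨x, by omega, fun ⟨y, hy, hy'⟩ => ?_⟩
  exact absurd (hx' y (hy'.trans hx)) (not_le.2 hy)

/-- On unshadowed positions the potential is strictly increasing and takes every integer value, and
one period adds a₁ - b |S₂|. For positive drift its residues therefore enumerate the unshadowed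
edges of a period. For nonpositive drift every edge is shadowed by its own translate. -/
theorem card_freeEdges {b a₁ a₂ : ℕ} (h₁ : 0 < a₁) (h₂ : 0 < a₂) {S₂ : Finset ℕ}
    (hS : S₂ ⊆ Finset.range a₂) : (freeEdges b a₁ a₂ S₂).card = a₁ - b * S₂.card := by
  rcases lt_or_ge (b * S₂.card) a₁ with hlt | hge
  · have hf : (1 : ℤ) ≤ a₁ - b * S₂.card := by
      have : ((b * S₂.card : ℕ) : ℤ) < a₁ := by exact_mod_cast hlt
      push_cast at this
      omega
    have h₁' : (0 : ℤ) < a₁ := by exact_mod_cast h₁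
    set f : ℤ := a₁ - b * S₂.card with hfdef
    rw [← Finset.card_range (a₁ - b * S₂.card)]
    refine Finset.card_nbij (fun k => (pot b a₁ a₂ (cum a₂ S₂) k % f).toNat) ?_ ?_ ?_
    · intro k _
      have h3 := Int.emod_nonneg (pot b a₁ a₂ (cum a₂ S₂) k) (show f ≠ 0 by omega)
      have h4 := Int.emod_lt_of_pos (pot b a₁ a₂ (cum a₂ S₂) k) (show 0 < f by omega)
      have : ((a₁ - b * S₂.card : ℕ) : ℤ) = f := by push_cast [Nat.cast_sub hlt.le]; rfl
      simp only [Finset.coe_range, Set.mem_Iio]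
      omega
    · intro k hk k' hk' he
      rw [Finset.mem_coe, mem_freeEdges] at hk hk'
      have h3 := Int.emod_nonneg (pot b a₁ a₂ (cum a₂ S₂) k) (show f ≠ 0 by omega)
      have h4 := Int.emod_nonneg (pot b a₁ a₂ (cum a₂ S₂) k') (show f ≠ 0 by omega)
      have he' : pot b a₁ a₂ (cum a₂ S₂) k % f = pot b a₁ a₂ (cum a₂ S₂) k' % f := by
        simp only at he; omega
      obtain ⟨t, ht⟩ := Int.ModEq.dvd (show _ ≡ _ [ZMOD f] from he')
      have h5 := pot_add_mul_period (b := b) h₁ h₂ S₂ k t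
      have h6 := (shadowed_add_mul_period (b := b) h₁ h₂ S₂ k t).not.2 hk.2
      have h7 : pot b a₁ a₂ (cum a₂ S₂) (k + t * a₁) = pot b a₁ a₂ (cum a₂ S₂) k' := by
        rw [h5, ← hfdef]; linarith
      have h8 : (k : ℤ) + t * a₁ = k' := by
        rcases lt_trichotomy ((k : ℤ) + t * a₁) k' with h | h | h
        · exact absurd h7 (pot_lt_of_not_shadowed h6 h).ne
        · exact h
        · exact absurd h7 (pot_lt_of_not_shadowed hk'.2 h).ne'
      have hk1 : (k : ℤ) < a₁ := by exact_mod_cast hk.1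
      have hk1' : (k' : ℤ) < a₁ := by exact_mod_cast hk'.1
      have ht0 : t = 0 := by
        by_contra hne
        rcases lt_or_gt_of_ne hne with h | h <;> nlinarith
      subst ht0
      omega
    · intro r hr
      obtain ⟨x, hx, hx'⟩ := exists_not_shadowed_of_level (b := b) h₁ h₂ hS hlt r
      have e := Int.emod_add_mul_ediv x a₁
      have hr1 := Int.emod_nonneg x h₁'.ne'
      have hr2 := Int.emod_lt_of_pos x h₁'
      have e' : x = x % a₁ + x / a₁ * a₁ := by linarith
      have hc : ((x % a₁).toNat : ℤ) = x % a₁ := by omega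
      refine ⟨(x % a₁).toNat, ?_, ?_⟩
      · rw [Finset.mem_coe, mem_freeEdges, hc]
        refine ⟨by omega, ?_⟩
        rwa [e', shadowed_add_mul_period h₁ h₂] at hx'
      · simp only [hc]
        have h5 := pot_add_mul_period (b := b) h₁ h₂ S₂ (x % a₁) (x / a₁)
        rw [← e', hx, ← hfdef] at h5
        have : pot b a₁ a₂ (cum a₂ S₂) (x % a₁) = r + f * (-(x / a₁)) := by linarith
        rw [this, Int.add_mul_emod_self_left]
        have hr3 : r < a₁ - b * S₂.card := by simpa using hr
        rw [Int.emod_eq_of_lt (by omega) (by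
          have : ((a₁ - b * S₂.card : ℕ) : ℤ) = f := by push_cast [Nat.cast_sub hlt.le]; rfl
          omega)]
        simp
  · rw [Nat.sub_eq_zero_of_le hge, Finset.card_eq_zero, Finset.eq_empty_iff_forall_notMem]
    intro k hk
    have h₁' : (0 : ℤ) < a₁ := by exact_mod_cast h₁
    refine (mem_freeEdges.1 hk).2 ⟨k + a₁, by omega, ?_⟩
    rw [pot_add_period h₁ h₂]
    have : (a₁ : ℤ) ≤ ((b * S₂.card : ℕ) : ℤ) := by exact_mod_cast hge
    push_cast at this
    omega

end RankTwoCluster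

/-! ### Counting pairs: rows, local pairs, reflection. -/

namespace RankTwoCluster

open Polynomial

open Classical in
/-- The compatible pairs, indexed by the abscissae of the horizontal and the heights of the
vertical edges. -/
noncomputable def modelPairs (b c a₁ a₂ : ℕ) : Finset (Finset ℕ × Finset ℕ) :=
  ((Finset.range a₁).powerset ×ˢ (Finset.range a₂).powerset).filter fun S =>
    Admissible b c a₁ a₂ (cum a₁ S.1) (cum a₂ S.2)

theorem mem_modelPairs {b c a₁ a₂ : ℕ} {S : Finset ℕ × Finset ℕ} :
    S ∈ modelPairs b c a₁ a₂ ↔ S.1 ⊆ Finset.range a₁ ∧ S.2 ⊆ Finset.range a₂ ∧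
      Admissible b c a₁ a₂ (cum a₁ S.1) (cum a₂ S.2) := by
  simp [modelPairs, and_assoc]

/-- The number of compatible pairs with `p` horizontal and `q` vertical edges. -/
noncomputable def pairCount (b c a₁ a₂ p q : ℕ) : ℕ :=
  ((modelPairs b c a₁ a₂).filter fun S => S.1.card = p ∧ S.2.card = q).card

open Classical in
/-- The compatible pairs all of whose horizontal edges are shadowed. -/
noncomputable def localPairs (b c a₁ a₂ : ℕ) : Finset (Finset ℕ × Finset ℕ) :=
  (modelPairs b c a₁ a₂).filter fun S => Disjoint S.1 (freeEdges b a₁ a₂ S.2)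

/-- The number of local compatible pairs with `p` horizontal and `q` vertical edges. -/
noncomputable def localCount (b c a₁ a₂ p q : ℕ) : ℕ :=
  ((localPairs b c a₁ a₂).filter fun S => S.1.card = p ∧ S.2.card = q).card

/-- The generating polynomial of the compatible pairs with `q` vertical edges. -/
noncomputable def rowPoly (b c a₁ a₂ q : ℕ) : ℤ[X] :=
  ∑ S ∈ (modelPairs b c a₁ a₂).filter (fun S => S.2.card = q), X ^ S.1.card

/-- The generating polynomial of the local compatible pairs with `q` vertical edges. -/
noncomputable def localPoly (b c a₁ a₂ q : ℕ) : ℤ[X] :=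
  ∑ S ∈ (localPairs b c a₁ a₂).filter (fun S => S.2.card = q), X ^ S.1.card

theorem coeff_sum_X_pow_card (F : Finset (Finset ℕ × Finset ℕ)) (q p : ℕ) :
    (∑ S ∈ F.filter (fun S => S.2.card = q), (X : ℤ[X]) ^ S.1.card).coeff p =
      (F.filter fun S => S.1.card = p ∧ S.2.card = q).card := by
  simp only [finsetSum_coeff, coeff_X_pow]
  rw [Finset.sum_boole, Finset.filter_filter]
  congr 2
  ext S
  simp only [Finset.mem_filter]
  tauto

theorem coeff_rowPoly (b c a₁ a₂ q p : ℕ) :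
    (rowPoly b c a₁ a₂ q).coeff p = pairCount b c a₁ a₂ p q :=
  coeff_sum_X_pow_card _ _ _

theorem coeff_localPoly (b c a₁ a₂ q p : ℕ) :
    (localPoly b c a₁ a₂ q).coeff p = localCount b c a₁ a₂ p q :=
  coeff_sum_X_pow_card _ _ _

theorem Admissible.of_eq_off_free {b c a₁ a₂ : ℕ} (hb : 0 < b) (h₁ : 0 < a₁) (h₂ : 0 < a₂)
    {S₁ S₁' S₂ : Finset ℕ} (hS₁ : S₁ ⊆ Finset.range a₁) (hS₁' : S₁' ⊆ Finset.range a₁)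
    (hS₂ : S₂ ⊆ Finset.range a₂) (h : Admissible b c a₁ a₂ (cum a₁ S₁) (cum a₂ S₂))
    (heq : ∀ k, k ∉ freeEdges b a₁ a₂ S₂ → (k ∈ S₁' ↔ k ∈ S₁)) :
    Admissible b c a₁ a₂ (cum a₁ S₁') (cum a₂ S₂) := by
  refine h.of_eq_on_shadow hb h₁ h₂ (unitSteps_cum hS₂) fun k hk => ?_
  rw [cum_succ hS₁, cum_succ hS₁']
  have h₁' : (0 : ℤ) < a₁ := by exact_mod_cast h₁
  have hr1 := Int.emod_nonneg k h₁'.ne'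
  have e := Int.emod_add_mul_ediv k a₁
  have hnf : (k % a₁).toNat ∉ freeEdges b a₁ a₂ S₂ := by
    rw [mem_freeEdges, not_and, not_not]
    intro _
    rw [show (((k % a₁).toNat : ℕ) : ℤ) = k % a₁ by omega,
      ← shadowed_add_mul_period h₁ h₂ S₂ (k % a₁) (k / a₁)]
    rwa [show k % a₁ + k / a₁ * a₁ = k by linarith]
  rw [if_congr (heq _ hnf) rfl rfl]
  ring

/-- Compatibility ignores the unshadowed edges in S₁, so a compatible pair is a local pair plus an
arbitrary set of free edges, whose number depends on q alone. -/
theorem rowPoly_eq {b c a₁ a₂ : ℕ} (hb : 0 < b) (h₁ : 0 < a₁) (h₂ : 0 < a₂) (q : ℕ) :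
    rowPoly b c a₁ a₂ q = (1 + X) ^ (a₁ - b * q) * localPoly b c a₁ a₂ q := by
  classical
  have key : ∀ S₂ : Finset ℕ, S₂ ⊆ Finset.range a₂ → S₂.card = q →
      ∑ T ∈ (freeEdges b a₁ a₂ S₂).powerset, (X : ℤ[X]) ^ T.card = (1 + X) ^ (a₁ - b * q) := by
    intro S₂ hS hq
    have := Finset.sum_pow_mul_eq_add_pow (X : ℤ[X]) 1 (freeEdges b a₁ a₂ S₂)
    simp only [one_pow, mul_one] at this
    rw [this, card_freeEdges h₁ h₂ hS, hq, add_comm]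
  rw [localPoly, Finset.mul_sum]
  have : ∀ S ∈ (localPairs b c a₁ a₂).filter (fun S => S.2.card = q),
      (1 + X : ℤ[X]) ^ (a₁ - b * q) * X ^ S.1.card =
        ∑ T ∈ (freeEdges b a₁ a₂ S.2).powerset, X ^ T.card * X ^ S.1.card := by
    intro S hS
    rw [Finset.mem_filter, localPairs, Finset.mem_filter, mem_modelPairs] at hS
    rw [← key S.2 hS.1.1.2.1 hS.2, Finset.sum_mul]
  rw [Finset.sum_congr rfl this, Finset.sum_sigma', rowPoly]
  symm
  refine Finset.sum_nbij' (fun x => (x.1.1 ∪ x.2, x.1.2))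
    (fun S => ⟨(S.1 \ freeEdges b a₁ a₂ S.2, S.2), S.1 ∩ freeEdges b a₁ a₂ S.2⟩) ?_ ?_ ?_ ?_ ?_
  · rintro ⟨⟨S₁, S₂⟩, T⟩ hx
    simp only [Finset.mem_sigma, Finset.mem_filter, localPairs, mem_modelPairs,
      Finset.mem_powerset] at hx ⊢
    obtain ⟨⟨⟨⟨h3, h4, h5⟩, h6⟩, h7⟩, h8⟩ := hx
    have h9 : T ⊆ Finset.range a₁ := h8.trans (Finset.filter_subset _ _)
    refine ⟨⟨Finset.union_subset h3 h9, h4, ?_⟩, h7⟩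
    refine h5.of_eq_off_free hb h₁ h₂ h3 (Finset.union_subset h3 h9) h4 fun k hk => ?_
    have : k ∉ T := fun hh => hk (h8 hh)
    simp [this]
  · rintro ⟨S₁, S₂⟩ hx
    simp only [Finset.mem_sigma, Finset.mem_filter, localPairs, mem_modelPairs,
      Finset.mem_powerset] at hx ⊢
    obtain ⟨⟨h3, h4, h5⟩, h7⟩ := hx
    refine ⟨⟨⟨⟨Finset.sdiff_subset.trans h3, h4, ?_⟩, Finset.sdiff_disjoint⟩, h7⟩,
      Finset.inter_subset_right⟩
    refine h5.of_eq_off_free hb h₁ h₂ h3 (Finset.sdiff_subset.trans h3) h4 fun k hk => ?_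
    simp [hk]
  · rintro ⟨⟨S₁, S₂⟩, T⟩ hx
    simp only [Finset.mem_sigma, Finset.mem_filter, localPairs, mem_modelPairs,
      Finset.mem_powerset] at hx
    obtain ⟨⟨⟨⟨h3, h4, h5⟩, h6⟩, h7⟩, h8⟩ := hx
    simp only
    rw [Finset.union_sdiff_distrib, Finset.sdiff_eq_empty_iff_subset.2 h8, Finset.union_empty,
      sdiff_eq_left.2 h6, Finset.union_inter_distrib_right, Finset.disjoint_iff_inter_eq_empty.1 h6,
      Finset.empty_union, Finset.inter_eq_left.2 h8]
  · rintro ⟨S₁, S₂⟩ hx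
    simp [Finset.sdiff_union_inter]
  · rintro ⟨⟨S₁, S₂⟩, T⟩ hx
    simp only [Finset.mem_sigma, Finset.mem_filter, localPairs, mem_modelPairs,
      Finset.mem_powerset] at hx
    obtain ⟨⟨⟨⟨h3, h4, h5⟩, h6⟩, h7⟩, h8⟩ := hx
    simp only
    rw [Finset.card_union_of_disjoint (h6.mono_right h8), add_comm, pow_add]

/-- The local pairs are those counted with strictly smaller slope. -/
theorem slope_of_mem_localPairs {b c a₁ a₂ : ℕ} (hb : 0 < b) (h₁ : 0 < a₁) (h₂ : 0 < a₂)
    {S : Finset ℕ × Finset ℕ} (hS : S ∈ localPairs b c a₁ a₂) (hq : 0 < S.2.card)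
    (hlt : b * S.2.card < a₁) : c * a₁ * S.1.card < b * a₂ * S.2.card := by
  rw [localPairs, Finset.mem_filter, mem_modelPairs] at hS
  obtain ⟨⟨h3, h4, h5⟩, h6⟩ := hS
  have hne : (freeEdges b a₁ a₂ S.2).Nonempty := by
    rw [← Finset.card_pos, card_freeEdges h₁ h₂ h4]; omega
  obtain ⟨m, hm⟩ := hne
  rw [mem_freeEdges] at hm
  -- The slope bound is applied between an unshadowed edge and its translate by one period; the
  -- increments are then the cardinalities of the two sets.
  have hm' := (shadowed_add_mul_period (b := b) h₁ h₂ S.2 m 1).not.2 hm.2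
  rw [one_mul] at hm'
  have := (h5.slope_bound hb h₁ h₂ (unitSteps_cum h4) (fun k hk => by
    by_contra hh
    rw [← ne_eq, cum_succ_ne_iff h3] at hh
    have hh' := Finset.disjoint_left.1 h6 hh
    refine hh' (mem_freeEdges.2 ⟨by simpa using h3 hh, ?_⟩)
    have h₁' : (0 : ℤ) < a₁ := by exact_mod_cast h₁
    have hr1 := Int.emod_nonneg k h₁'.ne'
    have e := Int.emod_add_mul_ediv k a₁
    rw [show (((k % a₁).toNat : ℕ) : ℤ) = k % a₁ by omega,
      ← shadowed_add_mul_period h₁ h₂ S.2 (k % a₁) (k / a₁)]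
    rwa [show k % a₁ + k / a₁ * a₁ = k by linarith]) hm.2 hm' (by omega) le_rfl).2.2
  rw [height_add_period h₁, cum_add_period h₁, cum_add_period h₂] at this
  have := this (by omega)
  simp only [add_sub_cancel_left] at this
  exact_mod_cast this

/-- Choose x₀ minimizing the potential over one period. As the drift is not positive, x₀ is also
minimal compared with the period preceding it, and the bound for stretches ending at a minimum of
the potential, applied to that whole period, gives c |S₁| ≤ a₂ - 1. -/
theorem mul_card_lt_of_mem_modelPairs {b c a₁ a₂ : ℕ} (h₁ : 0 < a₁) (h₂ : 0 < a₂)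
    {S : Finset ℕ × Finset ℕ} (hS : S ∈ modelPairs b c a₁ a₂)
    (hge : a₁ ≤ b * S.2.card) : c * S.1.card < a₂ := by
  rw [mem_modelPairs] at hS
  obtain ⟨h3, h4, h5⟩ := hS
  have h₁' : (0 : ℤ) < a₁ := by exact_mod_cast h₁
  have hge' : (a₁ : ℤ) ≤ b * S.2.card := by exact_mod_cast hge
  obtain ⟨x₀, hx₀, hmin⟩ := Finset.exists_min_image (Finset.Ico (a₁ : ℤ) (2 * a₁))
    (pot b a₁ a₂ (cum a₂ S.2)) ⟨a₁, by simp; omega⟩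
  rw [Finset.mem_Ico] at hx₀
  have := h5.mul_sub_le h₁ h₂ (unitSteps_cum h4) (show x₀ - a₁ < x₀ by omega) (by omega)
    fun k hk hk' => by
      by_cases hh : (a₁ : ℤ) ≤ k
      · exact hmin k (by rw [Finset.mem_Ico]; omega)
      · have h7 := hmin (k + a₁) (by rw [Finset.mem_Ico]; omega)
        rw [pot_add_period h₁ h₂] at h7
        omega
  have h8 := cum_add_period h₁ S.1 (x₀ - a₁)
  have h9 := height_add_period (a₂ := a₂) h₁ (x₀ - a₁)
  rw [sub_add_cancel] at h8 h9
  rw [h8, h9] at this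
  have : (c * S.1.card : ℤ) < a₂ := by linarith
  exact_mod_cast this

theorem image_reflect_subset {N : ℕ} {S : Finset ℕ} (hS : S ⊆ Finset.range N) :
    (S.image fun i => N - 1 - i) ⊆ Finset.range N := by
  intro i hi
  obtain ⟨j, hj, rfl⟩ := Finset.mem_image.1 hi
  have := Finset.mem_range.1 (hS hj)
  rw [Finset.mem_range]; omega

theorem image_reflect_reflect {N : ℕ} {S : Finset ℕ} (hS : S ⊆ Finset.range N) :
    ((S.image fun i => N - 1 - i).image fun i => N - 1 - i) = S := by
  rw [Finset.image_image]
  conv_rhs => rw [← Finset.image_id (s := S)]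
  refine Finset.image_congr fun i hi => ?_
  have := Finset.mem_range.1 (hS hi)
  change N - 1 - (N - 1 - i) = i
  omega

theorem card_image_reflect {N : ℕ} {S : Finset ℕ} (hS : S ⊆ Finset.range N) :
    (S.image fun i => N - 1 - i).card = S.card := by
  refine Finset.card_image_of_injOn fun i hi j hj h => ?_
  have := Finset.mem_range.1 (hS hi)
  have := Finset.mem_range.1 (hS hj)
  change N - 1 - i = N - 1 - j at h
  omega

theorem reflect_mem_modelPairs {b c a₁ a₂ : ℕ} (h₁ : 0 < a₁) (h₂ : 0 < a₂)
    {S : Finset ℕ × Finset ℕ} (hS : S ∈ modelPairs b c a₁ a₂) :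
    (S.2.image fun i => a₂ - 1 - i, S.1.image fun i => a₁ - 1 - i) ∈ modelPairs c b a₂ a₁ := by
  rw [mem_modelPairs] at hS ⊢
  refine ⟨image_reflect_subset hS.2.1, image_reflect_subset hS.1, ?_⟩
  exact (hS.2.2.reflect h₁ h₂).congr (funext fun x => (cum_reflect h₂ hS.2.1 x).symm)
    (funext fun x => (cum_reflect h₁ hS.1 x).symm)

/-- The shadow treats the two kinds of edges unequally. This symmetry makes every bound for rows
available for columns. -/
theorem pairCount_reflect {b c a₁ a₂ : ℕ} (h₁ : 0 < a₁) (h₂ : 0 < a₂) (p q : ℕ) :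
    pairCount b c a₁ a₂ p q = pairCount c b a₂ a₁ q p := by
  unfold pairCount
  refine Finset.card_nbij' (fun S => (S.2.image fun i => a₂ - 1 - i, S.1.image fun i => a₁ - 1 - i))
    (fun S => (S.2.image fun i => a₁ - 1 - i, S.1.image fun i => a₂ - 1 - i)) ?_ ?_ ?_ ?_
  · intro S hS
    simp only [Finset.coe_filter, Set.mem_ofPred_eq] at hS ⊢
    have := mem_modelPairs.1 hS.1
    exact ⟨reflect_mem_modelPairs h₁ h₂ hS.1, by rw [card_image_reflect this.2.1]; exact hS.2.2,
      by rw [card_image_reflect this.1]; exact hS.2.1⟩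
  · intro S hS
    simp only [Finset.coe_filter, Set.mem_ofPred_eq] at hS ⊢
    have := mem_modelPairs.1 hS.1
    exact ⟨reflect_mem_modelPairs h₂ h₁ hS.1, by rw [card_image_reflect this.2.1]; exact hS.2.2,
      by rw [card_image_reflect this.1]; exact hS.2.1⟩
  · intro S hS
    simp only [Finset.coe_filter, Set.mem_ofPred_eq] at hS
    have := mem_modelPairs.1 hS.1
    simp only [image_reflect_reflect this.1, image_reflect_reflect this.2.1]
  · intro S hS
    simp only [Finset.coe_filter, Set.mem_ofPred_eq] at hS
    have := mem_modelPairs.1 hS.1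
    simp only [image_reflect_reflect this.1, image_reflect_reflect this.2.1]

theorem pairCount_zero_left {b c a₁ a₂ : ℕ} (q : ℕ) :
    pairCount b c a₁ a₂ 0 q = a₂.choose q := by
  unfold pairCount
  rw [← Finset.card_range a₂, ← Finset.card_powersetCard q (Finset.range a₂)]
  refine Finset.card_nbij' (fun S => S.2) (fun T => (∅, T)) ?_ ?_ ?_ ?_
  · intro S hS
    simp only [Finset.coe_filter, Set.mem_ofPred_eq, mem_modelPairs, Finset.mem_coe,
      Finset.mem_powersetCard] at hS ⊢
    exact ⟨by simpa using hS.1.2.1, hS.2.2⟩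
  · intro T hT
    simp only [Finset.coe_filter, Set.mem_ofPred_eq, mem_modelPairs, Finset.mem_coe,
      Finset.mem_powersetCard] at hT ⊢
    refine ⟨⟨Finset.empty_subset _, by simpa using hT.1, ?_⟩, rfl, hT.2⟩
    intro k j hk
    simp [cum] at hk
  · intro S hS
    simp only [Finset.coe_filter, Set.mem_ofPred_eq, Finset.card_eq_zero] at hS
    exact Prod.ext hS.2.1.symm rfl
  · intro T _; rfl

theorem pairCount_zero_right {b c a₁ a₂ : ℕ} (h₁ : 0 < a₁) (h₂ : 0 < a₂) (p : ℕ) :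
    pairCount b c a₁ a₂ p 0 = a₁.choose p := by
  rw [pairCount_reflect h₁ h₂, pairCount_zero_left]

end RankTwoCluster

/-! ### Pairs prescribed on a window of one period. -/

namespace RankTwoCluster

open Classical in
theorem cum_sub_eq_card {N : ℕ} {S : Finset ℕ} (hS : S ⊆ Finset.range N) {x y : ℤ} (hxy : x ≤ y) :
    cum N S y - cum N S x = ((Finset.Ico x y).filter fun z : ℤ => (z % N).toNat ∈ S).card := by
  induction y, hxy using Int.leInduction with
  | base => simp
  | succ y hy ih =>
    rw [cum_succ hS, ← Finset.insert_Ico_right_eq_Ico_add_one hy, Finset.filter_insert]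
    split_ifs with h
    · rw [Finset.card_insert_of_notMem (by simp)]
      push_cast
      linarith
    · linarith

open Classical in
/-- The set of residues modulo `N` of the elements of `[t, t + N)` satisfying `P`. -/
noncomputable def ofWindow (N : ℕ) (t : ℤ) (P : ℤ → Prop) : Finset ℕ :=
  (Finset.range N).filter fun r => P (t + (r - t) % N)

open Classical in
theorem ofWindow_subset (N : ℕ) (t : ℤ) (P : ℤ → Prop) : ofWindow N t P ⊆ Finset.range N :=
  Finset.filter_subset _ _

open Classical in
theorem mem_ofWindow {N : ℕ} {t : ℤ} {P : ℤ → Prop} {x : ℤ} (h : t ≤ x) (h' : x < t + N) :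
    (x % N).toNat ∈ ofWindow N t P ↔ P x := by
  have hN : (0 : ℤ) < N := by omega
  have h1 := Int.emod_nonneg x hN.ne'
  have h2 := Int.emod_lt_of_pos x hN
  have : t + (((x % N).toNat : ℤ) - t) % N = x := by
    rw [show (((x % N).toNat : ℕ) : ℤ) = x % N by omega, Int.emod_sub_emod,
      Int.emod_eq_of_lt (by omega) (by omega)]
    ring
  rw [ofWindow, Finset.mem_filter, this]
  simp only [Finset.mem_range, and_iff_right_iff_imp]
  omega

open Classical in
theorem cum_ofWindow {N : ℕ} {t : ℤ} {P : ℤ → Prop} {x y : ℤ} (h : t ≤ x) (hxy : x ≤ y)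
    (h' : y ≤ t + N) : cum N (ofWindow N t P) y - cum N (ofWindow N t P) x =
      ((Finset.Ico x y).filter P).card := by
  rw [cum_sub_eq_card (ofWindow_subset _ _ _) hxy]
  congr 2
  ext z
  rw [Finset.mem_filter, Finset.mem_filter]
  refine and_congr_right fun hz => ?_
  rw [Finset.mem_Ico] at hz
  exact mem_ofWindow (by omega) (by omega)

theorem cum_add_mul_period {N : ℕ} (hN : 0 < N) (S : Finset ℕ) (x t : ℤ) :
    cum N S (x + t * N) = cum N S x + t * S.card := by
  induction t using Int.induction_on with
  | zero => simp
  | succ t ih =>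
    have := cum_add_period hN S (x + t * N)
    rw [show x + ((t : ℤ) + 1) * N = x + t * N + N by ring, this, ih]
    ring
  | pred t ih =>
    have := cum_add_period hN S (x + (-t - 1) * N)
    rw [show x + (-(t : ℤ) - 1) * N + N = x + -t * N by ring, ih] at this
    linarith

theorem height_add_mul_period {a₁ a₂ : ℕ} (h₁ : 0 < a₁) (x t : ℤ) :
    height a₁ a₂ (x + t * a₁) = height a₁ a₂ x + t * a₂ := by
  have h₁' : (a₁ : ℤ) ≠ 0 := by positivity
  unfold height
  rw [show (x + t * a₁) * (a₂ : ℤ) = x * a₂ + (t * a₂) * a₁ by ring, Int.add_mul_ediv_right _ _ h₁']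

theorem abscissa_add_mul_period {a₁ a₂ : ℕ} (h₂ : 0 < a₂) (j t : ℤ) :
    abscissa a₁ a₂ (j + t * a₂) = abscissa a₁ a₂ j + t * a₁ := by
  unfold abscissa
  rw [show -(j + t * (a₂ : ℤ) + 1) = -(j + 1) + (-t) * a₂ by ring, height_add_mul_period h₂]
  ring

/-- It suffices to check compatibility for the horizontal edges in one period. -/
theorem admissible_of_window {b c a₁ a₂ : ℕ} (h₁ : 0 < a₁) (h₂ : 0 < a₂) {S₁ S₂ : Finset ℕ}
    (hS₁ : S₁ ⊆ Finset.range a₁) (hS₂ : S₂ ⊆ Finset.range a₂) (t : ℤ)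
    (H : ∀ k j : ℤ, t ≤ k → k < t + a₁ → (k % a₁).toNat ∈ S₁ → (j % a₂).toNat ∈ S₂ →
      k < abscissa a₁ a₂ j → abscissa a₁ a₂ j ≤ k + a₁ →
      (∃ j', height a₁ a₂ k ≤ j' ∧ j' < j ∧
        c * (cum a₁ S₁ (abscissa a₁ a₂ j') - cum a₁ S₁ k) ≤ j' + 1 - height a₁ a₂ k) ∨
      ∃ k', k < k' ∧ k' < abscissa a₁ a₂ j ∧
        b * (cum a₂ S₂ (j + 1) - cum a₂ S₂ (height a₁ a₂ k')) ≤ abscissa a₁ a₂ j - k') :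
    Admissible b c a₁ a₂ (cum a₁ S₁) (cum a₂ S₂) := by
  intro k j hk hj hlt hle
  rw [cum_succ_ne_iff hS₁] at hk
  rw [cum_succ_ne_iff hS₂] at hj
  have h₁' : (0 : ℤ) < a₁ := by exact_mod_cast h₁
  have e := Int.emod_add_mul_ediv (k - t) a₁
  have hr1 := Int.emod_nonneg (k - t) h₁'.ne'
  have hr2 := Int.emod_lt_of_pos (k - t) h₁'
  set s := (k - t) / a₁ with hs
  have hX := fun j => abscissa_add_mul_period (a₁ := a₁) h₂ j (-s)
  have hY := fun k => height_add_mul_period (a₂ := a₂) h₁ k (-s)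
  have hX' := fun j => abscissa_add_mul_period (a₁ := a₁) h₂ j s
  have hY' := fun k => height_add_mul_period (a₂ := a₂) h₁ k s
  have hC₁ := fun x => cum_add_mul_period h₁ S₁ x (-s)
  have hC₂ := fun x => cum_add_mul_period h₂ S₂ x (-s)
  rcases H (k + -s * a₁) (j + -s * a₂) (by linarith) (by linarith)
    (by rwa [Int.add_mul_emod_self_right]) (by rwa [Int.add_mul_emod_self_right])
    (by rw [hX]; omega) (by rw [hX]; omega) with ⟨j', h3, h4, h5⟩ | ⟨k', h3, h4, h5⟩
  · left
    refine ⟨j' + s * a₂, by rw [hY] at h3; linarith, by linarith, ?_⟩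
    have h6 := cum_add_mul_period h₁ S₁ (abscissa a₁ a₂ j') s
    rw [hX', h6]
    rw [hY, hC₁] at h5
    linarith
  · right
    refine ⟨k' + s * a₁, by linarith, by rw [hX] at h4; linarith, ?_⟩
    rw [hX, show j + -s * (a₂ : ℤ) + 1 = j + 1 + -s * a₂ by ring, hC₂] at h5
    rw [hY', cum_add_mul_period h₂]
    linarith

open Classical in
theorem card_filter_Ico_eq {x y l u : ℤ} {P : ℤ → Prop} (hP : ∀ z, x ≤ z → z < y →
    (P z ↔ l ≤ z ∧ z < u)) : (((Finset.Ico x y).filter P).card : ℤ) = max 0 (min y u - max x l) := by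
  have : (Finset.Ico x y).filter P = Finset.Ico (max x l) (min y u) := by
    ext z
    rw [Finset.mem_filter, Finset.mem_Ico, Finset.mem_Ico]
    constructor
    · rintro ⟨h, h'⟩
      rw [hP z h.1 h.2] at h'
      omega
    · intro h
      have := hP z (by omega) (by omega)
      rw [this]
      omega
  rw [this, Int.card_Ico]
  omega

end RankTwoCluster

/-! ### An explicit local pair. -/

namespace RankTwoCluster

open Polynomial

theorem pairCount_eq_sum {b c a₁ a₂ : ℕ} (hb : 0 < b) (h₁ : 0 < a₁) (h₂ : 0 < a₂) (p q : ℕ) :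
    pairCount b c a₁ a₂ p q = ∑ x ∈ Finset.HasAntidiagonal.antidiagonal p,
      (a₁ - b * q).choose x.1 * localCount b c a₁ a₂ x.2 q := by
  have h : (pairCount b c a₁ a₂ p q : ℤ) = ((∑ x ∈ Finset.HasAntidiagonal.antidiagonal p,
      (a₁ - b * q).choose x.1 * localCount b c a₁ a₂ x.2 q : ℕ) : ℤ) := by
    rw [← coeff_rowPoly, rowPoly_eq hb h₁ h₂, coeff_mul]
    push_cast
    refine Finset.sum_congr rfl fun x _ => ?_
    rw [coeff_localPoly, coeff_one_add_X_pow]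
  exact_mod_cast h

theorem choose_mul_localCount_le {b c a₁ a₂ : ℕ} (hb : 0 < b) (h₁ : 0 < a₁) (h₂ : 0 < a₂)
    (p l q : ℕ) : (a₁ - b * q).choose p * localCount b c a₁ a₂ l q ≤
      pairCount b c a₁ a₂ (p + l) q := by
  rw [pairCount_eq_sum hb h₁ h₂]
  exact Finset.single_le_sum (f := fun x : ℕ × ℕ =>
    (a₁ - b * q).choose x.1 * localCount b c a₁ a₂ x.2 q) (fun _ _ => Nat.zero_le _)
    (a := (p, l)) (by simp)

theorem localCount_pos {b c a₁ a₂ : ℕ} {S₁ S₂ : Finset ℕ}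
    (hS₁ : S₁ ⊆ Finset.range a₁) (hS₂ : S₂ ⊆ Finset.range a₂)
    (h : Admissible b c a₁ a₂ (cum a₁ S₁) (cum a₂ S₂))
    (hl : ∀ k ∈ S₁, Shadowed b a₁ a₂ (cum a₂ S₂) k) :
    0 < localCount b c a₁ a₂ S₁.card S₂.card := by
  classical
  refine Finset.card_pos.2 ⟨(S₁, S₂), ?_⟩
  rw [Finset.mem_filter, localPairs, Finset.mem_filter, mem_modelPairs]
  exact ⟨⟨⟨hS₁, hS₂, h⟩, Finset.disjoint_left.2 fun k hk hk' => (mem_freeEdges.1 hk').2 (hl k hk)⟩,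
    rfl, rfl⟩

theorem shadowed_of_window {b a₁ a₂ : ℕ} (h₁ : 0 < a₁) (h₂ : 0 < a₂) {S₂ : Finset ℕ} {t : ℤ}
    {P : ℤ → Prop} (H : ∀ z, t ≤ z → z < t + a₁ → P z → Shadowed b a₁ a₂ (cum a₂ S₂) z) :
    ∀ k ∈ ofWindow a₁ t P, Shadowed b a₁ a₂ (cum a₂ S₂) k := by
  classical
  intro k hk
  have h₁' : (0 : ℤ) < a₁ := by exact_mod_cast h₁
  have hr1 := Int.emod_nonneg (k - t) h₁'.ne'
  have hr2 := Int.emod_lt_of_pos (k - t) h₁'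
  have e := Int.emod_add_mul_ediv (k - t) a₁
  have := H (t + (k - t) % a₁) (by omega) (by omega) (by
    rw [ofWindow, Finset.mem_filter] at hk; exact hk.2)
  rw [← shadowed_add_mul_period h₁ h₂ S₂ _ ((k - t) / a₁)] at this
  rwa [show t + (k - t) % a₁ + (k - t) / a₁ * a₁ = (k : ℤ) by linarith] at this

set_option maxHeartbeats 1000000 in
/-- A lower bound for the counts in the row `e` of the type `(n + b e) × (h + c n)`. -/
theorem choose_le_pairCount {b c e n h D : ℕ} (hb : 0 < b) (hn : 0 < n) (hh : 0 < h)
    (hsum : e + h = c * n) (hD : b * e * h = c * n ^ 2 + D) (hne : n ≤ b * e) (hnh : n ≤ b * h)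
    (hD0 : 0 < D) (p : ℕ) : n.choose p ≤ pairCount b c (n + b * e) (h + c * n) (p + n) e := by
  classical
  set A₁ := n + b * e with hA₁
  set A₂ := h + c * n with hA₂
  have h₁ : 0 < A₁ := by omega
  have h₂ : 0 < A₂ := by omega
  have eA₁ : (A₁ : ℤ) = n + b * e := by rw [hA₁]; push_cast; ring
  have eA₂ : (A₂ : ℤ) = h + c * n := by rw [hA₂]; push_cast; ring
  have hsum' : (e : ℤ) + h = c * n := by exact_mod_cast hsum
  have hD' : (b : ℤ) * e * h = c * n ^ 2 + D := by exact_mod_cast hD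
  have hne' : (n : ℤ) ≤ b * e := by exact_mod_cast hne
  have hnh' : (n : ℤ) ≤ b * h := by exact_mod_cast hnh
  have h₁' : (0 : ℤ) < A₁ := by exact_mod_cast h₁
  have h₂' : (0 : ℤ) < A₂ := by exact_mod_cast h₂
  have hn' : (0 : ℤ) < n := by exact_mod_cast hn
  have hh' : (0 : ℤ) < h := by exact_mod_cast hh
  have hb' : (0 : ℤ) < b := by exact_mod_cast hb
  have hbA : (A₁ : ℤ) ≤ b * A₂ := by
    rw [eA₁, eA₂, ← hsum', mul_add, mul_add]; linarith
  have hD1 : (b : ℤ) * e * A₂ = c * n * A₁ + D := by rw [eA₁, eA₂]; linear_combination hD'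
  -- The quadratic form bc A₁A₂ - c A₁² - b A₂² is positive at the large type. This decides the
  -- contradiction below.
  have hdisc : (b : ℤ) * c * A₁ * A₂ - c * A₁ ^ 2 - b * A₂ ^ 2 = D * (1 + 2 * b * c) := by
    have e0 : (e : ℤ) = c * n - h := by linarith
    rw [eA₁, eA₂]
    rw [e0] at hD' ⊢
    linear_combination (1 + 2 * b * c : ℤ) * hD'
  -- The pair consists of the e vertical edges just below height 0 and of the n horizontal edges
  -- that begin be units to the left of the origin.
  set P₁ : ℤ → Prop := fun k => -(b * e : ℤ) ≤ k ∧ k < n - b * e with hP₁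
  set P₂ : ℤ → Prop := fun j => -(e : ℤ) ≤ j with hP₂
  set S₁ := ofWindow A₁ (-A₁) P₁ with hS₁d
  set S₂ := ofWindow A₂ (-A₂) P₂ with hS₂d
  have hS₁ : S₁ ⊆ Finset.range A₁ := ofWindow_subset _ _ _
  have hS₂ : S₂ ⊆ Finset.range A₂ := ofWindow_subset _ _ _
  have heA₂ : (e : ℤ) ≤ A₂ := by omega
  have cum₂ : ∀ x y : ℤ, -(A₂ : ℤ) ≤ x → x ≤ y → y ≤ 0 →
      cum A₂ S₂ y - cum A₂ S₂ x = max 0 (y - max x (-e)) := by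
    intro x y h3 h4 h5
    rw [hS₂d, cum_ofWindow h3 h4 (by omega),
      card_filter_Ico_eq (l := -e) (u := y) fun z _ hz => by simp [hP₂, hz]]
    simp
  have cum₁ : ∀ x y : ℤ, -(A₁ : ℤ) ≤ x → x ≤ y → y ≤ 0 →
      cum A₁ S₁ y - cum A₁ S₁ x = max 0 (min y (n - b * e) - max x (-(b * e))) := by
    intro x y h3 h4 h5
    rw [hS₁d, cum_ofWindow h3 h4 (by omega),
      card_filter_Ico_eq (l := -(b * e)) (u := n - b * e) fun z _ hz => by simp [hP₁]]
  have card₂ : S₂.card = e := by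
    have h3 := cum₂ (-A₂) 0 le_rfl (by omega) le_rfl
    have h4 := cum_add_period h₂ S₂ (-A₂)
    rw [neg_add_cancel] at h4
    omega
  have card₁ : S₁.card = n := by
    have h3 := cum₁ (-A₁) 0 le_rfl (by omega) le_rfl
    have h4 := cum_add_period h₁ S₁ (-A₁)
    rw [neg_add_cancel] at h4
    omega
  have hgt : ∀ k : ℤ, -(A₁ : ℤ) ≤ k → -(A₂ : ℤ) ≤ height A₁ A₂ k := by
    intro k hk
    rw [le_height_iff h₁]
    have := mul_le_mul_of_nonneg_right hk h₂'.le
    linarith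
  have hneg : ∀ k : ℤ, k < 0 → height A₁ A₂ k < 0 := by
    intro k hk
    by_contra hh
    rw [not_lt, le_height_iff h₁] at hh
    have := mul_neg_of_neg_of_pos hk h₂'
    linarith
  have hadm : Admissible b c A₁ A₂ (cum A₁ S₁) (cum A₂ S₂) := by
    refine admissible_of_window h₁ h₂ hS₁ hS₂ (-A₁) fun k j hk hk0 hkS hjS hlt hle => ?_
    rw [hS₁d, mem_ofWindow hk (by omega)] at hkS
    obtain ⟨hk1, hk2⟩ := hkS
    have hkneg : k < 0 := by omega
    have hjk : height A₁ A₂ k ≤ j := (lt_abscissa_iff h₁ h₂).1 hlt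
    have hjk' : j < height A₁ A₂ k + A₂ := by
      rwa [abscissa_le_iff h₁ h₂, height_add_period h₁] at hle
    have hk3 := hgt k hk
    have hk4 := hneg k hkneg
    rcases lt_or_ge j 0 with hj0 | hj0
    · rw [hS₂d, mem_ofWindow (by omega) (by omega)] at hjS
      simp only [hP₂] at hjS
      by_contra hcon
      push Not at hcon
      obtain ⟨hF, hG⟩ := hcon
      have hX0 : abscissa A₁ A₂ j ≤ 0 := by rw [abscissa_le_iff h₁ h₂]; simpa using hj0
      -- Failure of the first alternative at j - 1, written as a slope inequality at k. If j =
      -- height k there is no such choice, but then the inequality holds because c (n - (k + be)) ≥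
      -- 1.
      have hy : (-(-1 - j) - c * (n - (k + b * e)) : ℤ) * A₁ ≤ k * A₂ := by
        rw [← le_height_iff h₁]
        by_contra hlt'
        have hcn : (0 : ℤ) ≤ c * (n - (k + b * e)) := by
          have : (0 : ℤ) ≤ n - (k + b * e) := by linarith
          positivity
        rcases Nat.eq_zero_or_pos c with rfl | hc
        · simp at hsum; omega
        have hc' : (1 : ℤ) ≤ c := by exact_mod_cast hc
        have hcn1 : (1 : ℤ) ≤ c * (n - (k + b * e)) :=
          one_le_mul_of_one_le_of_one_le hc' (by omega)
        have hj1 : height A₁ A₂ k ≤ j - 1 := by omega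
        have h3 := hF (j - 1) hj1 (by omega)
        have h4 : k < abscissa A₁ A₂ (j - 1) := (lt_abscissa_iff h₁ h₂).2 hj1
        have h5 : abscissa A₁ A₂ (j - 1) ≤ abscissa A₁ A₂ j := abscissa_mono h₂ (by omega)
        rw [cum₁ _ _ hk h4.le (by omega)] at h3
        have h6 : max 0 (min (abscissa A₁ A₂ (j - 1)) (n - b * e : ℤ) - max k (-(b * e))) ≤
            n - (k + b * e) := by omega
        have h7 : (c : ℤ) * max 0 (min (abscissa A₁ A₂ (j - 1)) (n - b * e : ℤ) -
            max k (-(b * e))) ≤ c * (n - (k + b * e)) := by gcongr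
        omega
      -- Failure of the second alternative at k + 1; if j stands already at k + 1, the bound on its
      -- abscissa is immediate.
      have hx : (j + 1) * A₁ ≤ (k + b * (e + j + 1)) * A₂ := by
        rw [← abscissa_le_iff_mul h₁ h₂]
        have hbe : (0 : ℤ) ≤ b * (e + j) := mul_nonneg hb'.le (by omega)
        rcases lt_or_eq_of_le (show k + 1 ≤ abscissa A₁ A₂ j from hlt) with h3 | h3
        · have h4 := hG (k + 1) (by omega) h3
          have h5 : height A₁ A₂ (k + 1) ≤ j := (lt_abscissa_iff h₁ h₂).1 h3
          rw [cum₂ _ _ (hgt _ (by omega)) (by omega) (by omega)] at h4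
          have h6 : max 0 (j + 1 - max (height A₁ A₂ (k + 1)) (-e)) ≤ e + j + 1 := by omega
          have h7 : (b : ℤ) * max 0 (j + 1 - max (height A₁ A₂ (k + 1)) (-e)) ≤
            b * (e + j + 1) := by gcongr
          omega
        · rw [← h3, show (b : ℤ) * (e + j + 1) = b * (e + j) + b by ring]
          omega
      set J : ℤ := k + b * e with hJ
      set y' : ℤ := -1 - j with hy'
      have hJ0 : 0 ≤ J := by omega
      have e1 : D + (c * A₁ - A₂) * J ≤ A₁ * y' := by
        have : k = J - b * e := by omega
        rw [this] at hy
        linear_combination hy - hD1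
      have e2 : (b * A₂ - A₁) * y' ≤ J * A₂ := by
        have : k = J - b * e := by omega
        have hj : j = -1 - y' := by omega
        rw [this, hj] at hx
        linear_combination hx
      -- Eliminating y' from the two inequalities makes a positive term plus a nonnegative multiple
      -- of J at most 0.
      have e3 : (b * A₂ - A₁ : ℤ) * (D + (c * A₁ - A₂) * J) ≤ (b * A₂ - A₁) * (A₁ * y') :=
        mul_le_mul_of_nonneg_left e1 (by omega)
      have e4 : A₁ * ((b * A₂ - A₁ : ℤ) * y') ≤ A₁ * (J * A₂) := by gcongr
      have e5 : (b * A₂ - A₁ : ℤ) * D + J * (D * (1 + 2 * b * c)) ≤ 0 := by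
        rw [← hdisc]
        linear_combination e3 + e4
      have e6 : (0 : ℤ) < b * A₂ - A₁ := by
        rw [eA₁, eA₂, mul_add, show (b : ℤ) * (c * n) = b * (c * n) from rfl, ← hsum', mul_add]
        have : 0 < (b : ℤ) * h := by positivity
        linarith
      have hD0' : (0 : ℤ) < D := by exact_mod_cast hD0
      have e7 : (0 : ℤ) < (b * A₂ - A₁) * D := by positivity
      have e8 : (0 : ℤ) ≤ J * (D * (1 + 2 * b * c)) := by positivity
      linarith
    -- Now j lies in the copy of the vertical block one period later, and the origin serves as the
    -- point A.
    · right
      have hj2 : ((j - A₂) % A₂).toNat ∈ S₂ := by rwa [Int.sub_emod_right]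
      rw [hS₂d, mem_ofWindow (by omega) (by omega)] at hj2
      simp only [hP₂] at hj2
      refine ⟨0, hkneg, by rw [lt_abscissa_iff h₁ h₂]; simpa using hj0, ?_⟩
      have h3 := cum_add_period h₂ S₂ (j + 1 - A₂)
      have h4 := cum_add_period h₂ S₂ (-A₂)
      rw [neg_add_cancel] at h4
      rw [sub_add_cancel] at h3
      have h5 := cum₂ (-A₂) (j + 1 - A₂) le_rfl (by omega) (by omega)
      have h6 : cum A₂ S₂ (j + 1) - cum A₂ S₂ 0 = j + 1 - A₂ + e := by omega
      rw [height_zero, h6]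
      by_contra hcon
      have h7 : abscissa A₁ A₂ j ≤ b * (j + 1 - A₂ + e) - 1 := by omega
      rw [abscissa_le_iff_mul h₁ h₂] at h7
      have h8 : (j + 1 - A₂ : ℤ) ≤ 0 := by omega
      have h9 : (0 : ℤ) ≤ (j + 1 - A₂) * (A₁ - b * A₂) := mul_nonneg_of_nonpos_of_nonpos h8 (by omega)
      have h10 : (0 : ℤ) < (n + 1) * A₂ := by positivity
      rw [eA₁] at h7 h9
      linarith
  have hloc : ∀ k ∈ S₁, Shadowed b A₁ A₂ (cum A₂ S₂) k := by
    refine shadowed_of_window h₁ h₂ fun z hz hz' hzP => ⟨0, by omega, ?_⟩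
    obtain ⟨hk1, hk2⟩ := hzP
    have h3 := cum₂ (height A₁ A₂ z) 0 (hgt z hz) (hneg z (by omega)).le le_rfl
    unfold pot
    rw [height_zero]
    rcases le_or_gt (height A₁ A₂ z) (-e) with h4 | h4
    · have h5 : cum A₂ S₂ 0 = cum A₂ S₂ (height A₁ A₂ z) + e := by omega
      rw [h5, mul_add]; omega
    · have h5 : cum A₂ S₂ 0 = cum A₂ S₂ (height A₁ A₂ z) - height A₁ A₂ z := by
        have := hneg z (by omega)
        omega
      rw [h5, mul_sub]
      have h6 : height A₁ A₂ z * A₁ ≤ z * A₂ := (le_height_iff h₁).1 le_rfl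
      have h7 : b * height A₁ A₂ z ≤ z := by
        have h8 : z * (b * A₂) ≤ z * A₁ := mul_le_mul_of_nonpos_left hbA (by omega)
        have : b * height A₁ A₂ z * A₁ ≤ z * A₁ := by
          have := mul_le_mul_of_nonneg_left h6 hb'.le
          linarith
        exact le_of_mul_le_mul_right this h₁'
      linarith
  -- One local pair suffices: row e has exactly n free edges, and choosing p of them yields the
  -- binomial coefficient.
  have hpos := localCount_pos hS₁ hS₂ hadm hloc
  rw [card₁, card₂] at hpos
  have := choose_mul_localCount_le (c := c) hb h₁ h₂ p n e
  rw [show A₁ - b * e = n by omega] at this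
  exact (Nat.le_mul_of_pos_right _ hpos).trans this

end RankTwoCluster

/-! ### The recursion, its invariant, and two numerical contradictions. -/

namespace RankTwoCluster

/-- Five consecutive data of the recursion `h_{m-1} + h_{m+1} = c h_m`, `h_m + h_{m+2} = b h_{m+1}`
together with its quadratic invariant `D`. -/
structure RecState (b c e n h k D : ℕ) : Prop where
  b_pos : 0 < b
  c_pos : 0 < c
  e_pos : 0 < e
  n_pos : 0 < n
  h_pos : 0 < h
  D_pos : 0 < D
  sum : e + h = c * n
  sum' : n + k = b * h
  disc : b * e * h = c * n ^ 2 + D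
  D_le : D + 4 ≤ b * c
  coprime : Nat.Coprime e n

namespace RecState
variable {b c e n h k D : ℕ}

theorem mul_eq (s : RecState b c e n h k D) : e * k = n * h + D := by
  have h1 : (e : ℤ) + h = c * n := by exact_mod_cast s.sum
  have h2 : (n : ℤ) + k = b * h := by exact_mod_cast s.sum'
  have h3 : (b : ℤ) * e * h = c * n ^ 2 + D := by exact_mod_cast s.disc
  have : (e : ℤ) * k = n * h + D := by linear_combination e * h2 + h3 - n * h1
  exact_mod_cast this

theorem k_pos (s : RecState b c e n h k D) : 0 < k := by
  have := s.mul_eq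
  have := s.D_pos
  rcases Nat.eq_zero_or_pos k with rfl | h
  · simp at *; omega
  · exact h

theorem coprime' (s : RecState b c e n h k D) : Nat.Coprime n h := by
  have h1 : Nat.gcd n h ∣ e := by
    rw [← Nat.dvd_add_left (Nat.gcd_dvd_right n h), s.sum]
    exact (Nat.gcd_dvd_left n h).mul_left c
  exact Nat.eq_one_of_dvd_one (s.coprime ▸ Nat.dvd_gcd h1 (Nat.gcd_dvd_left n h))

theorem next (s : RecState b c e n h k D) : RecState c b n h k (c * k - h) D where
  b_pos := s.c_pos
  c_pos := s.b_pos
  e_pos := s.n_pos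
  n_pos := s.h_pos
  h_pos := s.k_pos
  D_pos := s.D_pos
  sum := s.sum'
  sum' := by
    have h1 : (e : ℤ) + h = c * n := by exact_mod_cast s.sum
    have h2 : (n : ℤ) + k = b * h := by exact_mod_cast s.sum'
    have h3 : (b : ℤ) * e * h = c * n ^ 2 + D := by exact_mod_cast s.disc
    have h4 : (n : ℤ) * (c * k) = n * h + (h * k + D) := by
      linear_combination c * n * h2 + h3 - b * h * h1 - h * h2
    have hn : (0 : ℤ) < n := by exact_mod_cast s.n_pos
    have h5 : (n : ℤ) * h ≤ n * (c * k) := by rw [h4]; exact le_add_of_nonneg_right (by positivity)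
    have h6 : h ≤ c * k := by exact_mod_cast le_of_mul_le_mul_left h5 hn
    omega
  disc := by
    have h1 : (e : ℤ) + h = c * n := by exact_mod_cast s.sum
    have h2 : (n : ℤ) + k = b * h := by exact_mod_cast s.sum'
    have h3 : (b : ℤ) * e * h = c * n ^ 2 + D := by exact_mod_cast s.disc
    have : (c : ℤ) * n * k = b * h ^ 2 + D := by linear_combination c * n * h2 + h3 - b * h * h1
    exact_mod_cast this
  D_le := by rw [mul_comm]; exact s.D_le
  coprime := s.coprime'

/-- The ratio bound. -/
theorem two_mul_next (s : RecState b c e n h k D) (hbe : b * e ≤ 2 * n) : c * n ≤ 2 * h := by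
  have h1 : (e : ℤ) + h = c * n := by exact_mod_cast s.sum
  have h2 : (b : ℤ) * e ≤ 2 * n := by exact_mod_cast hbe
  have h4 : (D : ℤ) + 4 ≤ b * c := by exact_mod_cast s.D_le
  have hb : (0 : ℤ) < b := by exact_mod_cast s.b_pos
  have hn : (0 : ℤ) < n := by exact_mod_cast s.n_pos
  have hD : (0 : ℤ) < D := by exact_mod_cast s.D_pos
  -- The wildness enters through 2be ≤ 4n ≤ bcn.
  have : (b : ℤ) * (2 * e) ≤ b * (c * n) := by
    have : (4 : ℤ) * n ≤ b * c * n := mul_le_mul_of_nonneg_right (by linarith) hn.le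
    linarith
  have := le_of_mul_le_mul_left this hb
  have : (c : ℤ) * n ≤ 2 * h := by linarith
  exact_mod_cast this

/-- Small values of the linear form `b h q - c n p` are only taken for `q ≥ e`. -/
def Gap (b c e n h D : ℕ) : Prop :=
  ∀ q p : ℤ, 0 < q → 0 < b * h * q - c * n * p → b * h * q - c * n * p ≤ D → e ≤ q

theorem gap_of_eq_one (b c n h D : ℕ) : Gap b c 1 n h D := by
  intro q p hq _ _
  push_cast
  omega

/-- The next linear form at (q, p) equals the present one at (cq - p, q), so cq - p ≥ e. If q < n
held, the value would be at least bhe - cnq = D + cn(n - q), which exceeds D. -/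
theorem Gap.next (s : RecState b c e n h k D) (hg : Gap b c e n h D) : Gap c b n h k D := by
  have h1 : (e : ℤ) + h = c * n := by exact_mod_cast s.sum
  have h2 : (n : ℤ) + k = b * h := by exact_mod_cast s.sum'
  have h3 : (b : ℤ) * e * h = c * n ^ 2 + D := by exact_mod_cast s.disc
  have hb : (0 : ℤ) < b := by exact_mod_cast s.b_pos
  have hc : (0 : ℤ) < c := by exact_mod_cast s.c_pos
  have hn : (0 : ℤ) < n := by exact_mod_cast s.n_pos
  have hh : (0 : ℤ) < h := by exact_mod_cast s.h_pos
  intro q p hq hi hiD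
  have hk : (k : ℤ) = b * h - n := by linarith
  have e1 : (c : ℤ) * k * q - b * h * p = b * h * (c * q - p) - c * n * q := by rw [hk]; ring
  have hpos : 0 < c * q - p := by
    by_contra hh'
    have h5 : (b : ℤ) * h * (c * q - p) ≤ 0 :=
      mul_nonpos_of_nonneg_of_nonpos (by positivity) (not_lt.1 hh')
    have h6 : 0 < (c : ℤ) * n * q := by positivity
    linarith
  have h7 := hg (c * q - p) q hpos (by rw [← e1]; exact hi) (by rw [← e1]; exact hiD)
  by_contra hlt
  rw [not_le] at hlt
  have h8 : (c : ℤ) * n * (n - q) > 0 := by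
    have : 0 < (n : ℤ) - q := by linarith
    positivity
  have h9 : (b : ℤ) * h * e ≤ b * h * (c * q - p) := mul_le_mul_of_nonneg_left h7 (by positivity)
  rw [e1] at hiD
  nlinarith

end RecState

/-- The hypotheses `i1` and `i2` are what the failure of both alternatives amounts to. Multiplying
them by B₁ and bB₂ - B₁ and adding eliminates κ, and the discriminant identity leaves an upper bound
proportional to D. After scaling by n, the left side is at least (D + 1)(bB₂ - B₁)B₁ by `hi`, while
k ≥ (D + 1)n keeps the right side at most D(bB₂ - B₁)B₁. -/
theorem numeric_of_pos {b c e n h k D g κ Q P : ℤ} (hb : 0 < b) (hc : 0 < c) (hn : 0 < n)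
    (hh : 0 < h) (hD : 0 < D) (h1 : e + h = c * n) (h2 : n + k = b * h)
    (h3 : b * e * h = c * n ^ 2 + D) (h4 : D + 4 ≤ b * c) (hk : (D + 1) * n ≤ k)
    (i1 : g * (h + c * k) ≤ D + κ * (b * (h + c * k) - (n + b * h)))
    (i2 : κ * (n + b * h) ≤ D + g * (c * (n + b * h) - (h + c * k)) -
      (b * Q * (h + c * k) - c * P * (n + b * h)))
    (hQ : 0 < Q) (hi : D + 1 ≤ b * h * Q - c * n * P) (hg : g ≤ k) : False := by
  have hk0 : 0 < k := lt_of_lt_of_le (by positivity) hk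
  have hk2 : 2 * n ≤ k := by nlinarith
  set B₁ := n + b * h with hB₁
  set B₂ := h + c * k with hB₂
  have eB₁ : B₁ = 2 * n + k := by rw [hB₁]; linarith
  have hn2 : n * B₂ = h * B₁ + D := by
    rw [hB₁, hB₂]; linear_combination c * n * h2 + h3 - b * h * h1
  have eW : b * B₂ - B₁ = b * c * k - n := by rw [hB₁, hB₂]; ring
  have hbck : 5 * k ≤ b * c * k := mul_le_mul_of_nonneg_right (by linarith) hk0.le
  have hW : 0 < b * B₂ - B₁ := by rw [eW]; linarith
  have hdisc : (b * B₂ - B₁) * (c * B₁ - B₂) = D * (1 + 2 * b * c) + B₁ * B₂ := by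
    have e0 : e = c * n - h := by linarith
    have k0 : k = b * h - n := by linarith
    rw [hB₁, hB₂]
    rw [e0] at h3
    rw [k0]
    linear_combination (1 + 2 * b * c : ℤ) * h3
  have c1 := mul_le_mul_of_nonneg_left i2 hW.le
  have hB₁0 : 0 < B₁ := by positivity
  have c2 := mul_le_mul_of_nonneg_left i1 hB₁0.le
  have c3 : (b * B₂ - B₁) * (b * Q * B₂ - c * P * B₁) ≤ D * (b * B₂) + g * (D * (1 + 2 * b * c)) := by
    linear_combination c1 + c2 + g * hdisc
  have c4 : (b * B₂ - B₁) * (B₁ * (b * h * Q - c * n * P) + D * b * Q) ≤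
      n * (D * (b * B₂) + g * (D * (1 + 2 * b * c))) := by
    have := mul_le_mul_of_nonneg_left c3 hn.le
    linear_combination this - (b * B₂ - B₁) * b * Q * hn2
  have c5 : (b * B₂ - B₁) * (B₁ * (D + 1)) ≤
      (b * B₂ - B₁) * (B₁ * (b * h * Q - c * n * P) + D * b * Q) := by
    have : B₁ * (D + 1) ≤ B₁ * (b * h * Q - c * n * P) := mul_le_mul_of_nonneg_left hi hB₁0.le
    have h0 : 0 ≤ D * b * Q := by positivity
    exact mul_le_mul_of_nonneg_left (by linarith) hW.le
  have c6 : n * (D * (b * B₂) + g * (D * (1 + 2 * b * c))) ≤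
      D * (n * (b * B₂ + k * (1 + 2 * b * c))) := by
    have h0 : 0 ≤ D * (1 + 2 * b * c) := by positivity
    have := mul_le_mul_of_nonneg_right hg h0
    have := mul_le_mul_of_nonneg_left this hn.le
    linear_combination this
  have c7 : n * (b * B₂ + k * (1 + 2 * b * c)) ≤ (b * B₂ - B₁) * B₁ := by
    have e5 : b * B₂ = n + k + b * c * k := by rw [hB₂]; linear_combination -h2
    rw [e5, eB₁]
    have t1 : 2 * n * (b * c * k) ≤ k * (b * c * k) := mul_le_mul_of_nonneg_right hk2 (by positivity)
    have t2 : 5 * k * n ≤ b * c * k * n := mul_le_mul_of_nonneg_right hbck hn.le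
    have t3 : 2 * n * n ≤ k * n := mul_le_mul_of_nonneg_right hk2 hn.le
    nlinarith
  have c8 : D * (n * (b * B₂ + k * (1 + 2 * b * c))) ≤ D * ((b * B₂ - B₁) * B₁) :=
    mul_le_mul_of_nonneg_left c7 hD.le
  have c9 : 0 < (b * B₂ - B₁) * B₁ := by positivity
  linarith

/-- Here no old vertical edge contributes. The bound `i2` gives nκ - ge < 1, and nκ = ge is
impossible because n is prime to e and 0 < g < n. So nκ ≤ ge - 1, and the unit gained, multiplied by
bB₂ - B₁ = bck - n, contradicts `i1`. -/
theorem numeric_of_zero {b c e n h k D g κ : ℤ} (hb : 0 < b) (hc : 0 < c) (hn : 0 < n)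
    (hh : 0 < h) (hD : 0 < D) (h1 : e + h = c * n) (h2 : n + k = b * h)
    (h3 : b * e * h = c * n ^ 2 + D) (h4 : D + 4 ≤ b * c) (hk : (D + 1) * n ≤ k)
    (hcop : IsCoprime e n)
    (i1 : g * (h + c * k) ≤ D + κ * (b * (h + c * k) - (n + b * h)))
    (i2 : κ * (n + b * h) ≤ D + g * (c * (n + b * h) - (h + c * k)))
    (hg : 0 < g) (hgn : g < n) : False := by
  have hk0 : 0 < k := lt_of_lt_of_le (by positivity) hk
  set B₁ := n + b * h with hB₁
  set B₂ := h + c * k with hB₂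
  have eB₁ : B₁ = 2 * n + k := by rw [hB₁]; linarith
  have hB₁0 : 0 < B₁ := by positivity
  have eW : b * B₂ - B₁ = b * c * k - n := by rw [hB₁, hB₂]; ring
  have hbck : 5 * k ≤ b * c * k := mul_le_mul_of_nonneg_right (by linarith) hk0.le
  have hkn : n ≤ k := by nlinarith
  have hW : 0 < b * B₂ - B₁ := by rw [eW]; linarith
  have c1 : (n * κ - g * e) * B₁ ≤ D * (n - g) := by
    have hn' := mul_le_mul_of_nonneg_left i2 hn.le
    have e2 : n * (c * B₁ - B₂) = e * B₁ - D := by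
      rw [hB₁, hB₂]; linear_combination -c * n * h2 - h3 - n * h1
    linear_combination hn' + g * e2
  have c2 : D * (n - g) < B₁ := by nlinarith
  have c3 : n * κ - g * e < 1 := by
    by_contra hh'
    have := mul_le_mul_of_nonneg_right (not_lt.1 hh') hB₁0.le
    linarith
  have c4 : n * κ ≠ g * e := by
    intro hh'
    have : n ∣ g * e := ⟨κ, hh'.symm⟩
    have := hcop.symm.dvd_of_dvd_mul_right this
    exact absurd (Int.le_of_dvd hg this) (by omega)
  have c5 : n * κ ≤ g * e - 1 := by omega
  have c6 : e * (b * B₂ - B₁) = n * B₂ + b * c * D := by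
    have e0 : e = c * n - h := by linarith
    have k0 : k = b * h - n := by linarith
    rw [hB₁, hB₂]
    rw [e0] at h3 ⊢
    rw [k0]
    linear_combination b * c * h3
  have c7 := mul_le_mul_of_nonneg_left i1 hn.le
  have c8 := mul_le_mul_of_nonneg_right c5 hW.le
  have c9 : b * c * k - n ≤ n * D + g * (b * c * D) := by
    rw [← eW]
    linear_combination c7 + c8 + g * c6
  have c10 : g * (b * c * D) ≤ (n - 1) * (b * c * D) :=
    mul_le_mul_of_nonneg_right (by omega) (by positivity)
  have c11 : b * c * ((D + 1) * n) ≤ b * c * k := mul_le_mul_of_nonneg_left hk (by positivity)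
  have c12 : n * (D + 4) ≤ n * (b * c) := mul_le_mul_of_nonneg_left h4 hn.le
  have c13 : 0 < b * c * D := by positivity
  linarith

end RankTwoCluster

/-! ### Anchors and the transplanted pair. -/

namespace RankTwoCluster

theorem freeEdges_subset (b a₁ a₂ : ℕ) (S₂ : Finset ℕ) : freeEdges b a₁ a₂ S₂ ⊆ Finset.range a₁ :=
  fun _ hk => Finset.mem_range.2 (mem_freeEdges.1 hk).1

theorem mem_freeEdges_emod {b a₁ a₂ : ℕ} (h₁ : 0 < a₁) (h₂ : 0 < a₂) (S₂ : Finset ℕ) (z : ℤ) :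
    (z % a₁).toNat ∈ freeEdges b a₁ a₂ S₂ ↔ ¬Shadowed b a₁ a₂ (cum a₂ S₂) z := by
  have h₁' : (0 : ℤ) < a₁ := by exact_mod_cast h₁
  have hr1 := Int.emod_nonneg z h₁'.ne'
  have hr2 := Int.emod_lt_of_pos z h₁'
  have e := Int.emod_add_mul_ediv z a₁
  rw [mem_freeEdges, show (((z % a₁).toNat : ℕ) : ℤ) = z % a₁ by omega,
    ← shadowed_add_mul_period h₁ h₂ S₂ (z % a₁) (z / a₁),
    show z % a₁ + z / a₁ * a₁ = z by linarith]
  simp only [and_iff_right_iff_imp]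
  omega

/-- Between unshadowed edges, the free edges are counted by the potential. -/
theorem cum_freeEdges_sub {b a₁ a₂ : ℕ} (h₁ : 0 < a₁) (h₂ : 0 < a₂) {S₂ : Finset ℕ}
    (hS : S₂ ⊆ Finset.range a₂) {m m' : ℤ} (hm : ¬Shadowed b a₁ a₂ (cum a₂ S₂) m)
    (hm' : ¬Shadowed b a₁ a₂ (cum a₂ S₂) m') (hle : m ≤ m') :
    cum a₁ (freeEdges b a₁ a₂ S₂) m' - cum a₁ (freeEdges b a₁ a₂ S₂) m =
      pot b a₁ a₂ (cum a₂ S₂) m' - pot b a₁ a₂ (cum a₂ S₂) m := by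
  have hU := unitSteps_cum hS
  have hF : freeEdges b a₁ a₂ S₂ ⊆ Finset.range a₁ := freeEdges_subset b a₁ a₂ S₂
  suffices H : ∀ n : ℕ, ∀ m', m' = m + n → ¬Shadowed b a₁ a₂ (cum a₂ S₂) m' →
      cum a₁ (freeEdges b a₁ a₂ S₂) m' - cum a₁ (freeEdges b a₁ a₂ S₂) m =
      pot b a₁ a₂ (cum a₂ S₂) m' - pot b a₁ a₂ (cum a₂ S₂) m from
    H (m' - m).toNat m' (by omega) hm'
  intro n
  induction n using Nat.strong_induction_on with
  | _ n ih =>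
  intro m' hn hm'
  rcases Nat.eq_zero_or_pos n with rfl | hpos
  · simp only [Nat.cast_zero, add_zero] at hn
    subst hn
    simp
  obtain ⟨m₁, ⟨h3, h4, h5⟩, h6⟩ := Int.exists_greatest_of_bdd
    (P := fun z => m ≤ z ∧ z < m' ∧ ¬Shadowed b a₁ a₂ (cum a₂ S₂) z) ⟨m', fun z hz => hz.2.1.le⟩
    ⟨m, le_rfl, by omega, hm⟩
  have hrun : ∀ k, m₁ < k → k < m' → Shadowed b a₁ a₂ (cum a₂ S₂) k := by
    intro k hk hk'
    by_contra hh
    exact absurd (h6 k ⟨by omega, hk', hh⟩) (not_le.2 hk)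
  have ih1 := ih (m₁ - m).toNat (by omega) m₁ (by omega) h5
  have hp1 := pot_lt_of_not_shadowed h5 h4
  have hstep := pot_succ_le (b := b) (a₂ := a₂) h₁ hU m₁
  have hp2 : pot b a₁ a₂ (cum a₂ S₂) m' = pot b a₁ a₂ (cum a₂ S₂) m₁ + 1 := by
    rcases lt_or_eq_of_le (show m₁ + 1 ≤ m' from h4) with hlt | heq
    · have := pot_le_of_run hm' hrun (show m₁ < m₁ + 1 by omega) hlt
      omega
    · rw [← heq] at hp1 ⊢; omega
  have hc1 := cum_succ hF m₁
  rw [if_pos ((mem_freeEdges_emod h₁ h₂ S₂ m₁).2 h5)] at hc1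
  have hc2 : ∀ z, m₁ + 1 ≤ z → z ≤ m' →
      cum a₁ (freeEdges b a₁ a₂ S₂) z = cum a₁ (freeEdges b a₁ a₂ S₂) (m₁ + 1) := by
    intro z hz
    induction z, hz using Int.leInduction with
    | base => simp
    | succ z hz ihz =>
      intro hz'
      rw [cum_succ hF, if_neg fun hh => (mem_freeEdges_emod h₁ h₂ S₂ z).1 hh
        (hrun z (by omega) (by omega)), ihz (by omega), add_zero]
  have := hc2 m' h4 le_rfl
  omega

/-- Take the first unshadowed position m' at or after the abscissa of a selected vertical edge. If
it is not that abscissa, then m' - 1 is shadowed, so the potential does not increase from m' - 1 to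
m', which forces a selected vertical edge to stand at m'. A translation moves m' into one period. -/
theorem exists_unshadowed_of_selected {b a₁ a₂ : ℕ} (h₁ : 0 < a₁) (h₂ : 0 < a₂) {S₂ : Finset ℕ}
    (hS : S₂ ⊆ Finset.range a₂) (hlt : b * S₂.card < a₁) (hpos : 0 < S₂.card) :
    ∃ m : ℤ, 1 ≤ m ∧ m ≤ a₁ ∧ ¬Shadowed b a₁ a₂ (cum a₂ S₂) m ∧
      ∃ j, cum a₂ S₂ (j + 1) ≠ cum a₂ S₂ j ∧ abscissa a₁ a₂ j = m := by
  have hU := unitSteps_cum hS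
  have h₁' : (0 : ℤ) < a₁ := by exact_mod_cast h₁
  obtain ⟨i, hi⟩ := Finset.card_pos.1 hpos
  have hi' : i < a₂ := Finset.mem_range.1 (hS hi)
  have hsel : cum a₂ S₂ ((i : ℤ) + 1) ≠ cum a₂ S₂ i := by
    rw [cum_succ_ne_iff hS, Int.emod_eq_of_lt (by omega) (by omega)]
    simpa using hi
  -- some unshadowed edge after the vertical edge `i`
  obtain ⟨x, hx⟩ : (freeEdges b a₁ a₂ S₂).Nonempty := by
    rw [← Finset.card_pos, card_freeEdges h₁ h₂ hS]; omega
  rw [mem_freeEdges] at hx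
  obtain ⟨t, ht⟩ : ∃ t : ℤ, abscissa a₁ a₂ i ≤ x + t * a₁ := by
    refine ⟨|abscissa a₁ a₂ i|, ?_⟩
    have h3 := le_abs_self (abscissa a₁ a₂ i)
    have h4 : |abscissa a₁ a₂ i| * 1 ≤ |abscissa a₁ a₂ i| * a₁ := by gcongr; omega
    omega
  obtain ⟨m', ⟨h3, h4⟩, h5⟩ := Int.exists_least_of_bdd
    (P := fun z => abscissa a₁ a₂ i ≤ z ∧ ¬Shadowed b a₁ a₂ (cum a₂ S₂) z)
    ⟨_, fun z hz => hz.1⟩ ⟨x + t * a₁, ht, (shadowed_add_mul_period h₁ h₂ S₂ x t).not.2 hx.2⟩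
  have key : ∃ j, cum a₂ S₂ (j + 1) ≠ cum a₂ S₂ j ∧ abscissa a₁ a₂ j = m' := by
    rcases eq_or_lt_of_le h3 with h6 | h6
    · exact ⟨i, hsel, h6⟩
    · have h7 : Shadowed b a₁ a₂ (cum a₂ S₂) (m' - 1) := by
        by_contra hh
        exact absurd (h5 (m' - 1) ⟨by omega, hh⟩) (by omega)
      obtain ⟨z, hz, hz'⟩ := h7
      have h8 : pot b a₁ a₂ (cum a₂ S₂) m' ≤ pot b a₁ a₂ (cum a₂ S₂) (m' - 1) := by
        rcases eq_or_lt_of_le (show m' ≤ z by omega) with h9 | h9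
        · subst h9; exact hz'
        · exact (pot_lt_of_not_shadowed h4 h9).le.trans hz'
      obtain ⟨j, hj1, hj2, hj3, _⟩ := exists_reaches (b := b) h₁ h₂ hU
        (show m' - 1 < m' by omega) h8
      exact ⟨j, hj1, by omega⟩
  obtain ⟨j, hj, hjm⟩ := key
  have hr1 := Int.emod_nonneg (m' - 1) h₁'.ne'
  have hr2 := Int.emod_lt_of_pos (m' - 1) h₁'
  have e := Int.emod_add_mul_ediv (m' - 1) a₁
  set s := (m' - 1) / a₁ with hs
  refine ⟨m' + -s * a₁, by linarith, by linarith,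
    (shadowed_add_mul_period h₁ h₂ S₂ m' (-s)).not.2 h4, j + -s * a₂, ?_, ?_⟩
  · rw [cum_succ_ne_iff hS] at hj ⊢
    rwa [Int.add_mul_emod_self_right]
  · rw [abscissa_add_mul_period h₂, hjm]

/-- A local pair together with an unshadowed position at which a selected vertical edge ends. -/
structure Anchored (b c e n h k D : ℕ) (S₁ S₂ : Finset ℕ) (m : ℤ) : Prop where
  state : RecState b c e n h k D
  le_two : b * e ≤ 2 * n
  gap : RecState.Gap b c e n h D
  sub₁ : S₁ ⊆ Finset.range n
  sub₂ : S₂ ⊆ Finset.range h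
  adm : Admissible b c n h (cum n S₁) (cum h S₂)
  loc : ∀ z : ℤ, (z % n).toNat ∈ S₁ → Shadowed b n h (cum h S₂) z
  pos : 0 < S₂.card
  lt : b * S₂.card < n
  one_le : 1 ≤ m
  le : m ≤ n
  free : ¬Shadowed b n h (cum h S₂) m
  sel : ∃ j, cum h S₂ (j + 1) ≠ cum h S₂ j ∧ abscissa n h j = m

/-- The condition selecting the vertical edges of the transplanted pair. -/
def verticalCond (n h : ℕ) (S₂ : Finset ℕ) (m j : ℤ) : Prop :=
  (height n h (m - n) ≤ j ∧ j < height n h m ∧ (j % h).toNat ∈ S₂) ∨ h ≤ j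

/-- The condition selecting the horizontal edges of the transplanted pair. -/
def horizontalCond (b n h : ℕ) (S₁ S₂ : Finset ℕ) (m z : ℤ) : Prop :=
  2 * n - b * (S₂.card + h) ≤ z ∧ z < n ∧
    (¬(m - n ≤ z ∧ z < m ∧ Shadowed b n h (cum h S₂) z) ∨ (z % n).toNat ∈ S₁)

/-- The vertical part of the transplanted pair. -/
noncomputable def graftVertical (c n h k : ℕ) (S₂ : Finset ℕ) (m : ℤ) : Finset ℕ :=
  ofWindow (h + c * k) (2 * h - (h + c * k : ℕ)) (verticalCond n h S₂ m)

/-- The horizontal part of the transplanted pair. -/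
noncomputable def graftHorizontal (b n h : ℕ) (S₁ S₂ : Finset ℕ) (m : ℤ) : Finset ℕ :=
  ofWindow (n + b * h) (2 * n - (n + b * h : ℕ)) (horizontalCond b n h S₁ S₂ m)

namespace Anchored
variable {b c e n h k D : ℕ} {S₁ S₂ : Finset ℕ} {m : ℤ}

/-- From bcn = be + bh = be + n + k, the bounds bc ≥ D + 4 and be ≤ 2n leave at least (D + 1)n for
k. -/
theorem two_mul_le (a : Anchored b c e n h k D S₁ S₂ m) : (D + 1) * n ≤ k := by
  have s := a.state
  have h1 : (e : ℤ) + h = c * n := by exact_mod_cast s.sum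
  have h2 : (n : ℤ) + k = b * h := by exact_mod_cast s.sum'
  have h4 : (D : ℤ) + 4 ≤ b * c := by exact_mod_cast s.D_le
  have h5 : (b : ℤ) * e ≤ 2 * n := by exact_mod_cast a.le_two
  have h6 : ((D : ℤ) + 4) * n ≤ b * c * n := mul_le_mul_of_nonneg_right h4 (by positivity)
  have h7 : (b : ℤ) * c * n = b * e + b * h := by rw [mul_assoc, ← h1]; ring
  have : ((D : ℤ) + 1) * n ≤ k := by linarith
  exact_mod_cast this

/-- With B₁ = n + bh and B₂ = h + ck one has nB₂ = hB₁ + D, so the new diagonal is steeper by only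
D/(nB₁). As nD < B₁, no lattice point changes sides for these x. -/
theorem height_eq (a : Anchored b c e n h k D S₁ S₂ m) {x : ℤ} (hx : 1 - n ≤ x) (hx' : x ≤ n) :
    height (n + b * h) (h + c * k) x = height n h x := by
  have s := a.state
  have hn := s.n_pos
  have hn' : (0 : ℤ) < n := by exact_mod_cast hn
  have hB : 0 < n + b * h := by omega
  have h2 : (n : ℤ) + k = b * h := by exact_mod_cast s.sum'
  have h3 : (b : ℤ) * e * h = c * n ^ 2 + D := by exact_mod_cast s.disc
  have h1 : (e : ℤ) + h = c * n := by exact_mod_cast s.sum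
  have hk : ((D : ℤ) + 1) * n ≤ k := by exact_mod_cast a.two_mul_le
  have hD : (0 : ℤ) < D := by exact_mod_cast s.D_pos
  have hh : (0 : ℤ) < h := by exact_mod_cast s.h_pos
  have hB' : (0 : ℤ) < n + b * h := by exact_mod_cast hB
  have hnB : (n : ℤ) * (h + c * k) = h * (n + b * h) + D := by
    linear_combination c * n * h2 + h3 - b * h * h1
  have hnD : (n : ℤ) * D < n + b * h := by nlinarith
  have key : ∀ y : ℤ, y ≤ height (n + b * h) (h + c * k) x ↔ y ≤ height n h x := by
    intro y
    rw [le_height_iff hB, le_height_iff hn]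
    push_cast
    constructor
    · intro hy
      by_contra hlt
      rw [not_le] at hlt
      have h4 : x * h + 1 ≤ y * n := hlt
      have h5 : (x * h + 1) * (n + b * h) ≤ (y * n) * (n + b * h) :=
        mul_le_mul_of_nonneg_right h4 hB'.le
      have h6 : n * (y * (n + b * h)) ≤ n * (x * (h + c * k)) := mul_le_mul_of_nonneg_left hy hn'.le
      have h7 : x * D ≤ n * D := mul_le_mul_of_nonneg_right hx' hD.le
      have h8 : n * (x * (h + c * k)) = x * (h * (n + b * h) + D) := by rw [← hnB]; ring
      linarith
    · intro hy
      have h8 : n * (x * (h + c * k)) = x * (h * (n + b * h) + D) := by rw [← hnB]; ring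
      have h5 : (y * n) * (n + b * h) ≤ (x * h) * (n + b * h) :=
        mul_le_mul_of_nonneg_right hy hB'.le
      rcases lt_or_ge x 0 with hx0 | hx0
      · have hne : y * n ≠ x * h := by
          intro hh'
          have h9 : (n : ℤ) ∣ x * h := ⟨y, by rw [← hh']; ring⟩
          have h10 : IsCoprime (n : ℤ) h := Nat.isCoprime_iff_coprime.2 s.coprime'
          have h11 := h10.dvd_of_dvd_mul_right h9
          have := Int.le_of_dvd (by omega) ((dvd_neg).2 h11)
          omega
        have h4 : y * n + 1 ≤ x * h := by omega
        have h5 : (y * n + 1) * (n + b * h) ≤ (x * h) * (n + b * h) :=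
          mul_le_mul_of_nonneg_right h4 hB'.le
        have h7 : -(n * D) ≤ x * D := by nlinarith
        have h12 : n * (y * (n + b * h)) ≤ n * (x * (h + c * k)) := by linarith
        exact le_of_mul_le_mul_left h12 hn'
      · have h7 : 0 ≤ x * D := by positivity
        have h12 : n * (y * (n + b * h)) ≤ n * (x * (h + c * k)) := by linarith
        exact le_of_mul_le_mul_left h12 hn'
  exact le_antisymm ((key _).1 le_rfl) ((key _).2 le_rfl)

theorem abscissa_eq (a : Anchored b c e n h k D S₁ S₂ m) {j : ℤ} (hj : height n h (m - n) ≤ j)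
    (hj' : j < height n h m) :
    abscissa (n + b * h) (h + c * k) j = abscissa n h j ∧ m - n < abscissa n h j ∧
      abscissa n h j ≤ m := by
  have s := a.state
  have hn := s.n_pos
  have hh := s.h_pos
  have h1 := a.one_le
  have h2 := a.le
  have h3 : m - n < abscissa n h j := (lt_abscissa_iff hn hh).2 hj
  have h4 : abscissa n h j ≤ m := (abscissa_le_iff hn hh).2 hj'
  refine ⟨le_antisymm ?_ ?_, h3, h4⟩
  · rw [abscissa_le_iff (by omega) (by omega), a.height_eq (by omega) (by omega)]
    exact height_abscissa hn hh j
  · have : abscissa n h j - 1 < abscissa (n + b * h) (h + c * k) j := by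
      rw [lt_abscissa_iff (by omega) (by omega), a.height_eq (by omega) (by omega),
        ← lt_abscissa_iff hn hh]
      omega
    omega

theorem height_window (a : Anchored b c e n h k D S₁ S₂ m) :
    height n h m = height n h (m - n) + h ∧ -h ≤ height n h (m - n) ∧ height n h m ≤ h := by
  have s := a.state
  have hn := s.n_pos
  have h1 := height_add_period (a₂ := h) hn (m - n)
  rw [sub_add_cancel] at h1
  have h2 := height_mono (a₂ := h) hn a.le
  have h3 := height_add_period (a₂ := h) hn 0
  rw [zero_add, height_zero, zero_add] at h3
  have h4 := height_mono (a₂ := h) hn (show 0 ≤ m by have := a.one_le; omega)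
  rw [height_zero] at h4
  omega

theorem size (a : Anchored b c e n h k D S₁ S₂ m) :
    2 * n ≤ k ∧ (n : ℤ) + k = b * h ∧ (3 : ℤ) * h ≤ h + c * k ∧
      (b : ℤ) * (S₂.card + h) < 2 * n + k ∧ n * D < n + b * h ∧ n ≤ b * e := by
  have s := a.state
  have h0 := a.two_mul_le
  have h2 : (n : ℤ) + k = b * h := by exact_mod_cast s.sum'
  have h3 : (b : ℤ) * e * h = c * n ^ 2 + D := by exact_mod_cast s.disc
  have h1 : (e : ℤ) + h = c * n := by exact_mod_cast s.sum
  have hD := s.D_pos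
  have hn := s.n_pos
  have hk : 2 * n ≤ k := by nlinarith
  have hlt : (b : ℤ) * S₂.card < n := by exact_mod_cast a.lt
  have hc : (0 : ℤ) < c := by exact_mod_cast s.c_pos
  have he : (0 : ℤ) < e := by exact_mod_cast s.e_pos
  have hh : (0 : ℤ) < h := by exact_mod_cast s.h_pos
  refine ⟨hk, h2, ?_, ?_, ?_, ?_⟩
  · have : (c : ℤ) * (2 * n) ≤ c * k := by
      have : (2 * n : ℤ) ≤ k := by exact_mod_cast hk
      gcongr
    linarith
  · rw [mul_add]; linarith
  · have := s.sum'
    nlinarith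
  · have hn' : (0 : ℤ) < n := by exact_mod_cast hn
    have h5 : (n : ℤ) * h ≤ b * e * h := by
      rw [h3, pow_two, ← mul_assoc, ← h1]
      have : (0 : ℤ) ≤ D := by positivity
      have : 0 < (e : ℤ) * n := by positivity
      linarith
    exact_mod_cast le_of_mul_le_mul_right h5 hh

end Anchored

end RankTwoCluster

/-! ### Sizes of the transplanted pair. -/

namespace RankTwoCluster

namespace Anchored
variable {b c e n h k D : ℕ} {S₁ S₂ : Finset ℕ} {m : ℤ}

theorem card_pos' (a : Anchored b c e n h k D S₁ S₂ m) :
    0 < n + b * h ∧ 0 < h + c * k ∧ 0 < n ∧ 0 < h ∧ 0 < b ∧ 0 < c := by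
  have s := a.state
  have := s.n_pos
  have := s.h_pos
  exact ⟨by omega, by omega, s.n_pos, s.h_pos, s.b_pos, s.c_pos⟩

/-- The cumulative count of the vertical part of the transplanted pair. -/
theorem cum_graftVertical (a : Anchored b c e n h k D S₁ S₂ m) {u : ℤ}
    (hu : 2 * h - (h + c * k : ℕ) ≤ u) (hu' : u ≤ 2 * h) :
    cum (h + c * k) (graftVertical c n h k S₂ m) u =
      cum (h + c * k) (graftVertical c n h k S₂ m) (2 * h - (h + c * k : ℕ)) +
      (cum h S₂ (max (height n h (m - n)) (min u (height n h m))) -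
        cum h S₂ (height n h (m - n)) + max 0 (u - h)) := by
  obtain ⟨hw1, hw2, hw3⟩ := a.height_window
  obtain ⟨-, -, hs3, -, -, -⟩ := a.size
  set y₀ := height n h (m - n)
  set y₁ := height n h m
  have hsub : graftVertical c n h k S₂ m ⊆ Finset.range (h + c * k) := ofWindow_subset _ _ _
  induction u, hu using Int.leInduction with
  | base =>
    push_cast
    rw [show max y₀ (min (2 * (h : ℤ) - (h + c * k)) y₁) = y₀ by omega,
      show max (0 : ℤ) (2 * h - (h + c * k) - h) = 0 by omega]
    ring
  | succ u hu ih =>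
    have ih := ih (by omega)
    push_cast at hu
    have hc1 := cum_succ hsub u
    have hc2 := cum_succ a.sub₂ u
    have hmem : (u % (h + c * k : ℕ)).toNat ∈ graftVertical c n h k S₂ m ↔
        verticalCond n h S₂ m u := mem_ofWindow (by push_cast; omega) (by push_cast; omega)
    have hv : verticalCond n h S₂ m u ↔
      (y₀ ≤ u ∧ u < y₁ ∧ (u % h).toNat ∈ S₂) ∨ h ≤ u := Iff.rfl
    rw [hc1, ih, if_congr (hmem.trans hv) rfl rfl]
    rcases lt_or_ge u y₀ with h1 | h1
    · rw [if_neg (by omega), show max y₀ (min (u + 1) y₁) = y₀ by omega,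
        show max y₀ (min u y₁) = y₀ by omega]
      omega
    rcases lt_or_ge u y₁ with h2 | h2
    · rw [show max y₀ (min (u + 1) y₁) = u + 1 by omega, show max y₀ (min u y₁) = u by omega, hc2]
      have : ((y₀ ≤ u ∧ u < y₁ ∧ (u % h).toNat ∈ S₂) ∨ (h : ℤ) ≤ u) ↔ (u % h).toNat ∈ S₂ := by
        constructor
        · rintro (h3 | h3)
          · exact h3.2.2
          · omega
        · exact fun h3 => Or.inl ⟨h1, h2, h3⟩
      rw [if_congr this rfl rfl]
      omega
    · rw [show max y₀ (min (u + 1) y₁) = y₁ by omega, show max y₀ (min u y₁) = y₁ by omega]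
      rcases lt_or_ge u h with h3 | h3
      · rw [if_neg (by omega)]; omega
      · rw [if_pos (Or.inr h3)]; omega

theorem card_graftVertical (a : Anchored b c e n h k D S₁ S₂ m) :
    (graftVertical c n h k S₂ m).card = S₂.card + h := by
  obtain ⟨hw1, hw2, hw3⟩ := a.height_window
  obtain ⟨-, -, hs3, -, -, -⟩ := a.size
  obtain ⟨-, hB₂, -, hh, -, -⟩ := a.card_pos'
  have h1 := a.cum_graftVertical (u := 2 * h) (by push_cast; omega) le_rfl
  have h2 := cum_add_period hB₂ (graftVertical c n h k S₂ m) (2 * h - (h + c * k : ℕ))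
  rw [sub_add_cancel] at h2
  rw [show max (height n h (m - n)) (min (2 * (h : ℤ)) (height n h m)) = height n h m by omega,
    hw1, cum_add_period hh] at h1
  omega

set_option maxHeartbeats 800000 in
/-- The number of horizontal edges of the transplanted pair from `x` on. -/
theorem cum_graftHorizontal (a : Anchored b c e n h k D S₁ S₂ m) {x : ℤ}
    (hx : 2 * n - b * (S₂.card + h) ≤ x) (hx' : x ≤ n) :
    cum (n + b * h) (graftHorizontal b n h S₁ S₂ m) (2 * n) -
      cum (n + b * h) (graftHorizontal b n h S₁ S₂ m) x =
      (n - x) - (m - max (m - n) (min x m)) +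
      (cum n (freeEdges b n h S₂) m - cum n (freeEdges b n h S₂) (max (m - n) (min x m))) +
      (cum n S₁ m - cum n S₁ (max (m - n) (min x m))) := by
  classical
  obtain ⟨hs1, hs2, -, hs4, -, -⟩ := a.size
  obtain ⟨-, -, hn, hh, -, -⟩ := a.card_pos'
  have hone := a.one_le
  have hle := a.le
  set S₁' := graftHorizontal b n h S₁ S₂ m with hS₁'
  have hsub : S₁' ⊆ Finset.range (n + b * h) := ofWindow_subset _ _ _
  have hB : (n : ℤ) + b * h = 2 * n + k := by linarith
  have hmem : ∀ z : ℤ, 2 * n - (n + b * h : ℕ) ≤ z → z < 2 * n →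
      ((z % (n + b * h : ℕ)).toNat ∈ S₁' ↔ horizontalCond b n h S₁ S₂ m z) := fun z hz hz' =>
    mem_ofWindow hz (by push_cast at *; omega)
  have hflat : ∀ z : ℤ, n ≤ z → z ≤ 2 * n → cum (n + b * h) S₁' z = cum (n + b * h) S₁' n := by
    intro z hz
    induction z, hz using Int.leInduction with
    | base => simp
    | succ z hz ihz =>
      intro hz'
      rw [cum_succ hsub, if_neg, ihz (by omega), add_zero]
      rw [hmem z (by push_cast; omega) (by omega)]
      exact fun hh => absurd hh.2.1 (by omega)
  rw [hflat (2 * n) (by omega) le_rfl]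
  suffices H : ∀ i : ℕ, ∀ x : ℤ, x = n - i → 2 * n - b * (S₂.card + h) ≤ x →
      cum (n + b * h) S₁' n - cum (n + b * h) S₁' x = (n - x) - (m - max (m - n) (min x m)) +
      (cum n (freeEdges b n h S₂) m - cum n (freeEdges b n h S₂) (max (m - n) (min x m))) +
      (cum n S₁ m - cum n S₁ (max (m - n) (min x m))) from H (n - x).toNat x (by omega) hx
  intro i
  induction i with
  | zero =>
    intro x hx _
    rw [Nat.cast_zero, sub_zero] at hx
    rw [hx, show max (m - n) (min n m) = m by omega]
    ring
  | succ i ih =>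
    intro x hx hx0
    push_cast at hx
    have ih := ih (x + 1) (by omega) (by omega)
    have hc1 := cum_succ hsub x
    have hc2 := cum_succ a.sub₁ x
    have hc3 := cum_succ (freeEdges_subset b n h S₂) x
    have hm := hmem x (by push_cast; omega) (by omega)
    have hv : horizontalCond b n h S₁ S₂ m x ↔
        (¬(m - n ≤ x ∧ x < m ∧ Shadowed b n h (cum h S₂) x) ∨ (x % n).toNat ∈ S₁) := by
      unfold horizontalCond
      constructor
      · exact fun hh => hh.2.2
      · exact fun hh => ⟨hx0, by omega, hh⟩
    rw [if_congr (hm.trans hv) rfl rfl] at hc1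
    rw [if_congr (mem_freeEdges_emod hn hh S₂ x) rfl rfl] at hc3
    rcases lt_or_ge x (m - n) with h1 | h1
    · rw [show max (m - n) (min (x + 1) m) = m - n by omega] at ih
      rw [show max (m - n) (min x m) = m - n by omega]
      rw [if_pos (Or.inl fun hh => absurd hh.1 (not_le.2 h1))] at hc1
      linarith
    rcases lt_or_ge x m with h2 | h2
    · rw [show max (m - n) (min (x + 1) m) = x + 1 by omega] at ih
      rw [show max (m - n) (min x m) = x by omega]
      -- In the window a shadowed edge counts if it is in S₁ and an unshadowed edge always counts.
      -- Locality keeps S₁ away from unshadowed edges, so the two contributions simply add.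
      by_cases hsh : Shadowed b n h (cum h S₂) x
      · rw [if_neg (not_not.2 hsh)] at hc3
        have : (¬(m - n ≤ x ∧ x < m ∧ Shadowed b n h (cum h S₂) x) ∨ (x % n).toNat ∈ S₁) ↔
          (x % n).toNat ∈ S₁ := by simp [h1, h2, hsh]
        rw [if_congr this rfl rfl] at hc1
        linarith
      · rw [if_pos hsh] at hc3
        rw [if_pos (Or.inl fun hh => hsh hh.2.2)] at hc1
        rw [if_neg fun hh => hsh (a.loc x hh)] at hc2
        linarith
    · rw [show max (m - n) (min (x + 1) m) = m by omega] at ih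
      rw [show max (m - n) (min x m) = m by omega]
      rw [if_pos (Or.inl fun hh => absurd hh.2.1 (not_lt.2 h2))] at hc1
      linarith

/-- The clamped position is unshadowed when the edge is not a shadowed edge of the window. -/
theorem unshadowed_clamp (a : Anchored b c e n h k D S₁ S₂ m) {x : ℤ}
    (hx : ¬(m - n ≤ x ∧ x < m ∧ Shadowed b n h (cum h S₂) x)) :
    ¬Shadowed b n h (cum h S₂) (max (m - n) (min x m)) := by
  obtain ⟨-, -, hn, hh, -, -⟩ := a.card_pos'
  have h0 := (shadowed_add_mul_period (b := b) hn hh S₂ m (-1)).not.2 a.free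
  rw [show m + -1 * (n : ℤ) = m - n by ring] at h0
  rcases lt_or_ge x (m - n) with h1 | h1
  · rwa [show max (m - n) (min x m) = m - n by omega]
  rcases lt_or_ge x m with h2 | h2
  · rw [show max (m - n) (min x m) = x by omega]
    exact fun hh => hx ⟨h1, h2, hh⟩
  · rw [show max (m - n) (min x m) = m by omega]
    exact a.free

theorem cum_graftHorizontal' (a : Anchored b c e n h k D S₁ S₂ m) {x : ℤ}
    (hx : 2 * n - b * (S₂.card + h) ≤ x) (hx' : x ≤ n)
    (hfree : ¬(m - n ≤ x ∧ x < m ∧ Shadowed b n h (cum h S₂) x)) :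
    cum (n + b * h) (graftHorizontal b n h S₁ S₂ m) (2 * n) -
      cum (n + b * h) (graftHorizontal b n h S₁ S₂ m) x =
      (n - x) - b * (cum h S₂ (height n h m) -
        cum h S₂ (height n h (max (m - n) (min x m)))) +
      (cum n S₁ m - cum n S₁ (max (m - n) (min x m))) := by
  obtain ⟨-, -, hn, hh, -, -⟩ := a.card_pos'
  rw [a.cum_graftHorizontal hx hx', cum_freeEdges_sub hn hh a.sub₂ (a.unshadowed_clamp hfree) a.free
    (by omega)]
  unfold pot
  ring

/-- The interval has b(|S₂| + h) - n edges. Of these the b|S₂| shadowed edges of the window are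
removed and |S₁| of them restored, and bh - n = k. -/
theorem card_graftHorizontal (a : Anchored b c e n h k D S₁ S₂ m) :
    (graftHorizontal b n h S₁ S₂ m).card = S₁.card + k := by
  obtain ⟨hs1, hs2, -, hs4, -, -⟩ := a.size
  obtain ⟨hw1, hw2, hw3⟩ := a.height_window
  obtain ⟨hB₁, -, hn, hh, -, -⟩ := a.card_pos'
  have hone := a.one_le
  have hle := a.le
  have hlt : (b : ℤ) * S₂.card < n := by exact_mod_cast a.lt
  have hB : (n : ℤ) + b * h = 2 * n + k := by linarith
  have hbs : (b : ℤ) * (S₂.card + h) = b * S₂.card + b * h := by ring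
  have hb0 : (0 : ℤ) ≤ b * S₂.card := by positivity
  set S₁' := graftHorizontal b n h S₁ S₂ m with hS₁'
  have hsub : S₁' ⊆ Finset.range (n + b * h) := ofWindow_subset _ _ _
  have hflat : ∀ z : ℤ, 2 * n - (n + b * h : ℕ) ≤ z → z ≤ 2 * n - b * (S₂.card + h) →
      cum (n + b * h) S₁' z = cum (n + b * h) S₁' (2 * n - (n + b * h : ℕ)) := by
    intro z hz
    induction z, hz using Int.leInduction with
    | base => simp
    | succ z hz ihz =>
      intro hz'
      rw [cum_succ hsub, if_neg, ihz (by omega), add_zero]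
      rw [hS₁', graftHorizontal, mem_ofWindow hz (by push_cast at *; omega)]
      exact fun hh => absurd hh.1 (by omega)
  have h1 := a.cum_graftHorizontal' (x := 2 * n - b * (S₂.card + h)) le_rfl (by omega) (by omega)
  rw [show max (m - n) (min (2 * (n : ℤ) - b * (S₂.card + h)) m) = m - n by omega, hw1,
    cum_add_period hh] at h1
  have h2 := cum_add_period hn S₁ (m - n)
  rw [sub_add_cancel] at h2
  have h3 := cum_add_period hB₁ S₁' (2 * n - (n + b * h : ℕ))
  rw [sub_add_cancel] at h3
  have h4 := hflat _ (by push_cast; omega) le_rfl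
  rw [add_sub_cancel_left, ← hS₁'] at h1
  omega

end Anchored

end RankTwoCluster

/-! ### Compatibility of the transplanted pair: the inherited cases. -/

namespace RankTwoCluster

/-- One of the two numerical conditions in the definition of compatibility holds for the horizontal
edge `k` and the vertical edge `j`. -/
def Closes (b c a₁ a₂ : ℕ) (C₁ C₂ : ℤ → ℤ) (k j : ℤ) : Prop :=
  (∃ j', height a₁ a₂ k ≤ j' ∧ j' < j ∧
      c * (C₁ (abscissa a₁ a₂ j') - C₁ k) ≤ j' + 1 - height a₁ a₂ k) ∨
    ∃ k', k < k' ∧ k' < abscissa a₁ a₂ j ∧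
      b * (C₂ (j + 1) - C₂ (height a₁ a₂ k')) ≤ abscissa a₁ a₂ j - k'

theorem cum_freeEdges_eq_of_shadowed {b a₁ a₂ : ℕ} (h₁ : 0 < a₁) (h₂ : 0 < a₂) {S₂ : Finset ℕ}
    {u v : ℤ} (huv : u ≤ v) (hsh : ∀ z, u ≤ z → z < v → Shadowed b a₁ a₂ (cum a₂ S₂) z) :
    cum a₁ (freeEdges b a₁ a₂ S₂) v = cum a₁ (freeEdges b a₁ a₂ S₂) u := by
  induction v, huv using Int.leInduction with
  | base => rfl
  | succ v hv ih =>
    rw [cum_succ (freeEdges_subset b a₁ a₂ S₂),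
      if_neg fun hh => (mem_freeEdges_emod h₁ h₂ S₂ v).1 hh (hsh v hv (by omega)),
      ih fun z hz hz' => hsh z hz (by omega), add_zero]

namespace Anchored
variable {b c e n h k D : ℕ} {S₁ S₂ : Finset ℕ} {m : ℤ}

theorem window_left (a : Anchored b c e n h k D S₁ S₂ m) :
    2 * n - b * (S₂.card + h) ≤ m - (n : ℤ) ∧ 2 * (n : ℤ) - (n + b * h : ℕ) ≤
      2 * n - b * (S₂.card + h) + n := by
  obtain ⟨hs1, hs2, -, hs4, -, -⟩ := a.size
  have hlt : (b : ℤ) * S₂.card < n := by exact_mod_cast a.lt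
  have hb0 : (0 : ℤ) ≤ b * S₂.card := by positivity
  have hone := a.one_le
  push_cast
  rw [mul_add]
  omega

theorem cum_graftHorizontal_sub (a : Anchored b c e n h k D S₁ S₂ m) {u v : ℤ} (hu : m - n ≤ u)
    (huv : u ≤ v) (hv : v ≤ m) (hsh : ∀ z, u ≤ z → z < v → Shadowed b n h (cum h S₂) z) :
    cum (n + b * h) (graftHorizontal b n h S₁ S₂ m) v -
      cum (n + b * h) (graftHorizontal b n h S₁ S₂ m) u = cum n S₁ v - cum n S₁ u := by
  obtain ⟨-, -, hn, hh, -, -⟩ := a.card_pos'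
  have h1 := a.window_left.1
  have h2 := a.le
  have h3 := a.cum_graftHorizontal (x := u) (by omega) (by omega)
  have h4 := a.cum_graftHorizontal (x := v) (by omega) (by omega)
  rw [show max (m - n) (min u m) = u by omega] at h3
  rw [show max (m - n) (min v m) = v by omega,
    cum_freeEdges_eq_of_shadowed hn hh huv hsh] at h4
  linarith

/-- Old and new paths and counts agree on the window. If x is a shadowed edge of S₁, the
compatibility of the old pair carries over. Otherwise x, moved into the window if necessary, is
unshadowed, so j does not reach it, and the second alternative holds. -/
theorem closes_of_mem_window (a : Anchored b c e n h k D S₁ S₂ m) {x j : ℤ}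
    (hx : horizontalCond b n h S₁ S₂ m x) (hj : height n h (m - n) ≤ j)
    (hj' : j < height n h m) (hjS : (j % h).toNat ∈ S₂)
    (hlt : x < abscissa (n + b * h) (h + c * k) j) :
    Closes b c (n + b * h) (h + c * k) (cum (n + b * h) (graftHorizontal b n h S₁ S₂ m))
      (cum (h + c * k) (graftVertical c n h k S₂ m)) x j := by
  obtain ⟨-, -, hn, hh, hb, -⟩ := a.card_pos'
  obtain ⟨hw1, hw2, hw3⟩ := a.height_window
  obtain ⟨-, -, hs3, -, -, -⟩ := a.size
  obtain ⟨hX, hX1, hX2⟩ := a.abscissa_eq hj hj'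
  have hone := a.one_le
  have hle := a.le
  have hU := unitSteps_cum a.sub₂
  have hjne : cum h S₂ (j + 1) ≠ cum h S₂ j := (cum_succ_ne_iff a.sub₂ j).2 hjS
  rw [hX] at hlt
  have transfer : ∀ k', x < k' → m - n ≤ k' → k' < abscissa n h j →
      b * (cum h S₂ (j + 1) - cum h S₂ (height n h k')) ≤ abscissa n h j - k' →
      Closes b c (n + b * h) (h + c * k) (cum (n + b * h) (graftHorizontal b n h S₁ S₂ m))
      (cum (h + c * k) (graftVertical c n h k S₂ m)) x j := by
    intro k' h1 h2 h3 h4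
    refine Or.inr ⟨k', h1, by rw [hX]; exact h3, ?_⟩
    have h5 := height_mono (a₂ := h) hn h2
    have h6 := height_mono (a₂ := h) hn (show k' ≤ m by omega)
    rw [hX, a.height_eq (by omega) (by omega),
      a.cum_graftVertical (u := j + 1) (by push_cast; omega) (by omega),
      a.cum_graftVertical (u := height n h k') (by push_cast; omega) (by omega),
      show max (height n h (m - n)) (min (j + 1) (height n h m)) = j + 1 by omega,
      show max (height n h (m - n)) (min (height n h k') (height n h m)) = height n h k' by omega,
      show max 0 (j + 1 - h) = 0 by omega, show max 0 (height n h k' - h) = 0 by omega]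
    rw [mul_sub] at h4 ⊢
    linarith
  by_cases hf : m - n ≤ x ∧ x < m ∧ Shadowed b n h (cum h S₂) x
  · have hxS : (x % n).toNat ∈ S₁ := hx.2.2.resolve_left (not_not.2 hf)
    by_cases hR : Reaches b n h (cum h S₂) x j
    · have hsh : ∀ z, x ≤ z → z < abscissa n h j → Shadowed b n h (cum h S₂) z :=
        fun z hz hz' => Reaches.shadowed hb hn hh hU hjne hz' fun k' h3 h4 => hR k' (by omega) h4
      rcases a.adm x j ((cum_succ_ne_iff a.sub₁ x).2 hxS) hjne hlt (by omega) with
        ⟨j', h3, h4, h5⟩ | ⟨k', h3, h4, h5⟩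
      · have h6 := height_mono (a₂ := h) hn hf.1
        obtain ⟨hX', hX1', hX2'⟩ := a.abscissa_eq (j := j') (by omega) (by omega)
        have h7 : x < abscissa n h j' := (lt_abscissa_iff hn hh).2 h3
        have h8 := abscissa_mono (a₁ := n) hh h4.le
        refine Or.inl ⟨j', by rw [a.height_eq (by omega) (by omega)]; exact h3, h4, ?_⟩
        rw [a.height_eq (by omega) (by omega), hX', a.cum_graftHorizontal_sub hf.1 h7.le hX2'
          fun z hz hz' => hsh z hz (by omega)]
        exact h5
      · exact absurd h5 (not_le.2 (hR k' h3 h4))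
    · unfold Reaches at hR
      push Not at hR
      obtain ⟨k', h1, h2, h3⟩ := hR
      exact transfer k' h1 (by omega) h2 h3
  · have hun := a.unshadowed_clamp hf
    have hR : ¬Reaches b n h (cum h S₂) (max (m - n) (min x m)) j := fun hR =>
      hun (Reaches.shadowed hb hn hh hU hjne (by omega) hR)
    unfold Reaches at hR
    push Not at hR
    obtain ⟨k', h1, h2, h3⟩ := hR
    exact transfer k' (by omega) (by omega) h2 h3

/-- For an old shadowed edge x the first alternative already closes before the added vertical edges:
at the first unshadowed position after x the potential is minimal on the run, so the vertical edges
passed balance c times the S₁-count. -/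
theorem closes_of_shadowed (a : Anchored b c e n h k D S₁ S₂ m) {x j : ℤ} (hx : m - n ≤ x)
    (hx' : x < m) (hxS : (x % n).toNat ∈ S₁) (hj : h ≤ j) :
    Closes b c (n + b * h) (h + c * k) (cum (n + b * h) (graftHorizontal b n h S₁ S₂ m))
      (cum (h + c * k) (graftVertical c n h k S₂ m)) x j := by
  obtain ⟨hB₁, hB₂, hn, hh, hb, hc⟩ := a.card_pos'
  obtain ⟨hw1, hw2, hw3⟩ := a.height_window
  have hone := a.one_le
  have hle := a.le
  have hU := unitSteps_cum a.sub₂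
  obtain ⟨m', ⟨h3, h4⟩, h5⟩ := Int.exists_least_of_bdd
    (P := fun z => x < z ∧ ¬Shadowed b n h (cum h S₂) z) ⟨x, fun z hz => hz.1.le⟩
    ⟨m, hx', a.free⟩
  have hm'm := h5 m ⟨hx', a.free⟩
  have hrun : ∀ z, x - 1 < z → z < m' → Shadowed b n h (cum h S₂) z := by
    intro z hz hz'
    rcases lt_or_eq_of_le (show x ≤ z by omega) with h6 | h6
    · by_contra hcon
      exact absurd (h5 z ⟨h6, hcon⟩) (not_le.2 hz')
    · exact h6 ▸ a.loc x hxS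
  have hcl := a.adm.mul_sub_le hn hh hU h3 (by omega) fun z hz hz' =>
    pot_le_of_run h4 hrun (by omega) hz'
  have hstep : cum n S₁ (x + 1) = cum n S₁ x + 1 := by rw [cum_succ a.sub₁, if_pos hxS]
  have hmono := (unitSteps_cum a.sub₁).monotone (show x + 1 ≤ m' from h3)
  have h7 : (1 : ℤ) ≤ c * (cum n S₁ m' - cum n S₁ x) :=
    one_le_mul_of_one_le_of_one_le (by exact_mod_cast hc) (by omega)
  have hym := height_mono (a₂ := h) hn hm'm
  have hX : abscissa (n + b * h) (h + c * k) (height n h m' - 1) ≤ m' := by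
    rw [abscissa_le_iff hB₁ hB₂, a.height_eq (by omega) (by omega)]
    omega
  refine Or.inl ⟨height n h m' - 1, ?_, by omega, ?_⟩
  · rw [a.height_eq (by omega) (by omega)]; omega
  · rw [a.height_eq (by omega) (by omega)]
    have h8 := a.cum_graftHorizontal_sub hx h3.le hm'm fun z hz hz' => hrun z (by omega) hz'
    have h9 := (unitSteps_cum (ofWindow_subset (n + b * h) (2 * n - (n + b * h : ℕ))
      (horizontalCond b n h S₁ S₂ m))).monotone hX
    change cum (n + b * h) (graftHorizontal b n h S₁ S₂ m) _ ≤
      cum (n + b * h) (graftHorizontal b n h S₁ S₂ m) _ at h9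
    have h10 : (c : ℤ) * (cum (n + b * h) (graftHorizontal b n h S₁ S₂ m)
        (abscissa (n + b * h) (h + c * k) (height n h m' - 1)) -
        cum (n + b * h) (graftHorizontal b n h S₁ S₂ m) x) ≤
        c * (cum n S₁ m' - cum n S₁ x) := by
      refine mul_le_mul_of_nonneg_left ?_ (by positivity)
      rw [← h8]
      linarith
    omega

theorem two_D_lt (a : Anchored b c e n h k D S₁ S₂ m) :
    (n : ℤ) * (h + c * k) = h * (n + b * h) + D ∧ 2 * (D : ℤ) < n + b * h := by
  have s := a.state
  have h1 : (e : ℤ) + h = c * n := by exact_mod_cast s.sum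
  have h2 : (n : ℤ) + k = b * h := by exact_mod_cast s.sum'
  have h3 : (b : ℤ) * e * h = c * n ^ 2 + D := by exact_mod_cast s.disc
  have hk : ((D : ℤ) + 1) * n ≤ k := by exact_mod_cast a.two_mul_le
  have hn2 : (2 : ℤ) ≤ n := by
    have := a.lt
    have := Nat.mul_pos s.b_pos a.pos
    omega
  refine ⟨by linear_combination c * n * h2 + h3 - b * h * h1, ?_⟩
  have : ((D : ℤ) + 1) * 2 ≤ (D + 1) * n := by gcongr
  linarith

/-- By nB₂ = hB₁ + D the new diagonal passes above (2n, 2h) by 2D/B₁ < 1. This uses n ≥ 2, which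
holds as 0 < b|S₂| < n. -/
theorem height_two (a : Anchored b c e n h k D S₁ S₂ m) :
    height (n + b * h) (h + c * k) (2 * n) = 2 * h := by
  obtain ⟨hB₁, hB₂, hn, hh, hb, hc⟩ := a.card_pos'
  obtain ⟨e1, e2⟩ := a.two_D_lt
  apply le_antisymm
  · by_contra hcon
    have : 2 * (h : ℤ) < height (n + b * h) (h + c * k) (2 * n) := not_le.1 hcon
    rw [lt_height_iff hB₁] at this
    push_cast at this
    linarith
  · rw [le_height_iff hB₁]
    push_cast
    linarith [Int.natCast_nonneg D]

/-- The separating point is (2n, 2h), just past the added vertical edges. The unshadowed position m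
- n bounds b times the old vertical edges up to j, and k ≥ 2n leaves enough horizontal room. -/
theorem closes_of_next (a : Anchored b c e n h k D S₁ S₂ m) {x j : ℤ} (hx : x < n)
    (hj : height n h (m - n) ≤ j - (h + c * k : ℕ)) (hj' : j - (h + c * k : ℕ) < height n h m)
    (hj2 : 2 * h ≤ j) :
    Closes b c (n + b * h) (h + c * k) (cum (n + b * h) (graftHorizontal b n h S₁ S₂ m))
      (cum (h + c * k) (graftVertical c n h k S₂ m)) x j := by
  obtain ⟨hB₁, hB₂, hn, hh, hb, hc⟩ := a.card_pos'
  obtain ⟨hw1, hw2, hw3⟩ := a.height_window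
  obtain ⟨hs1, hs2, hs3, -, -, -⟩ := a.size
  have hone := a.one_le
  obtain ⟨hX, hX1, hX2⟩ := a.abscissa_eq hj hj'
  set j₀ := j - (h + c * k : ℕ) with hj₀
  have hXj : abscissa (n + b * h) (h + c * k) j = abscissa n h j₀ + (n + b * h : ℕ) := by
    rw [← hX, ← abscissa_add_period hB₂, hj₀, sub_add_cancel]
  refine Or.inr ⟨2 * n, by omega, ?_, ?_⟩
  · rw [lt_abscissa_iff hB₁ hB₂, a.height_two]; exact hj2
  · rw [a.height_two]
    have h1 := cum_add_period hB₂ (graftVertical c n h k S₂ m) (j₀ + 1)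
    have h2 := cum_add_period hB₂ (graftVertical c n h k S₂ m) (2 * h - (h + c * k : ℕ))
    rw [sub_add_cancel] at h2
    rw [show j₀ + 1 + ((h + c * k : ℕ) : ℤ) = j + 1 by omega,
      a.cum_graftVertical (u := j₀ + 1) (by push_cast; omega) (by omega),
      show max (height n h (m - n)) (min (j₀ + 1) (height n h m)) = j₀ + 1 by omega,
      show max 0 (j₀ + 1 - h) = 0 by omega] at h1
    have h3 := a.unshadowed_clamp (x := m - n - 1) (by omega)
    rw [show max (m - n) (min (m - n - 1) m) = m - n by omega] at h3
    have h4 := pot_lt_of_not_shadowed h3 hX1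
    have h5 := (unitSteps_cum a.sub₂).monotone (Int.add_one_le_iff.2 (height_abscissa hn hh j₀))
    have h6 : (b : ℤ) * cum h S₂ (j₀ + 1) ≤
      b * cum h S₂ (height n h (abscissa n h j₀)) := by gcongr
    unfold pot at h4
    rw [h1, h2, hXj]
    push_cast
    rw [show ∀ p q r s : ℤ, p + (q - r + 0) + s - (p + s) = q - r by intros; ring, mul_sub]
    linarith

end Anchored

end RankTwoCluster

/-! ### Compatibility of the transplanted pair: unshadowed against added edges. -/

namespace RankTwoCluster

namespace Anchored
variable {b c e n h k D : ℕ} {S₁ S₂ : Finset ℕ} {m : ℤ}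

theorem clamp_height (a : Anchored b c e n h k D S₁ S₂ m) {x : ℤ} :
    max (height n h (m - n)) (min (height (n + b * h) (h + c * k) x) (height n h m)) =
      height n h (max (m - n) (min x m)) := by
  obtain ⟨hB₁, hB₂, hn, hh, hb, hc⟩ := a.card_pos'
  have hone := a.one_le
  have hle := a.le
  have h0 := height_mono (a₂ := h) hn (show m - n ≤ m by omega)
  rcases lt_or_ge x (m - n) with h1 | h1
  · rw [show max (m - n) (min x m) = m - n by omega]
    have := height_mono (a₂ := h + c * k) hB₁ h1.le
    rw [a.height_eq (x := m - n) (by omega) (by omega)] at this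
    omega
  rcases le_or_gt x m with h2 | h2
  · rw [show max (m - n) (min x m) = x by omega, a.height_eq (by omega) (by omega)]
    have := height_mono (a₂ := h) hn h1
    have := height_mono (a₂ := h) hn h2
    omega
  · rw [show max (m - n) (min x m) = m by omega]
    have := height_mono (a₂ := h + c * k) hB₁ h2.le
    rw [a.height_eq (x := m) (by omega) (by omega)] at this
    omega

theorem height_ge (a : Anchored b c e n h k D S₁ S₂ m) {x : ℤ}
    (hx : 2 * n - b * (S₂.card + h) ≤ x) :
    2 * h - (h + c * k : ℕ) ≤ height (n + b * h) (h + c * k) x := by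
  obtain ⟨hB₁, hB₂, hn, hh, hb, hc⟩ := a.card_pos'
  obtain ⟨hs1, hs2, hs3, hs4, -, -⟩ := a.size
  have h1 := height_add_period (a₂ := h + c * k) hB₁ (2 * n - (n + b * h : ℕ))
  rw [sub_add_cancel, a.height_two] at h1
  have h2 := height_mono (a₂ := h + c * k) hB₁
    (show 2 * (n : ℤ) - (n + b * h : ℕ) ≤ x by push_cast; omega)
  omega

theorem vertical_count_le (a : Anchored b c e n h k D S₁ S₂ m) {x j : ℤ}
    (hx : 2 * n - b * (S₂.card + h) ≤ x) (hxn : x < n) (hj : h ≤ j) (hj' : j < 2 * h) :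
    cum (h + c * k) (graftVertical c n h k S₂ m) (j + 1) -
      cum (h + c * k) (graftVertical c n h k S₂ m) (height (n + b * h) (h + c * k) x) =
    cum h S₂ (height n h m) - cum h S₂ (height n h (max (m - n) (min x m))) + (j - h + 1) := by
  obtain ⟨hB₁, hB₂, hn, hh, hb, hc⟩ := a.card_pos'
  obtain ⟨hw1, hw2, hw3⟩ := a.height_window
  obtain ⟨hs1, hs2, hs3, -, -, -⟩ := a.size
  have h1 := a.height_ge hx
  have h2 := height_mono (a₂ := h + c * k) hB₁ hxn.le
  rw [a.height_eq (x := n) (by omega) le_rfl] at h2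
  have h3 := height_add_period (a₂ := h) hn 0
  rw [zero_add, height_zero, zero_add] at h3
  rw [a.cum_graftVertical (u := j + 1) (by push_cast; omega) (by omega),
    a.cum_graftVertical (u := height (n + b * h) (h + c * k) x) h1 (by omega), a.clamp_height,
    show max (height n h (m - n)) (min (j + 1) (height n h m)) = height n h m by omega,
    show max 0 (j + 1 - h) = j - h + 1 by omega,
    show max 0 (height (n + b * h) (h + c * k) x - h) = 0 by omega]
  ring

theorem horizontal_count_pos (a : Anchored b c e n h k D S₁ S₂ m) {x : ℤ}
    (hx : horizontalCond b n h S₁ S₂ m x) :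
    1 ≤ cum (n + b * h) (graftHorizontal b n h S₁ S₂ m) (2 * n) -
      cum (n + b * h) (graftHorizontal b n h S₁ S₂ m) x := by
  have hsub : graftHorizontal b n h S₁ S₂ m ⊆ Finset.range (n + b * h) := ofWindow_subset _ _ _
  obtain ⟨hs1, hs2, -, hs4, -, -⟩ := a.size
  obtain ⟨hx1, hx2, -⟩ := id hx
  have h1 : cum (n + b * h) (graftHorizontal b n h S₁ S₂ m) (x + 1) =
      cum (n + b * h) (graftHorizontal b n h S₁ S₂ m) x + 1 := by
    rw [cum_succ hsub, if_pos]
    rw [graftHorizontal, mem_ofWindow (by push_cast; omega) (by push_cast; omega)]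
    exact hx
  have h2 := (unitSteps_cum hsub).monotone (show x + 1 ≤ 2 * n by omega)
  omega

theorem sel_count_pos (a : Anchored b c e n h k D S₁ S₂ m) {x : ℤ} (hx : x < m) :
    0 < cum h S₂ (height n h m) - cum h S₂ (height n h x) := by
  obtain ⟨-, -, hn, hh, -, -⟩ := a.card_pos'
  obtain ⟨j, hj, hjm⟩ := a.sel
  have hU := unitSteps_cum a.sub₂
  have h1 : j < height n h m := (abscissa_le_iff hn hh).1 hjm.le
  have h2 : height n h x ≤ j := (lt_abscissa_iff hn hh).1 (hjm ▸ hx)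
  have h3 := hU.monotone (Int.add_one_le_iff.2 h1)
  have h4 := hU.monotone h2
  rcases hU j with h5 | h5 <;> omega

/-- This is where the arithmetic of the recursion is needed. If both alternatives failed, their
failure at x + 1 and at j - 1 would give two linear inequalities in g and j - h + 1 that the
numerical lemmas refute, according to whether an old selected vertical edge lies between x and the
anchor. -/
theorem closes_of_free (a : Anchored b c e n h k D S₁ S₂ m) {x j : ℤ}
    (hx : horizontalCond b n h S₁ S₂ m x)
    (hf : ¬(m - n ≤ x ∧ x < m ∧ Shadowed b n h (cum h S₂) x)) (hj : h ≤ j) (hj' : j < 2 * h)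
    (hlt : x < abscissa (n + b * h) (h + c * k) j) :
    Closes b c (n + b * h) (h + c * k) (cum (n + b * h) (graftHorizontal b n h S₁ S₂ m))
      (cum (h + c * k) (graftVertical c n h k S₂ m)) x j := by
  obtain ⟨hB₁, hB₂, hn, hh, hb, hc⟩ := a.card_pos'
  obtain ⟨hw1, hw2, hw3⟩ := a.height_window
  obtain ⟨hs1, hs2, hs3, hs4, hs5, hs6⟩ := a.size
  obtain ⟨hx1, hx2, -⟩ := id hx
  have s := a.state
  have hb' : (0 : ℤ) < b := by exact_mod_cast hb
  have hc' : (0 : ℤ) < c := by exact_mod_cast hc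
  have hn' : (0 : ℤ) < n := by exact_mod_cast hn
  have hh' : (0 : ℤ) < h := by exact_mod_cast hh
  have hD' : (0 : ℤ) < D := by exact_mod_cast s.D_pos
  have st1 : (e : ℤ) + h = c * n := by exact_mod_cast s.sum
  have st2 : (n : ℤ) + k = b * h := by exact_mod_cast s.sum'
  have st3 : (b : ℤ) * e * h = c * n ^ 2 + D := by exact_mod_cast s.disc
  have st4 : (D : ℤ) + 4 ≤ b * c := by exact_mod_cast s.D_le
  have hk : ((D : ℤ) + 1) * n ≤ k := by exact_mod_cast a.two_mul_le
  have hone := a.one_le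
  have hle := a.le
  set x' := max (m - n) (min x m) with hx'
  set Q := cum h S₂ (height n h m) - cum h S₂ (height n h x') with hQ
  set P := cum n S₁ m - cum n S₁ x' with hP
  -- The selected horizontal edges from x on number g + P.
  obtain ⟨g, hg⟩ : ∃ g : ℤ, g = n - x - b * Q := ⟨_, rfl⟩
  have hcount := a.cum_graftHorizontal' hx1 hx2.le hf
  rw [← hx', ← hQ, ← hP, ← hg] at hcount
  have hpos := a.horizontal_count_pos hx
  have hvert := a.vertical_count_le hx1 hx2 hj hj'
  rw [← hx', ← hQ] at hvert
  have hQ0 : 0 ≤ Q := sub_nonneg.2 <| (unitSteps_cum a.sub₂).monotone <| height_mono hn <| by omega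
  have hx'm : x' ≤ m := by omega
  have hx'm' : m ≤ x' + n := by omega
  have hxy : height (n + b * h) (h + c * k) x ≤ j := (lt_abscissa_iff hB₁ hB₂).1 hlt
  by_contra hcon
  unfold Closes at hcon
  push Not at hcon
  obtain ⟨hF, hG⟩ := hcon
  obtain ⟨hnB, -⟩ := a.two_D_lt
  -- the two inequalities
  have i1 : g * (h + c * k) ≤ D + (j - h + 1) * (b * (h + c * k) - (n + b * h)) := by
    have h1 : abscissa (n + b * h) (h + c * k) j ≤ x + b * (Q + (j - h + 1)) := by
      rcases lt_or_eq_of_le (show x + 1 ≤ abscissa (n + b * h) (h + c * k) j from hlt) with h2 | h2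
      · have h3 := hG (x + 1) (by omega) h2
        have h4 := (unitSteps_cum (ofWindow_subset (h + c * k) (2 * h - (h + c * k : ℕ))
          (verticalCond n h S₂ m))).monotone
          (height_mono (a₂ := h + c * k) hB₁ (show x ≤ x + 1 by omega))
        change cum (h + c * k) (graftVertical c n h k S₂ m) _ ≤
          cum (h + c * k) (graftVertical c n h k S₂ m) _ at h4
        have h5 : (b : ℤ) * (cum (h + c * k) (graftVertical c n h k S₂ m) (j + 1) -
          cum (h + c * k) (graftVertical c n h k S₂ m)
            (height (n + b * h) (h + c * k) (x + 1))) ≤ b * (Q + (j - h + 1)) :=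
          mul_le_mul_of_nonneg_left (by linarith) hb'.le
        linarith
      · have h6 : (1 : ℤ) ≤ b * (Q + (j - h + 1)) :=
          one_le_mul_of_one_le_of_one_le (by omega) (by omega)
        linarith
    rw [abscissa_le_iff_mul hB₁ hB₂, show x = n - g - b * Q by omega] at h1
    push_cast at h1
    linarith
  have i2 : (j - h + 1) * (n + b * h) ≤ D + g * (c * (n + b * h) - (h + c * k)) -
      (b * Q * (h + c * k) - c * P * (n + b * h)) := by
    have h1 : j + 1 - c * (g + P) ≤ height (n + b * h) (h + c * k) x := by
      rcases lt_or_eq_of_le hxy with h2 | h2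
      · have h3 := hF (j - 1) (by omega) (by omega)
        have h4 : abscissa (n + b * h) (h + c * k) (j - 1) ≤ 2 * n := by
          rw [abscissa_le_iff hB₁ hB₂, a.height_two]; omega
        have h5 := (unitSteps_cum (ofWindow_subset (n + b * h) (2 * n - (n + b * h : ℕ))
          (horizontalCond b n h S₁ S₂ m))).monotone h4
        change cum (n + b * h) (graftHorizontal b n h S₁ S₂ m) _ ≤
          cum (n + b * h) (graftHorizontal b n h S₁ S₂ m) _ at h5
        have h6 : (c : ℤ) * (cum (n + b * h) (graftHorizontal b n h S₁ S₂ m)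
          (abscissa (n + b * h) (h + c * k) (j - 1)) -
          cum (n + b * h) (graftHorizontal b n h S₁ S₂ m) x) ≤ c * (g + P) :=
          mul_le_mul_of_nonneg_left (by linarith) hc'.le
        linarith
      · have h6 : (1 : ℤ) ≤ c * (g + P) := one_le_mul_of_one_le_of_one_le (by omega) (by omega)
        linarith
    rw [le_height_iff hB₁, show x = n - g - b * Q by omega] at h1
    push_cast at h1
    linarith
  have hbS : (b : ℤ) * (S₂.card + h) = b * S₂.card + b * h := by ring
  have hbQ0 : 0 ≤ b * Q := mul_nonneg hb'.le hQ0
  rcases eq_or_lt_of_le hQ0 with hQ1 | hQ1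
  -- A selected vertical edge stands at the anchor, so Q = 0 forces x to lie at or right of it.
  -- Hence 0 < g < n.
  · have hxm : m ≤ x := by
      by_contra hcon
      have := a.sel_count_pos (x := x') (by omega)
      omega
    have hP0 : P = 0 := by rw [hP, show x' = m by omega, sub_self]
    rw [← hQ1, mul_zero, sub_zero] at hg
    rw [← hQ1, hP0] at i2
    exact numeric_of_zero hb' hc' hn' hh' hD' st1 st2 st3 st4 hk
      (Nat.isCoprime_iff_coprime.2 s.coprime) i1 (by linarith) (by omega) (by omega)
  · have hQq : Q ≤ S₂.card := by
      have h1 := (unitSteps_cum a.sub₂).monotone (height_mono (a₂ := h) hn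
        (show m - n ≤ x' by omega))
      have h2 := cum_add_period hh S₂ (height n h (m - n))
      rw [← hw1] at h2
      omega
    have hgk : g ≤ k := by
      rcases lt_or_ge x (m - n) with h1 | h1
      · have : Q = S₂.card := by
          rw [hQ, show x' = m - n by omega, hw1, cum_add_period hh]
          ring
        rw [this] at hg
        omega
      · omega
    have hsl := a.adm.slope_bound hb hn hh (unitSteps_cum a.sub₂) (fun z hz => by
      by_contra hcon
      exact hz (a.loc z ((cum_succ_ne_iff a.sub₁ z).1 hcon))) (a.unshadowed_clamp hf) a.free
      hx'm hx'm'
    rw [← hx'] at hsl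
    have hstrict := hsl.2.2 (by omega)
    rw [← hQ, ← hP] at hstrict
    refine numeric_of_pos hb' hc' hn' hh' hD' st1 st2 st3 st4 hk i1 i2 hQ1 ?_ hgk
    -- The strict slope bound makes bhQ - cnP positive. Were it at most D, the gap property would
    -- give Q ≥ e and so b|S₂| ≥ be ≥ n.
    by_contra hcon
    have h1 := a.gap Q P hQ1 (by linarith) (by omega)
    have h2 : (b : ℤ) * e ≤ b * S₂.card := mul_le_mul_of_nonneg_left (h1.trans hQq) hb'.le
    have h3 : (b : ℤ) * S₂.card < n := by exact_mod_cast a.lt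
    have h4 : (n : ℤ) ≤ b * e := by exact_mod_cast hs6
    linarith

/-- Seen from x, a selected vertical edge within one period is an old one in the window, one of the
h added ones, or the translate of an old one. Only for an added one does it matter whether x is an
old shadowed edge. -/
theorem admissible_graft (a : Anchored b c e n h k D S₁ S₂ m) :
    Admissible b c (n + b * h) (h + c * k) (cum (n + b * h) (graftHorizontal b n h S₁ S₂ m))
      (cum (h + c * k) (graftVertical c n h k S₂ m)) := by
  obtain ⟨hB₁, hB₂, hn, hh, hb, hc⟩ := a.card_pos'
  obtain ⟨hw1, hw2, hw3⟩ := a.height_window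
  obtain ⟨hs1, hs2, hs3, hs4, hs5, hs6⟩ := a.size
  have hone := a.one_le
  have hle := a.le
  refine admissible_of_window hB₁ hB₂ (ofWindow_subset _ _ _) (ofWindow_subset _ _ _)
    (2 * n - (n + b * h : ℕ)) fun x j hx hx' hxS hjS hlt hle' => ?_
  rw [graftHorizontal, mem_ofWindow hx hx'] at hxS
  have h1 : height (n + b * h) (h + c * k) x ≤ j := (lt_abscissa_iff hB₁ hB₂).1 hlt
  have h2 := a.height_ge hxS.1
  have h3 : j < height (n + b * h) (h + c * k) x + (h + c * k : ℕ) := by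
    rwa [abscissa_le_iff hB₁ hB₂, height_add_period hB₁] at hle'
  have h4 := height_mono (a₂ := h + c * k) hB₁ hxS.2.1.le
  rw [a.height_eq (x := n) (by omega) le_rfl] at h4
  have h5 := height_add_period (a₂ := h) hn 0
  rw [zero_add, height_zero, zero_add] at h5
  change Closes b c (n + b * h) (h + c * k) (cum (n + b * h) (graftHorizontal b n h S₁ S₂ m))
      (cum (h + c * k) (graftVertical c n h k S₂ m)) x j
  rcases lt_or_ge j (2 * h) with h6 | h6
  · rw [graftVertical, mem_ofWindow (by omega) (by omega)] at hjS
    rcases hjS with ⟨h7, h8, h9⟩ | h7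
    · exact a.closes_of_mem_window hxS h7 h8 h9 hlt
    · by_cases hf : m - n ≤ x ∧ x < m ∧ Shadowed b n h (cum h S₂) x
      · exact a.closes_of_shadowed hf.1 hf.2.1 (hxS.2.2.resolve_left (not_not.2 hf)) h7
      · exact a.closes_of_free hxS hf h7 h6 hlt
  · rw [← Int.sub_emod_right, graftVertical, mem_ofWindow (by omega) (by omega)] at hjS
    rcases hjS with ⟨h7, h8, h9⟩ | h7
    · exact a.closes_of_next hxS.2.1 h7 h8 h6
    · omega

/-- The added vertical edges shadow everything selected: at abscissa 2n, above all of them, the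
potential is no larger than at x. The left end of the horizontal interval is chosen for exactly
this. -/
theorem shadowed_graft (a : Anchored b c e n h k D S₁ S₂ m) :
    ∀ z ∈ graftHorizontal b n h S₁ S₂ m,
      Shadowed b (n + b * h) (h + c * k) (cum (h + c * k) (graftVertical c n h k S₂ m)) z := by
  obtain ⟨hB₁, hB₂, hn, hh, hb, hc⟩ := a.card_pos'
  obtain ⟨hw1, hw2, hw3⟩ := a.height_window
  obtain ⟨hs1, hs2, hs3, hs4, hs5, hs6⟩ := a.size
  have hone := a.one_le
  have hle := a.le
  have hb' : (0 : ℤ) < b := by exact_mod_cast hb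
  refine shadowed_of_window hB₁ hB₂ fun x hx hx' hxS => ⟨2 * n, by have := hxS.2.1; omega, ?_⟩
  have h1 := a.vertical_count_le (j := 2 * h - 1) hxS.1 hxS.2.1 (by omega) (by omega)
  rw [sub_add_cancel] at h1
  unfold pot
  rw [a.height_two]
  have h2 : (b : ℤ) * cum (h + c * k) (graftVertical c n h k S₂ m) (2 * h) =
      b * cum (h + c * k) (graftVertical c n h k S₂ m) (height (n + b * h) (h + c * k) x) +
      b * (cum h S₂ (height n h m) - cum h S₂ (height n h (max (m - n) (min x m)))) + b * h := by
    linear_combination b * h1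
  rw [h2]
  have hbS : (b : ℤ) * (S₂.card + h) = b * S₂.card + b * h := by ring
  have hx1 := hxS.1
  rcases lt_or_ge x (m - n) with h3 | h3
  · rw [show max (m - n) (min x m) = m - n by omega, hw1, cum_add_period hh, add_sub_cancel_left]
    omega
  · have h4 := (unitSteps_cum a.sub₂).monotone <| height_mono (a₂ := h) hn
      (show max (m - n) (min x m) ≤ m by omega)
    have h5 := mul_nonneg hb'.le (sub_nonneg.2 h4)
    omega

end Anchored

end RankTwoCluster

/-! ### Injectivity of the transplantation. -/

namespace RankTwoCluster

/-- A position at which the transplantation of a local pair with vertical part `S₂` is anchored. -/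
noncomputable def anchor (b n h : ℕ) (S₂ : Finset ℕ) : ℤ :=
  Classical.epsilon fun m : ℤ => 1 ≤ m ∧ m ≤ n ∧ ¬Shadowed b n h (cum h S₂) m ∧
    ∃ j, cum h S₂ (j + 1) ≠ cum h S₂ j ∧ abscissa n h j = m

theorem anchored_of_mem_localPairs {b c e n h k D : ℕ} (s : RecState b c e n h k D)
    (hbe : b * e ≤ 2 * n) (hg : RecState.Gap b c e n h D) {S : Finset ℕ × Finset ℕ}
    (hS : S ∈ localPairs b c n h) (hpos : 0 < S.2.card) (hlt : b * S.2.card < n) :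
    Anchored b c e n h k D S.1 S.2 (anchor b n h S.2) := by
  rw [localPairs, Finset.mem_filter, mem_modelPairs] at hS
  obtain ⟨⟨h1, h2, h3⟩, h4⟩ := hS
  obtain ⟨h5, h6, h7, h8⟩ :=
    Classical.epsilon_spec (exists_unshadowed_of_selected s.n_pos s.h_pos h2 hlt hpos)
  refine ⟨s, hbe, hg, h1, h2, h3, fun z hz => ?_, hpos, hlt, h5, h6, h7, h8⟩
  by_contra hcon
  exact Finset.disjoint_left.1 h4 hz ((mem_freeEdges_emod s.n_pos s.h_pos S.2 z).2 hcon)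

theorem exists_emod_mem_Ico {N : ℕ} (hN : 0 < N) (t : ℤ) (i : ℕ) (hi : i < N) :
    ∃ z : ℤ, t ≤ z ∧ z < t + N ∧ (z % N).toNat = i := by
  have hN' : (0 : ℤ) < N := by exact_mod_cast hN
  have h1 := Int.emod_nonneg (i - t) hN'.ne'
  have h2 := Int.emod_lt_of_pos (i - t) hN'
  refine ⟨t + (i - t) % N, by omega, by omega, ?_⟩
  rw [Int.add_emod, Int.emod_emod_of_dvd _ dvd_rfl, ← Int.add_emod, add_sub_cancel, Int.emod_eq_of_lt (by omega) (by omega)]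
  simp

namespace Anchored
variable {b c e n h k D : ℕ} {S₁ S₂ T₁ T₂ : Finset ℕ} {m m' : ℤ}

/-- This recovers S₂ without knowledge of the anchor: all old vertical edges have heights in [-h,
h), the added ones do not, and it remains to reduce modulo h. -/
theorem mem_vertical_iff (a : Anchored b c e n h k D S₁ S₂ m) (i : ℕ) :
    i ∈ S₂ ↔ i < h ∧ ∃ z : ℤ, -h ≤ z ∧ z < h ∧ (z % h).toNat = i ∧
      (z % (h + c * k : ℕ)).toNat ∈ graftVertical c n h k S₂ m := by
  obtain ⟨-, -, -, hh, -, -⟩ := a.card_pos'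
  obtain ⟨hw1, hw2, hw3⟩ := a.height_window
  obtain ⟨-, -, hs3, -, -, -⟩ := a.size
  have key : ∀ z : ℤ, -h ≤ z → z < h → ((z % (h + c * k : ℕ)).toNat ∈ graftVertical c n h k S₂ m ↔
      verticalCond n h S₂ m z) := fun z hz hz' =>
    mem_ofWindow (by push_cast; omega) (by push_cast; omega)
  constructor
  · intro hi
    have hi' : i < h := Finset.mem_range.1 (a.sub₂ hi)
    obtain ⟨z, h1, h2, h3⟩ := exists_emod_mem_Ico hh (height n h (m - n)) i hi'
    refine ⟨hi', z, by omega, by omega, h3, (key z (by omega) (by omega)).2 (Or.inl ⟨h1, by omega, ?_⟩)⟩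
    rwa [h3]
  · rintro ⟨-, z, h1, h2, h3, h4⟩
    rcases (key z h1 h2).1 h4 with h5 | h5
    · exact h3 ▸ h5.2.2
    · omega

theorem mem_horizontal_iff (a : Anchored b c e n h k D S₁ S₂ m) (i : ℕ) :
    i ∈ S₁ ↔ i < n ∧ ∃ z : ℤ, m - n ≤ z ∧ z < m ∧ (z % n).toNat = i ∧
      Shadowed b n h (cum h S₂) z ∧
      (z % (n + b * h : ℕ)).toNat ∈ graftHorizontal b n h S₁ S₂ m := by
  obtain ⟨-, -, hn, -, -, -⟩ := a.card_pos'
  obtain ⟨hs1, hs2, hs3, hs4, -, -⟩ := a.size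
  have hw := a.window_left.1
  have hone := a.one_le
  have hle := a.le
  have key : ∀ z : ℤ, m - n ≤ z → z < m →
      ((z % (n + b * h : ℕ)).toNat ∈ graftHorizontal b n h S₁ S₂ m ↔
      horizontalCond b n h S₁ S₂ m z) := fun z hz hz' =>
    mem_ofWindow (by push_cast; omega) (by push_cast; omega)
  constructor
  · intro hi
    have hi' : i < n := Finset.mem_range.1 (a.sub₁ hi)
    obtain ⟨z, h1, h2, h3⟩ := exists_emod_mem_Ico hn (m - n) i hi'
    have h4 : (z % n).toNat ∈ S₁ := by rwa [h3]
    exact ⟨hi', z, by omega, by omega, h3, a.loc z h4,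
      (key z (by omega) (by omega)).2 ⟨by omega, by omega, Or.inr h4⟩⟩
  · rintro ⟨-, z, h1, h2, h3, h4, h5⟩
    exact h3 ▸ ((key z h1 h2).1 h5).2.2.resolve_left (not_not.2 ⟨h1, h2, h4⟩)

/-- Once S₂ is recovered the anchors coincide, as they are chosen from S₂ alone. Then the shadowed
edges of the window determine S₁. -/
theorem ext (a : Anchored b c e n h k D S₁ S₂ (anchor b n h S₂))
    (a' : Anchored b c e n h k D T₁ T₂ (anchor b n h T₂))
    (h₁ : graftHorizontal b n h S₁ S₂ (anchor b n h S₂) =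
      graftHorizontal b n h T₁ T₂ (anchor b n h T₂))
    (h₂ : graftVertical c n h k S₂ (anchor b n h S₂) =
      graftVertical c n h k T₂ (anchor b n h T₂)) : S₁ = T₁ ∧ S₂ = T₂ := by
  have e₂ : S₂ = T₂ := by
    ext i
    rw [a.mem_vertical_iff, a'.mem_vertical_iff, h₂]
  subst e₂
  refine ⟨?_, rfl⟩
  ext i
  rw [a.mem_horizontal_iff, a'.mem_horizontal_iff, h₁]

end Anchored

/-- Local pairs of type `n × h` can be transplanted into the type `(n + b h) × (h + c k)`. -/
theorem localCount_le {b c e n h k D : ℕ} (s : RecState b c e n h k D) (hbe : b * e ≤ 2 * n)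
    (hg : RecState.Gap b c e n h D) {q : ℕ} (hq : 0 < q) (hlt : b * q < n) (p : ℕ) :
    localCount b c n h p q ≤ localCount b c (n + b * h) (h + c * k) (p + k) (q + h) := by
  classical
  have ha : ∀ S ∈ (localPairs b c n h).filter (fun S => S.1.card = p ∧ S.2.card = q),
      Anchored b c e n h k D S.1 S.2 (anchor b n h S.2) := by
    intro S hS
    rw [Finset.mem_filter] at hS
    obtain ⟨h1, rfl, rfl⟩ := hS
    exact anchored_of_mem_localPairs s hbe hg h1 hq hlt
  refine Finset.card_le_card_of_injOn (fun S =>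
    (graftHorizontal b n h S.1 S.2 (anchor b n h S.2),
      graftVertical c n h k S.2 (anchor b n h S.2))) ?_ ?_
  · intro S hS
    have a := ha S hS
    rw [Finset.mem_coe, Finset.mem_filter] at hS
    obtain ⟨h1, rfl, rfl⟩ := hS
    rw [Finset.mem_coe, Finset.mem_filter, localPairs, Finset.mem_filter, mem_modelPairs]
    refine ⟨⟨⟨ofWindow_subset _ _ _, ofWindow_subset _ _ _, a.admissible_graft⟩, ?_⟩,
      a.card_graftHorizontal, a.card_graftVertical⟩
    exact Finset.disjoint_left.2 fun z hz hz' => (mem_freeEdges.1 hz').2 (a.shadowed_graft z hz)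
  · intro S hS T hT hST
    rw [Prod.mk.injEq] at hST
    have := (ha S hS).ext (ha T hT) hST.1 hST.2
    exact Prod.ext this.1 this.2

/-- The count for a row with a negative exponent is at most the corresponding count of the larger
greedy element. -/
theorem pairCount_le_of_lt {b c e n h k D : ℕ} (s : RecState b c e n h k D) (hbe : b * e ≤ 2 * n)
    (hg : RecState.Gap b c e n h D) {q : ℕ} (hq : 0 < q) (hlt : b * q < n) (p : ℕ) :
    pairCount b c n h p q ≤ pairCount b c (n + b * h) (h + c * k) (p + k) (q + h) := by
  have hB₁ : 0 < n + b * h := by have := s.n_pos; omega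
  have hB₂ : 0 < h + c * k := by have := s.h_pos; omega
  -- Both rows have the same number of free edges, n + bh - b(q + h) = n - bq, so comparing local
  -- counts is enough.
  rw [pairCount_eq_sum s.b_pos s.n_pos s.h_pos, pairCount_eq_sum s.b_pos hB₁ hB₂,
    show n + b * h - b * (q + h) = n - b * q by rw [mul_add]; omega]
  refine (Finset.sum_le_sum fun x _ => Nat.mul_le_mul_left _
    (localCount_le s hbe hg hq hlt x.2)).trans ?_
  have hinj : Function.Injective fun x : ℕ × ℕ => (x.1, x.2 + k) := fun x y hxy => by
    simp only [Prod.mk.injEq, add_left_inj] at hxy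
    exact Prod.ext hxy.1 hxy.2
  rw [← Finset.sum_image (f := fun x : ℕ × ℕ => (n - b * q).choose x.1 *
    localCount b c (n + b * h) (h + c * k) x.2 (q + h)) (g := fun x : ℕ × ℕ => (x.1, x.2 + k))
    hinj.injOn]
  refine Finset.sum_le_sum_of_subset fun x hx => ?_
  obtain ⟨y, hy, rfl⟩ := Finset.mem_image.1 hx
  rw [Finset.HasAntidiagonal.mem_antidiagonal] at hy ⊢
  simp only
  omega

end RankTwoCluster

/-! ### Laurent polynomials by rows and divisibility. -/

namespace RankTwoCluster

open Finsupp

/-- Multiplication of a Laurent polynomial in one variable `z` by `1 + z ^ c`. -/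
noncomputable def bump (c : ℕ) : AddMonoid.End (ℤ →₀ ℤ) :=
  AddMonoidHom.id _ + mapDomain.addMonoidHom fun j : ℤ => j + c

theorem bump_apply (c : ℕ) (u : ℤ →₀ ℤ) (j : ℤ) : bump c u j = u j + u (j - c) := by
  change u j + mapDomain (fun j : ℤ => j + c) u j = _
  congr 1
  conv_lhs => rw [show j = (fun j : ℤ => j + c) (j - c) by simp]
  exact mapDomain_apply (add_left_injective _) _ _

theorem bump_pow_succ (c e : ℕ) (u : ℤ →₀ ℤ) :
    (bump c ^ (e + 1)) u = bump c ((bump c ^ e) u) := by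
  rw [pow_succ']; rfl

theorem bump_pow_add (c e e' : ℕ) (u : ℤ →₀ ℤ) :
    (bump c ^ (e + e')) u = (bump c ^ e) ((bump c ^ e') u) := by
  rw [pow_add]; rfl

/-- `j₁` and `j₂` are the smallest and the largest exponent of `u`. -/
def IsRange (u : ℤ →₀ ℤ) (j₁ j₂ : ℤ) : Prop :=
  u j₁ ≠ 0 ∧ u j₂ ≠ 0 ∧ (∀ j, j < j₁ → u j = 0) ∧ ∀ j, j₂ < j → u j = 0

theorem exists_isRange {u : ℤ →₀ ℤ} (hu : u ≠ 0) : ∃ j₁ j₂, j₁ ≤ j₂ ∧ IsRange u j₁ j₂ := by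
  have hne := support_nonempty_iff.2 hu
  refine ⟨u.support.min' hne, u.support.max' hne, Finset.min'_le_max' _ hne,
    mem_support_iff.1 (Finset.min'_mem _ _), mem_support_iff.1 (Finset.max'_mem _ _), ?_, ?_⟩
  · intro j hj
    by_contra hh
    exact absurd (Finset.min'_le _ _ (mem_support_iff.2 hh)) (not_le.2 hj)
  · intro j hj
    by_contra hh
    exact absurd (Finset.le_max' _ _ (mem_support_iff.2 hh)) (not_le.2 hj)

theorem IsRange.bump {c : ℕ} (hc : 0 < c) {u : ℤ →₀ ℤ} {j₁ j₂ : ℤ} (h : IsRange u j₁ j₂) :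
    IsRange (bump c u) j₁ (j₂ + c) := by
  obtain ⟨h1, h2, h3, h4⟩ := h
  refine ⟨?_, ?_, fun j hj => ?_, fun j hj => ?_⟩
  · rw [bump_apply, h3 (j₁ - c) (by omega), add_zero]; exact h1
  · rw [bump_apply, h4 (j₂ + c) (by omega), zero_add, add_sub_cancel_right]; exact h2
  · rw [bump_apply, h3 _ hj, h3 _ (by omega), add_zero]
  · rw [bump_apply, h4 _ (by omega), h4 _ (by omega), add_zero]

theorem IsRange.bump_pow {c : ℕ} (hc : 0 < c) {u : ℤ →₀ ℤ} {j₁ j₂ : ℤ} (h : IsRange u j₁ j₂)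
    (e : ℕ) : IsRange ((RankTwoCluster.bump c ^ e) u) j₁ (j₂ + c * e) := by
  induction e with
  | zero => simpa using h
  | succ e ih =>
    rw [bump_pow_succ]
    have := ih.bump hc
    rwa [show j₂ + (c : ℤ) * e + c = j₂ + c * ((e + 1 : ℕ) : ℤ) by push_cast; ring] at this

/-- Evaluation of Laurent polynomials in one variable. -/
noncomputable def evalRow (z : AmbientField) : (ℤ →₀ ℤ) →+ AmbientField :=
  liftAddHom fun j => (AddMonoidHom.mulRight (z ^ j)).comp (Int.castAddHom AmbientField)

theorem evalRow_single (z : AmbientField) (j k : ℤ) : evalRow z (single j k) = k * z ^ j := by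
  simp [evalRow]

theorem evalRow_bump {z : AmbientField} (hz : z ≠ 0) (c : ℕ) (u : ℤ →₀ ℤ) :
    evalRow z (bump c u) = (1 + z ^ c) * evalRow z u := by
  change evalRow z (u + mapDomain (fun j : ℤ => j + c) u) = _
  rw [map_add, add_mul, one_mul]
  congr 1
  induction u using Finsupp.induction_linear with
  | zero => simp
  | add f g hf hg => rw [mapDomain_add, map_add, map_add, hf, hg, mul_add]
  | single j k =>
    rw [mapDomain_single, evalRow_single, evalRow_single, zpow_add₀ hz, zpow_natCast]
    ring

theorem evalRow_bump_pow {z : AmbientField} (hz : z ≠ 0) (c e : ℕ) (u : ℤ →₀ ℤ) :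
    evalRow z ((bump c ^ e) u) = (1 + z ^ c) ^ e * evalRow z u := by
  induction e with
  | zero => simp
  | succ e ih => rw [bump_pow_succ, evalRow_bump hz, ih, pow_succ']; ring

/-- Evaluation of Laurent polynomials in two variables, as a homomorphism. -/
noncomputable def evalHom (y z : AmbientField) : (ℤ × ℤ →₀ ℤ) →+ AmbientField :=
  liftAddHom fun e => (AddMonoidHom.mulRight (y ^ e.1 * z ^ e.2)).comp (Int.castAddHom AmbientField)

theorem evalHom_eq (y z : AmbientField) (f : ℤ × ℤ →₀ ℤ) : evalHom y z f = laurentEval y z f := rfl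

theorem evalHom_single (y z : AmbientField) (e : ℤ × ℤ) (k : ℤ) :
    evalHom y z (single e k) = k * (y ^ e.1 * z ^ e.2) := by simp [evalHom]

/-- A Laurent polynomial in `z`, times `y ^ i`. -/
noncomputable def rowEmb (i : ℤ) : (ℤ →₀ ℤ) →+ (ℤ × ℤ →₀ ℤ) :=
  mapDomain.addMonoidHom fun j => (i, j)

theorem rowEmb_apply (i : ℤ) (u : ℤ →₀ ℤ) (e : ℤ × ℤ) :
    rowEmb i u e = if e.1 = i then u e.2 else 0 := by
  obtain ⟨i', j⟩ := e
  have hinj : Function.Injective fun j : ℤ => (i, j) := fun a b h => (Prod.mk.inj h).2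
  change mapDomain (fun j => (i, j)) u (i', j) = _
  split_ifs with h
  · simp only at h
    subst h
    exact mapDomain_apply hinj _ _
  · refine mapDomain_of_notMem_range _ _ fun ⟨j', hj'⟩ => h ?_
    exact (Prod.mk.inj hj').1.symm

theorem evalHom_rowEmb (y z : AmbientField) (i : ℤ) (u : ℤ →₀ ℤ) :
    evalHom y z (rowEmb i u) = y ^ i * evalRow z u := by
  induction u using Finsupp.induction_linear with
  | zero => simp
  | add f g hf hg => rw [map_add, map_add, map_add, hf, hg, mul_add]
  | single j k =>
    change evalHom y z (mapDomain (fun j => (i, j)) (single j k)) = _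
    rw [mapDomain_single, evalHom_single, evalRow_single]
    ring

/-- The row with index `i` of a Laurent polynomial in two variables. -/
noncomputable def row (f : ℤ × ℤ →₀ ℤ) (i : ℤ) : ℤ →₀ ℤ :=
  f.comapDomain (fun j => (i, j)) fun _ _ _ _ h => (Prod.mk.inj h).2

@[simp] theorem row_apply (f : ℤ × ℤ →₀ ℤ) (i j : ℤ) : row f i j = f (i, j) := rfl

theorem eq_sum_rowEmb (f : ℤ × ℤ →₀ ℤ) : f = ∑ i ∈ f.support.image Prod.fst, rowEmb i (row f i) := by
  ext ⟨i, j⟩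
  rw [finsetSum_apply]
  simp only [rowEmb_apply, row_apply]
  rw [Finset.sum_ite_eq]
  split_ifs with h
  · rfl
  · by_contra hh
    exact h (Finset.mem_image.2 ⟨(i, j), mem_support_iff.2 hh, rfl⟩)

/-- The rows with negative index `-l` are divisible by `(1 + z ^ c) ^ l`. -/
def RowDivisible (c : ℕ) (f : ℤ × ℤ →₀ ℤ) : Prop :=
  ∀ l : ℕ, ∃ u, row f (-l) = (bump c ^ l) u

theorem row_add (f g : ℤ × ℤ →₀ ℤ) (i : ℤ) : row (f + g) i = row f i + row g i := by
  ext j; simp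

theorem row_neg (f : ℤ × ℤ →₀ ℤ) (i : ℤ) : row (-f) i = -row f i := by
  ext j; simp

theorem row_rowEmb (i i' : ℤ) (u : ℤ →₀ ℤ) : row (rowEmb i u) i' = if i' = i then u else 0 := by
  ext j
  rw [row_apply, rowEmb_apply]
  split_ifs <;> rfl

/-- The width of a nonzero row with a negative index. -/
theorem RowDivisible.width {c : ℕ} (hc : 0 < c) {f : ℤ × ℤ →₀ ℤ} (h : RowDivisible c f) {i j : ℤ}
    (hi : i ≤ 0) (hf : f (i, j) ≠ 0) :
    ∃ j₁ j₂, f (i, j₁) ≠ 0 ∧ f (i, j₂) ≠ 0 ∧ j₁ + c * (-i) ≤ j₂ := by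
  obtain ⟨u, hu⟩ := h (-i).toNat
  rw [show -(((-i).toNat : ℕ) : ℤ) = i by omega] at hu
  have hu0 : u ≠ 0 := by
    rintro rfl
    rw [map_zero] at hu
    exact hf (by rw [← row_apply, hu]; rfl)
  obtain ⟨j₁, j₂, hle, hr⟩ := exists_isRange hu0
  have := hr.bump_pow hc (-i).toNat
  rw [← hu] at this
  exact ⟨j₁, _, this.1, this.2.1, by
    rw [show (((-i).toNat : ℕ) : ℤ) = -i by omega]; omega⟩

/-- The ring of Laurent polynomials whose rows of index `-l` are divisible by `(1 + z ^ c) ^ l`,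
inside the ambient field. -/
noncomputable def semiLaurent (c : ℕ) (y z : AmbientField) : Subring AmbientField :=
  Subring.closure {x | ∃ (i j : ℤ) (e : ℕ), -i ≤ e ∧ x = y ^ i * z ^ j * (1 + z ^ c) ^ e}

theorem monomial_mem_semiLaurent {c : ℕ} {y z : AmbientField} {i : ℤ} {e : ℕ} (h : -i ≤ e)
    (j : ℤ) : y ^ i * z ^ j * (1 + z ^ c) ^ e ∈ semiLaurent c y z :=
  Subring.subset_closure ⟨i, j, e, h, rfl⟩

/-- The generators are closed under multiplication, so the subring is their additive span, and row
divisibility is an additive condition. -/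
theorem exists_rowDivisible {c : ℕ} {y z x : AmbientField} (hy : y ≠ 0) (hz : z ≠ 0)
    (hx : x ∈ semiLaurent c y z) : ∃ f, evalHom y z f = x ∧ RowDivisible c f := by
  rw [semiLaurent, Subring.mem_closure_iff] at hx
  induction hx using AddSubgroup.closure_induction with
  | mem x hx =>
    have : ∃ (i j : ℤ) (e : ℕ), -i ≤ e ∧ x = y ^ i * z ^ j * (1 + z ^ c) ^ e := by
      induction hx using Submonoid.closure_induction with
      | mem x hx => exact hx
      | one => exact ⟨0, 0, 0, by simp, by simp⟩
      | mul x x' _ _ h h' =>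
        obtain ⟨i, j, e, h1, rfl⟩ := h
        obtain ⟨i', j', e', h1', rfl⟩ := h'
        refine ⟨i + i', j + j', e + e', by push_cast; omega, ?_⟩
        rw [zpow_add₀ hy, zpow_add₀ hz, pow_add]
        ring
    obtain ⟨i, j, e, h1, rfl⟩ := this
    refine ⟨rowEmb i ((bump c ^ e) (single j 1)), ?_, fun l => ?_⟩
    · rw [evalHom_rowEmb, evalRow_bump_pow hz, evalRow_single]
      push_cast
      ring
    · rw [row_rowEmb]
      split_ifs with h
      · refine ⟨(bump c ^ (e - l)) (single j 1), ?_⟩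
        rw [← bump_pow_add, Nat.add_sub_cancel' (by omega)]
      · exact ⟨0, by rw [map_zero]⟩
  | zero => exact ⟨0, map_zero _, fun l => ⟨0, by rw [map_zero]; ext j; simp⟩⟩
  | add x x' _ _ h h' =>
    obtain ⟨f, hf, hd⟩ := h
    obtain ⟨f', hf', hd'⟩ := h'
    refine ⟨f + f', by rw [map_add, hf, hf'], fun l => ?_⟩
    obtain ⟨u, hu⟩ := hd l
    obtain ⟨u', hu'⟩ := hd' l
    exact ⟨u + u', by rw [row_add, hu, hu', map_add]⟩
  | neg x _ h =>
    obtain ⟨f, hf, hd⟩ := h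
    refine ⟨-f, by rw [map_neg, hf], fun l => ?_⟩
    obtain ⟨u, hu⟩ := hd l
    exact ⟨-u, by rw [row_neg, hu, map_neg]⟩

/-- Interchange of the two variables. -/
noncomputable def swapVars (f : ℤ × ℤ →₀ ℤ) : ℤ × ℤ →₀ ℤ := f.equivMapDomain (Equiv.prodComm ℤ ℤ)

@[simp] theorem swapVars_apply (f : ℤ × ℤ →₀ ℤ) (i j : ℤ) : swapVars f (i, j) = f (j, i) := rfl

theorem evalHom_swapVars (y z : AmbientField) (f : ℤ × ℤ →₀ ℤ) :
    evalHom z y (swapVars f) = evalHom y z f := by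
  induction f using Finsupp.induction_linear with
  | zero => simp [swapVars]
  | add f g hf hg =>
    rw [map_add, ← hf, ← hg, ← map_add]
    congr 1
    ext ⟨i, j⟩
    simp
  | single e k =>
    rw [swapVars, equivMapDomain_single, evalHom_single, evalHom_single]
    simp only [Equiv.prodComm_apply, Prod.fst_swap, Prod.snd_swap]
    ring

theorem swapVars_injective : Function.Injective swapVars := fun f g h => by
  ext ⟨i, j⟩
  rw [← swapVars_apply f, h, swapVars_apply]

theorem evalHom_swap_injective {y z : AmbientField} (h : Function.Injective (evalHom y z)) :
    Function.Injective (evalHom z y) := fun f g hfg => by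
  rw [← evalHom_swapVars, ← evalHom_swapVars z y g] at hfg
  exact swapVars_injective (h hfg)

/-- Linear independence of the Laurent monomials passes to the next cluster. -/
theorem evalHom_injective_step {c : ℕ} (hc : 0 < c) {y z w : AmbientField} (hy : y ≠ 0) (hz : z ≠ 0)
    (hw : w ≠ 0) (hyw : y * w = 1 + z ^ c)
    (hinj : Function.Injective (evalHom y z)) : Function.Injective (evalHom z w) := by
  refine evalHom_swap_injective ((injective_iff_map_eq_zero _).2 fun f hf => ?_)
  have hne : 1 + z ^ c ≠ 0 := hyw ▸ mul_ne_zero hy hw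
  set J := f.support.image Prod.fst with hJ
  set N := J.sup fun j => (-j).toNat with hN
  have hJN : ∀ j ∈ J, 0 ≤ N + j := by
    intro j hj
    have : (-j).toNat ≤ N := Finset.le_sup (f := fun j : ℤ => (-j).toNat) hj
    omega
  -- Substitute w = (1 + z^c)/y and clear denominators with (1 + z^c)^N; the power w^j then
  -- contributes to the row -j only.
  set F : ℤ × ℤ →₀ ℤ := ∑ j ∈ J, rowEmb (-j) ((bump c ^ (N + j).toNat) (row f j)) with hF
  have hF0 : evalHom y z F = 0 := by
    have : evalHom y z F = (1 + z ^ c) ^ N * evalHom w z f := by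
      conv_rhs => rw [eq_sum_rowEmb f]
      rw [hF, map_sum, map_sum, Finset.mul_sum]
      refine Finset.sum_congr rfl fun j hj => ?_
      rw [evalHom_rowEmb, evalHom_rowEmb, evalRow_bump_pow hz, ← mul_assoc, ← mul_assoc]
      congr 1
      have hw' : w = (1 + z ^ c) * y⁻¹ := by rw [← hyw]; field_simp
      rw [hw', mul_zpow, inv_zpow', ← mul_assoc, ← zpow_natCast (1 + z ^ c) N, ← zpow_add₀ hne,
        mul_comm, ← zpow_natCast, Int.toNat_of_nonneg (hJN j hj)]
    rw [this, hf, mul_zero]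
  have hF' : F = 0 := hinj (by rw [hF0, map_zero])
  -- Multiplication by 1 + z^c preserves the lowest exponent, hence kills no nonzero row.
  have hrow : ∀ j, row f j = 0 := by
    intro j
    by_cases hj : j ∈ J
    · have h1 : row F (-j) = (bump c ^ (N + j).toNat) (row f j) := by
        ext k
        rw [row_apply, hF, finsetSum_apply]
        simp only [rowEmb_apply, neg_inj]
        rw [Finset.sum_ite_eq, if_pos hj]
      by_contra hcon
      obtain ⟨j₁, j₂, -, hr⟩ := exists_isRange hcon
      have h2 := (hr.bump_pow hc (N + j).toNat).1
      rw [← h1, hF'] at h2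
      exact h2 rfl
    · ext k
      by_contra hcon
      exact hj (Finset.mem_image.2 ⟨(j, k), mem_support_iff.2 hcon, rfl⟩)
  ext ⟨i, j⟩
  rw [← row_apply, hrow]
  rfl

end RankTwoCluster

/-! ### Clusters, exchange relations and generators. -/

namespace RankTwoCluster

open Finsupp

theorem evalHom_base_injective : Function.Injective (evalHom x₁ x₂) := by
  refine (injective_iff_map_eq_zero _).2 fun f hf => ?_
  set N := f.support.sup fun e => (-e.1).toNat + (-e.2).toNat with hN
  have hle : ∀ e ∈ f.support, 0 ≤ e.1 + N ∧ 0 ≤ e.2 + N := by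
    intro e he
    have : (-e.1).toNat + (-e.2).toNat ≤ N :=
      Finset.le_sup (f := fun e : ℤ × ℤ => (-e.1).toNat + (-e.2).toNat) he
    omega
  set μ : ℤ × ℤ → (Fin 2 →₀ ℕ) := fun e =>
    single 0 (e.1 + N).toNat + single 1 (e.2 + N).toNat with hμ
  have hμ0 : ∀ e, μ e 0 = (e.1 + N).toNat := fun e => by simp [hμ]
  have hμ1 : ∀ e, μ e 1 = (e.2 + N).toNat := fun e => by simp [hμ]
  set P : MvPolynomial (Fin 2) ℚ := ∑ e ∈ f.support, MvPolynomial.monomial (μ e) (f e : ℚ) with hP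
  have hx₁ : x₁ ≠ 0 := by
    unfold x₁
    exact (map_ne_zero_iff _ (IsFractionRing.injective _ _)).2 (MvPolynomial.X_ne_zero _)
  have hx₂ : x₂ ≠ 0 := by
    unfold x₂
    exact (map_ne_zero_iff _ (IsFractionRing.injective _ _)).2 (MvPolynomial.X_ne_zero _)
  have hPF : algebraMap (MvPolynomial (Fin 2) ℚ) AmbientField P =
      (x₁ ^ N * x₂ ^ N) * evalHom x₁ x₂ f := by
    rw [evalHom_eq, laurentEval, Finsupp.sum, hP, map_sum, Finset.mul_sum]
    refine Finset.sum_congr rfl fun e he => ?_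
    have hm : MvPolynomial.monomial (μ e) (f e : ℚ) = (f e : MvPolynomial (Fin 2) ℚ) *
        (MvPolynomial.X 0 ^ (e.1 + N).toNat * MvPolynomial.X 1 ^ (e.2 + N).toNat) := by
      rw [MvPolynomial.X_pow_eq_monomial, MvPolynomial.X_pow_eq_monomial, MvPolynomial.monomial_mul,
        one_mul, show (f e : MvPolynomial (Fin 2) ℚ) = MvPolynomial.C (f e : ℚ) by simp,
        MvPolynomial.C_mul_monomial, mul_one]
    rw [hm, map_mul, map_mul, map_pow, map_pow, map_intCast]
    change _ * (x₁ ^ (e.1 + N).toNat * x₂ ^ (e.2 + N).toNat) = _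
    obtain ⟨h1, h2⟩ := hle e he
    rw [← zpow_natCast x₁ (e.1 + N).toNat, ← zpow_natCast x₂ (e.2 + N).toNat,
      Int.toNat_of_nonneg h1, Int.toNat_of_nonneg h2, zpow_add₀ hx₁, zpow_add₀ hx₂, zpow_natCast,
      zpow_natCast]
    ring
  rw [hf, mul_zero, map_eq_zero_iff _ (IsFractionRing.injective _ _)] at hPF
  ext e
  by_contra hcon
  have he : e ∈ f.support := mem_support_iff.2 hcon
  have hc : MvPolynomial.coeff (μ e) P = f e := by
    rw [hP, MvPolynomial.coeff_sum, Finset.sum_eq_single e]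
    · rw [MvPolynomial.coeff_monomial, if_pos rfl]
    · intro e' he' hne
      rw [MvPolynomial.coeff_monomial, if_neg]
      intro hh
      obtain ⟨h1, h2⟩ := hle e he
      obtain ⟨h1', h2'⟩ := hle e' he'
      have h3 := hμ0 e
      have h4 := hμ1 e
      rw [← hh, hμ0] at h3
      rw [← hh, hμ1] at h4
      exact hne (Prod.ext (by omega) (by omega))
    · exact fun h => absurd he h
  rw [hPF, MvPolynomial.coeff_zero] at hc
  exact hcon (by exact_mod_cast hc.symm)

theorem one_add_pow_ne_zero {y z : AmbientField} (h : Function.Injective (evalHom y z)) {c : ℕ}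
    (hc : 0 < c) : 1 + z ^ c ≠ 0 := by
  intro hcon
  have h1 : evalHom y z (single (0, 0) 1 + single (0, (c : ℤ)) 1) = 0 := by
    rw [map_add, evalHom_single, evalHom_single, ← hcon]
    simp
  have h2 := h (h1.trans (map_zero _).symm)
  have h3 := DFunLike.congr_fun h2 (0, 0)
  rw [Finsupp.add_apply, single_eq_same, single_eq_of_ne (by simp; omega)] at h3
  simp at h3

theorem ne_zero_of_injective {y z : AmbientField} (h : Function.Injective (evalHom y z)) :
    y ≠ 0 := by
  rintro rfl
  have h1 : evalHom 0 z (single (1, 0) 1) = 0 := by simp [evalHom_single]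
  have h2 := h (h1.trans (map_zero _).symm)
  have h3 := DFunLike.congr_fun h2 (1, 0)
  simp at h3

variable {b c : ℕ}

theorem exchangeExp_pos (hb : 0 < b) (hc : 0 < c) (m : ℤ) : 0 < exchangeExp b c m := by
  unfold exchangeExp; split_ifs <;> assumption

theorem exchangeExp_add_two (m : ℤ) : exchangeExp b c (m + 2) = exchangeExp b c m := by
  unfold exchangeExp
  simp [parity_simps]

theorem clusterVar_of_one_le {m : ℤ} (h : 1 ≤ m) :
    clusterVar b c m = forwardVar b c (m - 1).toNat := if_pos h

theorem clusterVar_of_le_two {m : ℤ} (h : m ≤ 2) :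
    clusterVar b c m = backwardVar b c (2 - m).toNat := by
  unfold clusterVar
  split_ifs with h1
  · obtain rfl | rfl : m = 1 ∨ m = 2 := by omega
    · rfl
    · rfl
  · rfl

theorem clusterVar_succ_of_one_le {m : ℤ} (h : 1 ≤ m) : clusterVar b c (m + 2) =
    (clusterVar b c (m + 1) ^ exchangeExp b c (m + 1) + 1) / clusterVar b c m := by
  obtain ⟨n, rfl⟩ : ∃ n : ℕ, m = n + 1 := ⟨(m - 1).toNat, by omega⟩
  rw [clusterVar_of_one_le (by omega), clusterVar_of_one_le (by omega),
    clusterVar_of_one_le (by omega), show ((n : ℤ) + 1 + 2 - 1).toNat = n + 2 by omega,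
    show ((n : ℤ) + 1 + 1 - 1).toNat = n + 1 by omega, show ((n : ℤ) + 1 - 1).toNat = n by omega,
    forwardVar, show (n : ℤ) + 1 + 1 = n + 2 by ring]

theorem clusterVar_pred_of_le {m : ℤ} (h : m ≤ 2) : clusterVar b c (m - 2) =
    (clusterVar b c (m - 1) ^ exchangeExp b c (m - 1) + 1) / clusterVar b c m := by
  obtain ⟨n, rfl⟩ : ∃ n : ℕ, m = 2 - n := ⟨(2 - m).toNat, by omega⟩
  rw [clusterVar_of_le_two (by omega), clusterVar_of_le_two (by omega),
    clusterVar_of_le_two (by omega), show (2 - (2 - (n : ℤ) - 2)).toNat = n + 2 by omega,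
    show (2 - (2 - (n : ℤ) - 1)).toNat = n + 1 by omega, show (2 - (2 - (n : ℤ))).toNat = n by omega,
    backwardVar, show 2 - (n : ℤ) - 1 = 1 - n by ring]

/-- The Laurent monomials in each cluster are linearly independent. -/
theorem evalHom_clusterVar_injective (hb : 0 < b) (hc : 0 < c) (m : ℤ) :
    Function.Injective (evalHom (clusterVar b c m) (clusterVar b c (m + 1))) := by
  induction m using Int.inductionOn' (b := 1) with
  | zero => exact evalHom_base_injective
  | succ m hm ih =>
    have h1 := one_add_pow_ne_zero ih (exchangeExp_pos hb hc (m + 1))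
    have hy := ne_zero_of_injective ih
    have hz := ne_zero_of_injective (evalHom_swap_injective ih)
    have hw := clusterVar_succ_of_one_le (b := b) (c := c) hm
    rw [show m + 1 + 1 = m + 2 by ring]
    refine evalHom_injective_step (exchangeExp_pos hb hc (m + 1)) hy hz ?_ ?_ ih
    · rw [hw, add_comm]; exact div_ne_zero h1 hy
    · rw [hw]; field_simp; ring
  | pred m hm ih =>
    have ih' := evalHom_swap_injective ih
    have h1 := one_add_pow_ne_zero ih' (exchangeExp_pos hb hc m)
    have hy := ne_zero_of_injective ih'
    have hz := ne_zero_of_injective ih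
    have hw := clusterVar_pred_of_le (b := b) (c := c) (show m + 1 ≤ 2 by omega)
    rw [show m + 1 - 2 = m - 1 by ring, show m + 1 - 1 = m by ring] at hw
    rw [show m - 1 + 1 = m by ring]
    refine evalHom_swap_injective
      (evalHom_injective_step (exchangeExp_pos hb hc m) hy hz ?_ ?_ ih')
    · rw [hw, add_comm]; exact div_ne_zero h1 hy
    · rw [hw]; field_simp; ring

theorem clusterVar_ne_zero (hb : 0 < b) (hc : 0 < c) (m : ℤ) : clusterVar b c m ≠ 0 :=
  ne_zero_of_injective (evalHom_clusterVar_injective hb hc m)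

/-- The exchange relation. -/
theorem clusterVar_mul (hb : 0 < b) (hc : 0 < c) (m : ℤ) :
    clusterVar b c (m - 1) * clusterVar b c (m + 1) =
      1 + clusterVar b c m ^ exchangeExp b c m := by
  rcases le_or_gt 2 m with h | h
  · have := clusterVar_succ_of_one_le (b := b) (c := c) (show 1 ≤ m - 1 by omega)
    rw [show m - 1 + 2 = m + 1 by ring, show m - 1 + 1 = m by ring] at this
    have h0 := clusterVar_ne_zero hb hc (m - 1)
    rw [this]; field_simp; ring
  · have := clusterVar_pred_of_le (b := b) (c := c) (show m + 1 ≤ 2 by omega)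
    rw [show m + 1 - 2 = m - 1 by ring, show m + 1 - 1 = m by ring] at this
    have h0 := clusterVar_ne_zero hb hc (m + 1)
    rw [this]; field_simp; ring

theorem clusterVar_mem (m : ℤ) : clusterVar b c m ∈ clusterAlgebra b c :=
  Subring.subset_closure ⟨m, rfl⟩

/-- The fifth of five consecutive cluster variables is a polynomial in the first four. -/
theorem mem_of_exchange {R : Subring AmbientField} {y₀ y₁ y₂ y₃ y₄ : AmbientField} {b c : ℕ}
    (hc : 0 < c) (h0 : y₀ ∈ R) (h2 : y₂ ∈ R) (h3 : y₃ ∈ R) (hy : y₂ ≠ 0)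
    (e1 : y₀ * y₂ = 1 + y₁ ^ b) (e2 : y₁ * y₃ = 1 + y₂ ^ c) (e3 : y₂ * y₄ = 1 + y₃ ^ b) :
    y₄ ∈ R := by
  -- Modulo y₂ the power (1 + y₂^c)^b is 1, and the quotient G is the correction in y₄ = y₀ y₃^b -
  -- G.
  have hdvd : ∃ G ∈ R, (1 + y₂ ^ c) ^ b = 1 + y₂ * G := by
    clear e1 e2 e3
    induction b with
    | zero => exact ⟨0, R.zero_mem, by simp⟩
    | succ b ih =>
      obtain ⟨G, hG, hG'⟩ := ih
      refine ⟨G * (1 + y₂ ^ c) + y₂ ^ (c - 1), R.add_mem (R.mul_mem hG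
        (R.add_mem R.one_mem (R.pow_mem h2 _))) (R.pow_mem h2 _), ?_⟩
      rw [pow_succ, hG']
      obtain ⟨c, rfl⟩ := Nat.exists_eq_add_of_lt hc
      simp only [zero_add, Nat.add_sub_cancel]
      ring
  obtain ⟨G, hG, hG'⟩ := hdvd
  have : y₄ = y₀ * y₃ ^ b - G := by
    apply mul_left_cancel₀ hy
    have : (1 + y₁ ^ b) * y₃ ^ b = y₃ ^ b + (1 + y₂ ^ c) ^ b := by
      rw [add_mul, one_mul, ← mul_pow, e2]
    rw [mul_sub, e3, ← mul_assoc, mul_comm y₂ y₀, e1, this, hG']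
    ring
  rw [this]
  exact R.sub_mem (R.mul_mem h0 (R.pow_mem h3 _)) hG

/-- The cluster algebra is generated by any four consecutive cluster variables. -/
theorem clusterAlgebra_le (hb : 0 < b) (hc : 0 < c) {R : Subring AmbientField} (m : ℤ)
    (h0 : clusterVar b c (m - 1) ∈ R) (h1 : clusterVar b c m ∈ R)
    (h2 : clusterVar b c (m + 1) ∈ R) (h3 : clusterVar b c (m + 2) ∈ R) :
    clusterAlgebra b c ≤ R := by
  have key : ∀ n : ℤ, clusterVar b c (n - 1) ∈ R ∧ clusterVar b c n ∈ R ∧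
      clusterVar b c (n + 1) ∈ R ∧ clusterVar b c (n + 2) ∈ R := by
    intro n
    have rel := fun k => clusterVar_mul hb hc k
    induction n using Int.inductionOn' (b := m) with
    | zero => exact ⟨h0, h1, h2, h3⟩
    | succ n _ ih =>
      obtain ⟨i0, i1, i2, i3⟩ := ih
      rw [add_sub_cancel_right, show n + 1 + 1 = n + 2 by ring]
      refine ⟨i1, i2, i3, ?_⟩
      have e1 := rel n
      have e2 := rel (n + 1)
      have e3 := rel (n + 2)
      rw [exchangeExp_add_two] at e3
      rw [add_sub_cancel_right, show n + 1 + 1 = n + 2 by ring] at e2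
      rw [show n + 2 - 1 = n + 1 by ring, show n + 2 + 1 = n + 1 + 2 by ring] at e3
      exact mem_of_exchange (exchangeExp_pos hb hc _) i0 i2 i3 (clusterVar_ne_zero hb hc _) e1 e2 e3
    | pred n _ ih =>
      obtain ⟨i0, i1, i2, i3⟩ := ih
      rw [sub_add_cancel, show n - 1 + 2 = n + 1 by ring]
      refine ⟨?_, i0, i1, i2⟩
      have e1 := rel (n + 1)
      have e2 := rel n
      have e3 := rel (n - 1)
      rw [← exchangeExp_add_two, show n - 1 + 2 = n + 1 by ring] at e3
      rw [add_sub_cancel_right, show n + 1 + 1 = n + 2 by ring] at e1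
      rw [show n - 1 + 1 = n by ring] at e3
      exact mem_of_exchange (exchangeExp_pos hb hc _) i3 i1 i0 (clusterVar_ne_zero hb hc _)
        ((mul_comm _ _).trans e1) ((mul_comm _ _).trans e2) ((mul_comm _ _).trans e3)
  refine Subring.closure_le.2 ?_
  rintro _ ⟨n, rfl⟩
  exact (key n).2.1

/-- Only four consecutive cluster variables need checking. Of these just x_{m+2} = (1 +
x_{m+1}^exponent)/x_m involves a negative power of x_m, and it carries the required factor. -/
theorem clusterAlgebra_le_semiLaurent (hb : 0 < b) (hc : 0 < c) (m : ℤ) :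
    clusterAlgebra b c ≤ semiLaurent (exchangeExp b c (m + 1)) (clusterVar b c m)
      (clusterVar b c (m + 1)) := by
  have hy := clusterVar_ne_zero hb hc m
  have hz := clusterVar_ne_zero hb hc (m + 1)
  have hle : ∀ i j : ℤ, ∀ e : ℕ, -i ≤ e → clusterVar b c m ^ i * clusterVar b c (m + 1) ^ j *
      (1 + clusterVar b c (m + 1) ^ exchangeExp b c (m + 1)) ^ e ∈
      semiLaurent (exchangeExp b c (m + 1)) (clusterVar b c m) (clusterVar b c (m + 1)) :=
    fun i j e h => monomial_mem_semiLaurent h j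
  refine clusterAlgebra_le hb hc m ?_ ?_ ?_ ?_
  · have h1 := clusterVar_mul hb hc m
    have h2 := Subring.add_mem _ (hle 0 (-1) 0 (by simp))
      (hle (exchangeExp b c m) (-1) 0 (by simp))
    have : clusterVar b c (m - 1) = (1 + clusterVar b c m ^ exchangeExp b c m) *
        (clusterVar b c (m + 1))⁻¹ := by rw [← h1]; field_simp
    rw [this]
    convert h2 using 1
    simp
    ring
  · simpa using hle 1 0 0 (by simp)
  · simpa using hle 0 1 0 (by simp)
  · have h1 := clusterVar_mul hb hc (m + 1)
    rw [add_sub_cancel_right, show m + 1 + 1 = m + 2 by ring] at h1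
    have h2 := hle (-1) 0 1 (by simp)
    rw [pow_one, ← h1] at h2
    convert h2 using 1
    simp
    field_simp

theorem clusterAlgebra_le_semiLaurent' (hb : 0 < b) (hc : 0 < c) (m : ℤ) :
    clusterAlgebra b c ≤ semiLaurent (exchangeExp b c m) (clusterVar b c (m + 1))
      (clusterVar b c m) := by
  have hy := clusterVar_ne_zero hb hc m
  have hz := clusterVar_ne_zero hb hc (m + 1)
  have hle : ∀ i j : ℤ, ∀ e : ℕ, -i ≤ e → clusterVar b c (m + 1) ^ i * clusterVar b c m ^ j *
      (1 + clusterVar b c m ^ exchangeExp b c m) ^ e ∈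
      semiLaurent (exchangeExp b c m) (clusterVar b c (m + 1)) (clusterVar b c m) :=
    fun i j e h => monomial_mem_semiLaurent h j
  refine clusterAlgebra_le hb hc m ?_ ?_ ?_ ?_
  · have h1 := clusterVar_mul hb hc m
    have h2 := hle (-1) 0 1 (by simp)
    rw [pow_one, ← h1] at h2
    convert h2 using 1
    simp
    field_simp
  · simpa using hle 0 1 0 (by simp)
  · simpa using hle 1 0 0 (by simp)
  · have h1 := clusterVar_mul hb hc (m + 1)
    rw [add_sub_cancel_right, show m + 1 + 1 = m + 2 by ring] at h1
    have h2 := Subring.add_mem _ (hle 0 (-1) 0 (by simp))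
      (hle (exchangeExp b c (m + 1)) (-1) 0 (by simp))
    have : clusterVar b c (m + 2) = (1 + clusterVar b c (m + 1) ^ exchangeExp b c (m + 1)) *
        (clusterVar b c m)⁻¹ := by rw [← h1]; field_simp
    rw [this]
    convert h2 using 1
    simp
    ring

end RankTwoCluster

/-! ### Pointed elements and bases. -/

namespace RankTwoCluster

open Finsupp

/-- `f` has coefficient `1` at the exponent `-a`, and its support lies in the box spanned by the
powers of the two numerators. -/
def IsPointed (b c : ℕ) (a : ℤ × ℤ) (f : ℤ × ℤ →₀ ℤ) : Prop :=
  f (-a.1, -a.2) = 1 ∧ ∀ i j, f (i, j) ≠ 0 →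
    (-a.1 ≤ i ∧ i ≤ -a.1 + b * max a.2 0) ∧ (-a.2 ≤ j ∧ j ≤ -a.2 + c * max a.1 0)

section
variable {b c : ℕ} {y z : AmbientField}

theorem rowDivisible_of_mem (hy : y ≠ 0) (hz : z ≠ 0) (hinj : Function.Injective (evalHom y z))
    {f : ℤ × ℤ →₀ ℤ} (h : evalHom y z f ∈ semiLaurent c y z) : RowDivisible c f := by
  obtain ⟨g, hg, hd⟩ := exists_rowDivisible hy hz h
  rwa [← hinj hg]

theorem rowDivisible_swapVars_of_mem (hy : y ≠ 0) (hz : z ≠ 0)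
    (hinj : Function.Injective (evalHom y z)) {f : ℤ × ℤ →₀ ℤ}
    (h : evalHom y z f ∈ semiLaurent b z y) : RowDivisible b (swapVars f) := by
  rw [← evalHom_swapVars] at h
  exact rowDivisible_of_mem hz hy (evalHom_swap_injective hinj) h

/-- One elimination step at the lexicographically least exponent. Divisibility forces the row and
the column through that exponent to be wide, so any box containing the support of f also contains
that of g, and the process stays in a fixed finite box. -/
theorem exists_smaller_of_pointed (hb : 0 < b) (hc : 0 < c) {I₀ I₁ J₀ J₁ : ℤ}
    {f g : ℤ × ℤ →₀ ℤ} {p : ℤ × ℤ} (hr : RowDivisible c f) (hs : RowDivisible b (swapVars f))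
    (hbox : ∀ i j, f (i, j) ≠ 0 → (I₀ ≤ i ∧ i ≤ I₁) ∧ J₀ ≤ j ∧ j ≤ J₁)
    (hp : f p ≠ 0) (hmin : ∀ i j, f (i, j) ≠ 0 → toLex p ≤ toLex (i, j))
    (hg : IsPointed b c (-p.1, -p.2) g) :
    (∀ i j, (f - f p • g) (i, j) ≠ 0 → (I₀ ≤ i ∧ i ≤ I₁) ∧ J₀ ≤ j ∧ j ≤ J₁) ∧
      (f - f p • g) p = 0 ∧ ∀ i j, (f - f p • g) (i, j) ≠ 0 → toLex p ≤ toLex (i, j) := by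
  obtain ⟨p₁, p₂⟩ := p
  obtain ⟨hg1, hg2⟩ := hg
  simp only [neg_neg] at hg1 hg2
  have hmin1 : ∀ j, f (p₁, j) ≠ 0 → p₂ ≤ j := by
    intro j hj
    have := hmin p₁ j hj
    rw [Prod.Lex.toLex_le_toLex] at this
    simp at this
    exact this
  have hmin2 : ∀ i j, f (i, j) ≠ 0 → p₁ ≤ i := by
    intro i j hj
    have := hmin i j hj
    rw [Prod.Lex.toLex_le_toLex] at this
    simp at this
    omega
  have hpbox := hbox _ _ hp
  have hI : p₁ + b * max (-p₂) 0 ≤ I₁ := by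
    rcases le_or_gt p₂ 0 with h | h
    · obtain ⟨i₁, i₂, h1, h2, h3⟩ := hs.width hb h (j := p₁) hp
      rw [swapVars_apply] at h1 h2
      have := hmin2 _ _ h1
      have := (hbox _ _ h2).1.2
      rw [max_eq_left (by omega)]
      linarith
    · rw [max_eq_right (by omega), mul_zero]; omega
  have hJ : p₂ + c * max (-p₁) 0 ≤ J₁ := by
    rcases le_or_gt p₁ 0 with h | h
    · obtain ⟨j₁, j₂, h1, h2, h3⟩ := hr.width hc h hp
      have := hmin1 _ h1
      have := (hbox _ _ h2).2.2
      rw [max_eq_left (by omega)]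
      linarith
    · rw [max_eq_right (by omega), mul_zero]; omega
  have hcase : ∀ i j, (f - f (p₁, p₂) • g) (i, j) ≠ 0 → f (i, j) ≠ 0 ∨ g (i, j) ≠ 0 := by
    intro i j hij
    by_contra hcon
    push Not at hcon
    apply hij
    rw [Finsupp.sub_apply, Finsupp.smul_apply, hcon.1, hcon.2]
    simp
  refine ⟨fun i j hij => ?_, ?_, fun i j hij => ?_⟩
  · rcases hcase i j hij with h | h
    · exact hbox i j h
    · have := hg2 i j h
      omega
  · rw [Finsupp.sub_apply, Finsupp.smul_apply, hg1]
    simp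
  · rcases hcase i j hij with h | h
    · exact hmin i j h
    · have := hg2 i j h
      rw [Prod.Lex.toLex_le_toLex]
      simp only
      omega

/-- Pointed elements span the elements that are Laurent polynomials with the two divisibility
properties. -/
theorem mem_span_of_pointed (hb : 0 < b) (hc : 0 < c) (hy : y ≠ 0) (hz : z ≠ 0)
    (hinj : Function.Injective (evalHom y z)) {w : ℤ × ℤ → AmbientField}
    (h₁ : ∀ a, w a ∈ semiLaurent c y z) (h₂ : ∀ a, w a ∈ semiLaurent b z y)
    (hw : ∀ a, ∃ f, evalHom y z f = w a ∧ IsPointed b c a f) {x : AmbientField}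
    (hx₁ : x ∈ semiLaurent c y z) (hx₂ : x ∈ semiLaurent b z y) :
    x ∈ Submodule.span ℤ (Set.range w) := by
  classical
  obtain ⟨f, rfl, -⟩ := exists_rowDivisible hy hz hx₁
  obtain ⟨M, hM⟩ : ∃ M : ℤ, ∀ i j, f (i, j) ≠ 0 → (-M ≤ i ∧ i ≤ M) ∧ -M ≤ j ∧ j ≤ M := by
    refine ⟨(f.support.sup fun e => e.1.natAbs + e.2.natAbs : ℕ), fun i j hij => ?_⟩
    have : i.natAbs + j.natAbs ≤ f.support.sup fun e => e.1.natAbs + e.2.natAbs :=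
      Finset.le_sup (f := fun e : ℤ × ℤ => e.1.natAbs + e.2.natAbs) (mem_support_iff.2 hij)
    omega
  set B : Finset (ℤ × ℤ) := Finset.Icc (-M) M ×ˢ Finset.Icc (-M) M with hB
  -- The number of box points lexicographically at or after some exponent of f; it drops when the
  -- least exponent is cancelled.
  set rank : (ℤ × ℤ →₀ ℤ) → ℕ := fun f =>
    (B.filter fun p => ∃ s, f s ≠ 0 ∧ toLex s ≤ toLex p).card with hrank
  generalize hN : rank f = N
  induction N using Nat.strong_induction_on generalizing f with
  | _ N ih =>
  by_cases hf : f = 0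
  · rw [hf, map_zero]; exact Submodule.zero_mem _
  obtain ⟨p, hp, hmin⟩ := Finset.exists_min_image f.support toLex (support_nonempty_iff.2 hf)
  rw [mem_support_iff] at hp
  obtain ⟨g, hg, hgp⟩ := hw (-p.1, -p.2)
  obtain ⟨k1, k2, k3⟩ := exists_smaller_of_pointed hb hc (rowDivisible_of_mem hy hz hinj hx₁)
    (rowDivisible_swapVars_of_mem hy hz hinj hx₂) hM hp
    (fun i j hij => hmin _ (mem_support_iff.2 hij)) hgp
  have heval : evalHom y z (f - f p • g) = evalHom y z f - f p • w (-p.1, -p.2) := by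
    rw [map_sub, map_zsmul, hg]
  have hmem := ih (rank (f - f p • g)) (by
    rw [← hN]
    refine Finset.card_lt_card (Finset.ssubset_iff_of_subset (fun q hq => ?_) |>.2 ⟨p, ?_, ?_⟩)
    · rw [Finset.mem_filter] at hq ⊢
      obtain ⟨hq1, ⟨s₁, s₂⟩, hs, hsq⟩ := hq
      exact ⟨hq1, p, hp, (k3 s₁ s₂ hs).trans hsq⟩
    · rw [Finset.mem_filter]
      have := hM p.1 p.2 hp
      refine ⟨?_, p, hp, le_rfl⟩
      rw [hB, Finset.mem_product, Finset.mem_Icc, Finset.mem_Icc]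
      exact this
    · rw [Finset.mem_filter]
      rintro ⟨-, ⟨s₁, s₂⟩, hs, hsp⟩
      have : (s₁, s₂) = p := toLex.injective (le_antisymm hsp (k3 s₁ s₂ hs))
      rw [this] at hs
      exact hs k2) (f - f p • g)
    (by rw [heval]; exact sub_mem hx₁ (zsmul_mem (h₁ _) _))
    (by rw [heval]; exact sub_mem hx₂ (zsmul_mem (h₂ _) _)) k1 rfl
  rw [heval] at hmem
  have := Submodule.add_mem _ hmem (Submodule.smul_mem _ (f p)
    (Submodule.subset_span (s := Set.range w) ⟨(-p.1, -p.2), rfl⟩))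
  rwa [sub_add_cancel] at this

/-- Pointed elements are linearly independent. -/
theorem linearIndependent_of_pointed (hinj : Function.Injective (evalHom y z))
    {w : ℤ × ℤ → AmbientField} (hw : ∀ a, ∃ f, evalHom y z f = w a ∧ IsPointed b c a f) :
    LinearIndependent ℤ w := by
  choose F hF hFp using hw
  rw [linearIndependent_iff]
  intro l hl
  by_contra hne
  -- For the lexicographically largest index a, no other term contributes at the exponent -a: it
  -- would need an index componentwise at least a.
  obtain ⟨a, ha, hmax⟩ := Finset.exists_max_image l.support toLex (support_nonempty_iff.2 hne)
  have h1 : evalHom y z (∑ a ∈ l.support, l a • F a) = 0 := by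
    rw [map_sum, ← hl, Finsupp.linearCombination_apply, Finsupp.sum]
    exact Finset.sum_congr rfl fun a _ => by rw [map_zsmul, hF]
  have h2 := hinj (h1.trans (map_zero _).symm)
  have h3 := DFunLike.congr_fun h2 (-a.1, -a.2)
  rw [finsetSum_apply, Finset.sum_eq_single a] at h3
  · rw [Finsupp.smul_apply, (hFp a).1] at h3
    exact mem_support_iff.1 ha (by simpa using h3)
  · intro a' ha' hne'
    rw [Finsupp.smul_apply]
    by_contra hcon
    have h4 := (hFp a').2 (-a.1) (-a.2) (fun h => hcon (by rw [h]; simp))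
    have h5 := hmax a' ha'
    rw [Prod.Lex.toLex_le_toLex] at h5
    exact hne' (Prod.ext (by omega) (by omega))
  · exact fun h => absurd ha h

/-- The product of a Laurent polynomial in `y` and a Laurent polynomial in `z`. -/
noncomputable def outer (v u : ℤ →₀ ℤ) : ℤ × ℤ →₀ ℤ := v.sum fun i k => k • rowEmb i u

theorem outer_apply (v u : ℤ →₀ ℤ) (i j : ℤ) : outer v u (i, j) = v i * u j := by
  rw [outer, Finsupp.sum, finsetSum_apply]
  simp only [Finsupp.smul_apply, rowEmb_apply, smul_eq_mul, mul_ite, mul_zero]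
  rw [Finset.sum_ite_eq]
  split_ifs with h
  · rfl
  · rw [notMem_support_iff.1 h, zero_mul]

theorem evalHom_outer (v u : ℤ →₀ ℤ) : evalHom y z (outer v u) = evalRow y v * evalRow z u := by
  rw [outer, Finsupp.sum, map_sum]
  conv_rhs => rw [← Finsupp.sum_single v, Finsupp.sum, map_sum, Finset.sum_mul]
  refine Finset.sum_congr rfl fun i _ => ?_
  rw [map_zsmul, evalHom_rowEmb, evalRow_single, zsmul_eq_mul, mul_assoc]

theorem bump_pow_single (hc : 0 < c) (e : ℕ) (j : ℤ) : (bump c ^ e) (single j 1) j = 1 := by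
  have hr : IsRange (single j (1 : ℤ)) j j := ⟨by simp, by simp,
    fun k hk => single_eq_of_ne hk.ne, fun k hk => single_eq_of_ne hk.ne'⟩
  induction e with
  | zero => simp
  | succ e ih => rw [bump_pow_succ, bump_apply, ih, (hr.bump_pow hc e).2.2.1 _ (by omega), add_zero]

theorem bump_pow_single_range (hc : 0 < c) (e : ℕ) {j k : ℤ}
    (h : (bump c ^ e) (single j 1) k ≠ 0) : j ≤ k ∧ k ≤ j + c * e := by
  have hr : IsRange (single j (1 : ℤ)) j j := ⟨by simp, by simp,
    fun k hk => single_eq_of_ne hk.ne, fun k hk => single_eq_of_ne hk.ne'⟩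
  have := hr.bump_pow hc e
  constructor <;> by_contra hcon
  · exact h (this.2.2.1 _ (not_le.1 hcon))
  · exact h (this.2.2.2 _ (not_le.1 hcon))

/-- The Laurent expansions of the standard monomials. -/
noncomputable def standardExpansion (b c : ℕ) (a : ℤ × ℤ) : ℤ × ℤ →₀ ℤ :=
  outer ((bump b ^ a.2.toNat) (single (-a.1) 1)) ((bump c ^ a.1.toNat) (single (-a.2) 1))

theorem isPointed_standardExpansion (hb : 0 < b) (hc : 0 < c) (a : ℤ × ℤ) :
    IsPointed b c a (standardExpansion b c a) := by
  refine ⟨?_, fun i j hij => ?_⟩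
  · rw [standardExpansion, outer_apply, bump_pow_single hb, bump_pow_single hc, one_mul]
  · rw [standardExpansion, outer_apply] at hij
    have h1 := bump_pow_single_range hb _ (left_ne_zero_of_mul hij)
    have h2 := bump_pow_single_range hc _ (right_ne_zero_of_mul hij)
    rw [show ((a.2.toNat : ℕ) : ℤ) = max a.2 0 by omega] at h1
    rw [show ((a.1.toNat : ℕ) : ℤ) = max a.1 0 by omega] at h2
    exact ⟨h1, h2⟩

theorem evalHom_standardExpansion (hy : y ≠ 0) (hz : z ≠ 0) (a : ℤ × ℤ) :
    evalHom y z (standardExpansion b c a) =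
      y ^ (-a.1) * z ^ (-a.2) * ((1 + y ^ b) ^ a.2.toNat * (1 + z ^ c) ^ a.1.toNat) := by
  rw [standardExpansion, evalHom_outer, evalRow_bump_pow hy, evalRow_bump_pow hz, evalRow_single,
    evalRow_single]
  push_cast
  ring

end

/-- The cluster algebra contains the standard monomials. -/
theorem standard_mem (b c : ℕ) (hb : 0 < b) (hc : 0 < c) (a : ℤ × ℤ) :
    evalHom x₁ x₂ (standardExpansion b c a) ∈ clusterAlgebra b c := by
  have h1 : x₁ = clusterVar b c 1 := rfl
  have h2 : x₂ = clusterVar b c 2 := rfl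
  have hy : x₁ ≠ 0 := h1 ▸ clusterVar_ne_zero hb hc 1
  have hz : x₂ ≠ 0 := h2 ▸ clusterVar_ne_zero hb hc 2
  have r1 : clusterVar b c 0 * x₂ = 1 + x₁ ^ b := by
    simpa [exchangeExp, ← h1, ← h2] using clusterVar_mul hb hc 1
  have r2 : x₁ * clusterVar b c 3 = 1 + x₂ ^ c := by
    have := clusterVar_mul hb hc 2
    norm_num at this
    rw [← h1, ← h2] at this
    rw [this, exchangeExp, if_neg (by decide)]
  rw [evalHom_standardExpansion hy hz, ← r1, ← r2, mul_pow, mul_pow]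
  have key : x₁ ^ (-a.1) * x₂ ^ (-a.2) * (clusterVar b c 0 ^ a.2.toNat * x₂ ^ a.2.toNat *
      (x₁ ^ a.1.toNat * clusterVar b c 3 ^ a.1.toNat)) =
      x₁ ^ (-a.1).toNat * x₂ ^ (-a.2).toNat * clusterVar b c 0 ^ a.2.toNat *
        clusterVar b c 3 ^ a.1.toNat := by
    have e1 : x₁ ^ (-a.1) * x₁ ^ a.1.toNat = x₁ ^ (-a.1).toNat := by
      rw [← zpow_natCast, ← zpow_natCast, ← zpow_add₀ hy]; congr 1; omega
    have e2 : x₂ ^ (-a.2) * x₂ ^ a.2.toNat = x₂ ^ (-a.2).toNat := by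
      rw [← zpow_natCast, ← zpow_natCast, ← zpow_add₀ hz]; congr 1; omega
    rw [← e1, ← e2]
    ring
  rw [key]
  have m1 : x₁ ∈ clusterAlgebra b c := h1 ▸ clusterVar_mem 1
  have m2 : x₂ ∈ clusterAlgebra b c := h2 ▸ clusterVar_mem 2
  exact mul_mem (mul_mem (mul_mem (pow_mem m1 _) (pow_mem m2 _))
    (pow_mem (clusterVar_mem 0) _)) (pow_mem (clusterVar_mem 3) _)

theorem base_ne_zero : x₁ ≠ 0 ∧ x₂ ≠ 0 :=
  ⟨ne_zero_of_injective evalHom_base_injective,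
    ne_zero_of_injective (evalHom_swap_injective evalHom_base_injective)⟩

/-- The cluster algebra is cut out by the two divisibility conditions. -/
theorem mem_clusterAlgebra_iff {b c : ℕ} (hb : 0 < b) (hc : 0 < c) {x : AmbientField} :
    x ∈ clusterAlgebra b c ↔ x ∈ semiLaurent c x₁ x₂ ∧ x ∈ semiLaurent b x₂ x₁ := by
  have e1 : clusterAlgebra b c ≤ semiLaurent c x₁ x₂ := by
    have := clusterAlgebra_le_semiLaurent hb hc 1
    rwa [exchangeExp, if_neg (by decide)] at this
  have e2 : clusterAlgebra b c ≤ semiLaurent b x₂ x₁ := by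
    have := clusterAlgebra_le_semiLaurent' hb hc 1
    rwa [exchangeExp, if_pos (by decide)] at this
  refine ⟨fun h => ⟨e1 h, e2 h⟩, fun h => ?_⟩
  obtain ⟨hy, hz⟩ := base_ne_zero
  have hmem := standard_mem b c hb hc
  -- The standard monomials lie in the algebra and are pointed, so they span the intersection of the
  -- two rings.
  have := mem_span_of_pointed hb hc hy hz evalHom_base_injective
    (w := fun a => evalHom x₁ x₂ (standardExpansion b c a)) (fun a => e1 (hmem a))
    (fun a => e2 (hmem a)) (fun a => ⟨_, rfl, isPointed_standardExpansion hb hc a⟩) h.1 h.2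
  have hle : Submodule.span ℤ (Set.range fun a => evalHom x₁ x₂ (standardExpansion b c a)) ≤
      (clusterAlgebra b c).toAddSubgroup.toIntSubmodule := by
    rw [Submodule.span_le]
    rintro _ ⟨a, rfl⟩
    exact hmem a
  exact hle this

/-- Pointed elements form a basis of the cluster algebra. -/
theorem exists_basis_of_pointed {b c : ℕ} (hb : 0 < b) (hc : 0 < c) {w : ℤ × ℤ → AmbientField}
    (hmem : ∀ a, w a ∈ clusterAlgebra b c)
    (hw : ∀ a, ∃ f, evalHom x₁ x₂ f = w a ∧ IsPointed b c a f) :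
    ∃ B : Module.Basis (ℤ × ℤ) ℤ (clusterAlgebra b c), ∀ a, (B a : AmbientField) = w a := by
  obtain ⟨hy, hz⟩ := base_ne_zero
  have hli := linearIndependent_of_pointed evalHom_base_injective hw
  set w' : ℤ × ℤ → clusterAlgebra b c := fun a => ⟨w a, hmem a⟩ with hw'
  set φ : clusterAlgebra b c →ₗ[ℤ] AmbientField :=
    (clusterAlgebra b c).subtype.toAddMonoidHom.toIntLinearMap with hφ
  have hφw : φ ∘ w' = w := rfl
  have hli' : LinearIndependent ℤ w' := LinearIndependent.of_comp φ (hφw ▸ hli)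
  have hspan : ⊤ ≤ Submodule.span ℤ (Set.range w') := by
    rintro ⟨x, hx⟩ -
    have h1 := (mem_clusterAlgebra_iff hb hc).1 hx
    have h2 := mem_span_of_pointed hb hc hy hz evalHom_base_injective
      (fun a => ((mem_clusterAlgebra_iff hb hc).1 (hmem a)).1)
      (fun a => ((mem_clusterAlgebra_iff hb hc).1 (hmem a)).2) hw h1.1 h1.2
    rw [← hφw, Set.range_comp, ← Submodule.map_span] at h2
    obtain ⟨x', hx', hxx'⟩ := h2
    have : x' = ⟨x, hx⟩ := Subtype.ext hxx'
    rwa [← this]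
  exact ⟨Module.Basis.mk hli' hspan, fun a => by rw [Module.Basis.mk_apply]⟩

end RankTwoCluster

/-! ### The maximal Dyck path parametrized by steps. -/

namespace RankTwoCluster

section
variable {b c a₁ a₂ : ℕ}

/-- The ordinate of the point of the periodically extended Dyck path after `t` steps. -/
def pathY (a₁ a₂ : ℕ) (t : ℤ) : ℤ := height (a₁ + a₂) a₂ t

/-- The abscissa of the point of the periodically extended Dyck path after `t` steps. -/
def pathX (a₁ a₂ : ℕ) (t : ℤ) : ℤ := t - pathY a₁ a₂ t

theorem pathX_add_pathY (t : ℤ) : pathX a₁ a₂ t + pathY a₁ a₂ t = t := by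
  unfold pathX; ring

theorem le_pathY_iff (h₁ : 0 < a₁) {y t : ℤ} : y ≤ pathY a₁ a₂ t ↔ y * a₁ ≤ (t - y) * a₂ := by
  rw [pathY, le_height_iff (by omega)]
  push_cast
  constructor <;> intro h <;> linarith

theorem unitSteps_pathY (h₁ : 0 < a₁) : UnitSteps (pathY a₁ a₂) := by
  intro t
  have e1 : pathY a₁ a₂ t ≤ pathY a₁ a₂ (t + 1) := height_mono (by omega) (by omega)
  have e2 : pathY a₁ a₂ (t + 1) - 1 ≤ pathY a₁ a₂ t := by
    have := (le_pathY_iff (a₂ := a₂) h₁).1 (le_refl (pathY a₁ a₂ (t + 1)))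
    rw [le_pathY_iff h₁]
    have h₁' : (0 : ℤ) < a₁ := by exact_mod_cast h₁
    linarith
  omega

theorem unitSteps_pathX (h₁ : 0 < a₁) : UnitSteps (pathX a₁ a₂) := by
  intro t
  unfold pathX
  rcases unitSteps_pathY (a₂ := a₂) h₁ t with h | h <;> omega

theorem pathY_le_height (h₁ : 0 < a₁) (t : ℤ) : pathY a₁ a₂ t ≤ height a₁ a₂ (pathX a₁ a₂ t) := by
  rw [le_height_iff h₁]
  exact (le_pathY_iff h₁).1 le_rfl

theorem height_pathX (h₁ : 0 < a₁) {t : ℤ} (h : pathY a₁ a₂ (t + 1) = pathY a₁ a₂ t) :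
    height a₁ a₂ (pathX a₁ a₂ t) = pathY a₁ a₂ t := by
  refine le_antisymm ?_ (pathY_le_height h₁ t)
  by_contra hcon
  rw [not_le, lt_height_iff h₁] at hcon
  have : pathY a₁ a₂ t + 1 ≤ pathY a₁ a₂ (t + 1) := by
    rw [le_pathY_iff h₁]
    unfold pathX at hcon
    linarith
  omega

theorem abscissa_pathY (h₁ : 0 < a₁) (h₂ : 0 < a₂) {t : ℤ}
    (h : pathY a₁ a₂ (t + 1) = pathY a₁ a₂ t + 1) :
    abscissa a₁ a₂ (pathY a₁ a₂ t) = pathX a₁ a₂ t := by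
  refine le_antisymm ?_ ?_
  · rw [abscissa_le_iff_mul h₁ h₂]
    have := (le_pathY_iff (a₂ := a₂) h₁).1 h.ge
    unfold pathX
    linarith
  · refine Int.le_of_sub_one_lt ?_
    rw [lt_abscissa_iff h₁ h₂, ← not_lt, lt_height_iff h₁]
    intro hcon
    have : pathY a₁ a₂ t + 1 ≤ pathY a₁ a₂ t := by
      rw [le_pathY_iff h₁]
      unfold pathX at hcon
      linarith
    omega

theorem pathY_horizontal (h₁ : 0 < a₁) (k : ℤ) :
    pathY a₁ a₂ (k + height a₁ a₂ k) = height a₁ a₂ k ∧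
      pathY a₁ a₂ (k + height a₁ a₂ k + 1) = height a₁ a₂ k := by
  have e1 : height a₁ a₂ k ≤ pathY a₁ a₂ (k + height a₁ a₂ k) := by
    rw [le_pathY_iff h₁, add_sub_cancel_right, ← le_height_iff h₁]
  have e2 : ¬ height a₁ a₂ k + 1 ≤ pathY a₁ a₂ (k + height a₁ a₂ k + 1) := by
    rw [le_pathY_iff h₁, show k + height a₁ a₂ k + 1 - (height a₁ a₂ k + 1) = k by ring,
      ← lt_height_iff h₁]
    exact lt_irrefl _
  have e3 := (unitSteps_pathY (a₂ := a₂) h₁).monotone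
    (show k + height a₁ a₂ k ≤ k + height a₁ a₂ k + 1 by omega)
  omega

theorem pathY_vertical (h₁ : 0 < a₁) (h₂ : 0 < a₂) (j : ℤ) :
    pathY a₁ a₂ (j + abscissa a₁ a₂ j) = j ∧
      pathY a₁ a₂ (j + abscissa a₁ a₂ j + 1) = j + 1 := by
  have e1 : j + 1 ≤ pathY a₁ a₂ (j + abscissa a₁ a₂ j + 1) := by
    rw [le_pathY_iff h₁, show j + abscissa a₁ a₂ j + 1 - (j + 1) = abscissa a₁ a₂ j by ring,
      ← abscissa_le_iff_mul h₁ h₂]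
  have e2 : ¬ j + 1 ≤ pathY a₁ a₂ (j + abscissa a₁ a₂ j) := by
    rw [le_pathY_iff h₁, show j + abscissa a₁ a₂ j - (j + 1) = abscissa a₁ a₂ j - 1 by ring,
      ← abscissa_le_iff_mul h₁ h₂]
    omega
  have e3 := unitSteps_pathY (a₂ := a₂) h₁ (j + abscissa a₁ a₂ j)
  omega

theorem pathY_add_period (h₁ : 0 < a₁) (t : ℤ) :
    pathY a₁ a₂ (t + (a₁ + a₂ : ℕ)) = pathY a₁ a₂ t + a₂ := height_add_period (by omega) t

theorem pathX_add_period (h₁ : 0 < a₁) (t : ℤ) :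
    pathX a₁ a₂ (t + (a₁ + a₂ : ℕ)) = pathX a₁ a₂ t + a₁ := by
  unfold pathX
  rw [pathY_add_period h₁]
  push_cast
  ring

theorem pathY_add_mul_period (h₁ : 0 < a₁) (t s : ℤ) :
    pathY a₁ a₂ (t + s * (a₁ + a₂ : ℕ)) = pathY a₁ a₂ t + s * a₂ :=
  height_add_mul_period (by omega) t s

theorem pathX_add_mul_period (h₁ : 0 < a₁) (t s : ℤ) :
    pathX a₁ a₂ (t + s * (a₁ + a₂ : ℕ)) = pathX a₁ a₂ t + s * a₁ := by
  unfold pathX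
  rw [pathY_add_mul_period h₁]
  push_cast
  ring

theorem pathY_zero : pathY a₁ a₂ 0 = 0 := height_zero _ _

theorem pathX_zero : pathX a₁ a₂ 0 = 0 := by rw [pathX, pathY_zero, sub_zero]

/-- Both paths go up exactly when the point above is not over the diagonal. The extra condition on
the height in the recursive definition is automatic until the end of the path. -/
theorem dyckPoint_eq (h₁ : 0 < a₁) {k : ℕ} (hk : k ≤ a₁ + a₂) :
    ((dyckPoint a₁ a₂ k).1 : ℤ) = pathX a₁ a₂ k ∧ ((dyckPoint a₁ a₂ k).2 : ℤ) = pathY a₁ a₂ k := by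
  induction k with
  | zero => simp [dyckPoint, pathX_zero, pathY_zero]
  | succ k ih =>
    obtain ⟨ih1, ih2⟩ := ih (by omega)
    have hs := unitSteps_pathY (a₂ := a₂) h₁ k
    have hN : pathY a₁ a₂ (a₁ + a₂ : ℕ) = a₂ := by
      have := pathY_add_period (a₂ := a₂) h₁ 0
      rwa [zero_add, pathY_zero, zero_add] at this
    have hle := (unitSteps_pathY (a₂ := a₂) h₁).monotone
      (show ((k : ℤ) + 1) ≤ (a₁ + a₂ : ℕ) by omega)
    have key : pathY a₁ a₂ k + 1 ≤ pathY a₁ a₂ (k + 1) ↔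
        ((dyckPoint a₁ a₂ k).2 + 1) * a₁ ≤ (dyckPoint a₁ a₂ k).1 * a₂ := by
      rw [le_pathY_iff h₁, ← Nat.cast_le (α := ℤ)]
      push_cast
      rw [ih1, ih2, pathX]
      ring_nf
    simp only [dyckPoint]
    push_cast
    unfold pathX at ih1 ⊢
    split_ifs with h
    · have := key.2 h.2
      push_cast
      omega
    · have : ¬ pathY a₁ a₂ k + 1 ≤ pathY a₁ a₂ (k + 1) := fun hh => h ⟨by omega, key.1 hh⟩
      push_cast
      omega

theorem mem_horizontalEdges (h₁ : 0 < a₁) {k : ℕ} :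
    k ∈ horizontalEdges a₁ a₂ ↔ k < a₁ + a₂ ∧ pathY a₁ a₂ (k + 1) = pathY a₁ a₂ k := by
  rw [horizontalEdges, Finset.mem_filter, Finset.mem_range]
  refine and_congr_right fun hk => ?_
  have e1 := (dyckPoint_eq h₁ hk.le).2
  have e2 := (dyckPoint_eq h₁ (k := k + 1) hk).2
  push_cast at e2
  rw [← e1, ← e2]
  exact_mod_cast Iff.rfl

theorem mem_verticalEdges (h₁ : 0 < a₁) {k : ℕ} :
    k ∈ verticalEdges a₁ a₂ ↔ k < a₁ + a₂ ∧ pathY a₁ a₂ (k + 1) = pathY a₁ a₂ k + 1 := by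
  rw [verticalEdges, Finset.mem_filter, Finset.mem_range]
  refine and_congr_right fun hk => ?_
  have e1 := (dyckPoint_eq h₁ hk.le).1
  have e2 := (dyckPoint_eq h₁ (k := k + 1) hk).1
  push_cast at e2
  rw [← Nat.cast_inj (R := ℤ), e1, e2, pathX, pathX]
  omega

/-- The edges of the Dyck path that are horizontal with abscissa in `S`. -/
def horizontalLift (a₁ a₂ : ℕ) (S : Finset ℕ) : Finset ℕ :=
  (horizontalEdges a₁ a₂).filter fun t => (pathX a₁ a₂ t).toNat ∈ S

/-- The edges of the Dyck path that are vertical with height in `S`. -/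
def verticalLift (a₁ a₂ : ℕ) (S : Finset ℕ) : Finset ℕ :=
  (verticalEdges a₁ a₂).filter fun t => (pathY a₁ a₂ t).toNat ∈ S

theorem pathX_mem (h₁ : 0 < a₁) {t : ℤ} (h0 : 0 ≤ t) (ht : t < (a₁ + a₂ : ℕ))
    (h : pathY a₁ a₂ (t + 1) = pathY a₁ a₂ t) : 0 ≤ pathX a₁ a₂ t ∧ pathX a₁ a₂ t < a₁ := by
  have e0 := (unitSteps_pathX (a₂ := a₂) h₁).monotone h0
  have e1 := (unitSteps_pathX (a₂ := a₂) h₁).monotone (show t + 1 ≤ (a₁ + a₂ : ℕ) by omega)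
  have e2 := pathX_add_period (a₂ := a₂) h₁ 0
  rw [pathX_zero] at e0 e2
  rw [zero_add, zero_add] at e2
  have e3 : pathX a₁ a₂ (t + 1) = pathX a₁ a₂ t + 1 := by unfold pathX; omega
  omega

theorem pathY_mem (h₁ : 0 < a₁) {t : ℤ} (h0 : 0 ≤ t) (ht : t < (a₁ + a₂ : ℕ))
    (h : pathY a₁ a₂ (t + 1) = pathY a₁ a₂ t + 1) : 0 ≤ pathY a₁ a₂ t ∧ pathY a₁ a₂ t < a₂ := by
  have e0 := (unitSteps_pathY (a₂ := a₂) h₁).monotone h0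
  have e1 := (unitSteps_pathY (a₂ := a₂) h₁).monotone (show t + 1 ≤ (a₁ + a₂ : ℕ) by omega)
  have e2 := pathY_add_period (a₂ := a₂) h₁ 0
  rw [pathY_zero] at e0 e2
  rw [zero_add, zero_add] at e2
  omega

theorem emod_mem_horizontalLift (h₁ : 0 < a₁) {S : Finset ℕ} (t : ℤ) :
    (t % (a₁ + a₂ : ℕ)).toNat ∈ horizontalLift a₁ a₂ S ↔
      pathY a₁ a₂ (t + 1) = pathY a₁ a₂ t ∧ (pathX a₁ a₂ t % a₁).toNat ∈ S := by
  have hN : (0 : ℤ) < (a₁ + a₂ : ℕ) := by omega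
  have r0 := Int.emod_nonneg t hN.ne'
  have r1 := Int.emod_lt_of_pos t hN
  have e := Int.emod_add_mul_ediv t (a₁ + a₂ : ℕ)
  generalize t % (a₁ + a₂ : ℕ) = r at *
  generalize t / (a₁ + a₂ : ℕ) = s at *
  obtain rfl : t = r + s * (a₁ + a₂ : ℕ) := by rw [← e]; ring
  rw [horizontalLift, Finset.mem_filter, mem_horizontalEdges h₁, Int.toNat_of_nonneg r0,
    add_right_comm, pathY_add_mul_period h₁, pathY_add_mul_period h₁, pathX_add_mul_period h₁,
    Int.add_mul_emod_self_right, add_left_inj]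
  constructor
  · rintro ⟨⟨_, h⟩, h'⟩
    have := pathX_mem h₁ r0 r1 h
    exact ⟨h, by rwa [Int.emod_eq_of_lt this.1 this.2]⟩
  · rintro ⟨h, h'⟩
    have := pathX_mem h₁ r0 r1 h
    rw [Int.emod_eq_of_lt this.1 this.2] at h'
    exact ⟨⟨by omega, h⟩, h'⟩

theorem emod_mem_verticalLift (h₁ : 0 < a₁) {S : Finset ℕ} (t : ℤ) :
    (t % (a₁ + a₂ : ℕ)).toNat ∈ verticalLift a₁ a₂ S ↔
      pathY a₁ a₂ (t + 1) = pathY a₁ a₂ t + 1 ∧ (pathY a₁ a₂ t % a₂).toNat ∈ S := by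
  have hN : (0 : ℤ) < (a₁ + a₂ : ℕ) := by omega
  have r0 := Int.emod_nonneg t hN.ne'
  have r1 := Int.emod_lt_of_pos t hN
  have e := Int.emod_add_mul_ediv t (a₁ + a₂ : ℕ)
  generalize t % (a₁ + a₂ : ℕ) = r at *
  generalize t / (a₁ + a₂ : ℕ) = s at *
  obtain rfl : t = r + s * (a₁ + a₂ : ℕ) := by rw [← e]; ring
  rw [verticalLift, Finset.mem_filter, mem_verticalEdges h₁, Int.toNat_of_nonneg r0,
    add_right_comm r, pathY_add_mul_period h₁, pathY_add_mul_period h₁,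
    Int.add_mul_emod_self_right, add_right_comm, add_left_inj]
  constructor
  · rintro ⟨⟨_, h⟩, h'⟩
    have := pathY_mem h₁ r0 r1 h
    exact ⟨h, by rwa [Int.emod_eq_of_lt this.1 this.2]⟩
  · rintro ⟨h, h'⟩
    have := pathY_mem h₁ r0 r1 h
    rw [Int.emod_eq_of_lt this.1 this.2] at h'
    exact ⟨⟨by omega, h⟩, h'⟩

theorem horizontalLift_subset (S : Finset ℕ) :
    horizontalLift a₁ a₂ S ⊆ Finset.range (a₁ + a₂) :=
  (Finset.filter_subset _ _).trans (Finset.filter_subset _ _)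

theorem verticalLift_subset (S : Finset ℕ) :
    verticalLift a₁ a₂ S ⊆ Finset.range (a₁ + a₂) :=
  (Finset.filter_subset _ _).trans (Finset.filter_subset _ _)

theorem eq_of_step_eq {f g : ℤ → ℤ} (h0 : f 0 = g 0)
    (h : ∀ t, f (t + 1) - f t = g (t + 1) - g t) : f = g := by
  funext t
  induction t using Int.induction_on with
  | zero => exact h0
  | succ t ih => have := h t; omega
  | pred t ih =>
    have := h (-t - 1)
    rw [sub_add_cancel] at this
    omega

theorem cum_horizontalLift (h₁ : 0 < a₁) {S : Finset ℕ} (hS : S ⊆ Finset.range a₁)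
    (t : ℤ) : cum (a₁ + a₂) (horizontalLift a₁ a₂ S) t = cum a₁ S (pathX a₁ a₂ t) := by
  refine congrFun (eq_of_step_eq (g := fun t => cum a₁ S (pathX a₁ a₂ t)) ?_ fun t => ?_) t
  · simp only [pathX_zero, cum_zero hS, cum_zero (horizontalLift_subset S)]
  · rw [cum_succ (horizontalLift_subset S)]
    simp only [emod_mem_horizontalLift h₁]
    rcases unitSteps_pathY (a₂ := a₂) h₁ t with h | h
    · rw [show pathX a₁ a₂ (t + 1) = pathX a₁ a₂ t + 1 by unfold pathX; omega, cum_succ hS]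
      simp [h]
    · rw [show pathX a₁ a₂ (t + 1) = pathX a₁ a₂ t by unfold pathX; omega]
      simp [h]

theorem cum_verticalLift (h₁ : 0 < a₁) {S : Finset ℕ} (hS : S ⊆ Finset.range a₂)
    (t : ℤ) : cum (a₁ + a₂) (verticalLift a₁ a₂ S) t = cum a₂ S (pathY a₁ a₂ t) := by
  refine congrFun (eq_of_step_eq (g := fun t => cum a₂ S (pathY a₁ a₂ t)) ?_ fun t => ?_) t
  · simp only [pathY_zero, cum_zero hS, cum_zero (verticalLift_subset S)]
  · rw [cum_succ (verticalLift_subset S)]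
    simp only [emod_mem_verticalLift h₁]
    rcases unitSteps_pathY (a₂ := a₂) h₁ t with h | h
    · simp [h]
    · rw [h, cum_succ hS]
      simp

theorem card_horizontalLift (h₁ : 0 < a₁) {S : Finset ℕ}
    (hS : S ⊆ Finset.range a₁) : (horizontalLift a₁ a₂ S).card = S.card := by
  have := cum_horizontalLift (a₂ := a₂) h₁ hS (a₁ + a₂ : ℕ)
  rw [cum_period (by omega) (horizontalLift_subset S), ← zero_add (((a₁ + a₂ : ℕ)) : ℤ),
    pathX_add_period h₁, pathX_zero, zero_add, cum_period h₁ hS] at this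
  exact_mod_cast this

theorem card_verticalLift (h₁ : 0 < a₁) (h₂ : 0 < a₂) {S : Finset ℕ}
    (hS : S ⊆ Finset.range a₂) : (verticalLift a₁ a₂ S).card = S.card := by
  have := cum_verticalLift h₁ hS (a₁ + a₂ : ℕ)
  rw [cum_period (by omega) (verticalLift_subset S), ← zero_add (((a₁ + a₂ : ℕ)) : ℤ),
    pathY_add_period h₁, pathY_zero, zero_add, cum_period h₂ hS] at this
  exact_mod_cast this

theorem edgeCount_eq {N : ℕ} {T : Finset ℕ} (hT : T ⊆ Finset.range N) (s i : ℕ) {j : ℕ}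
    (hij : i ≤ j) : (edgeCount N T s i j : ℤ) = cum N T (s + j) - cum N T (s + i) := by
  induction j, hij using Nat.le_induction with
  | base => simp [edgeCount]
  | succ j hj ih =>
    have : edgeCount N T s i (j + 1) = edgeCount N T s i j + if (s + j) % N ∈ T then 1 else 0 := by
      rw [edgeCount, edgeCount, ← Finset.insert_Ico_right_eq_Ico_add_one hj, Finset.filter_insert]
      split_ifs with h
      · rw [Finset.card_insert_of_notMem (by simp)]
      · rfl
    rw [this]
    push_cast
    rw [ih, ← add_assoc, cum_succ hT,
      show (((s : ℤ) + j) % N).toNat = (s + j) % N by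
        rw [← Nat.cast_add, ← Int.natCast_mod, Int.toNat_natCast]]
    ring

end

end RankTwoCluster

/-! ### Compatibility on the path and admissibility. -/

namespace RankTwoCluster

section
variable {b c a₁ a₂ : ℕ}

theorem exists_eq_zero_of_step_le {f : ℤ → ℤ} (hf : ∀ t, f (t + 1) ≤ f t + 1) {x y : ℤ}
    (hxy : x ≤ y) (hx : f x ≤ 0) (hy : 0 ≤ f y) : ∃ t, x ≤ t ∧ t ≤ y ∧ f t = 0 := by
  induction y, hxy using Int.leInduction with
  | base => exact ⟨x, le_rfl, le_rfl, by omega⟩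
  | succ y hxy ih =>
    by_cases h : 0 ≤ f y
    · obtain ⟨t, h1, h2, h3⟩ := ih h
      exact ⟨t, h1, by omega, h3⟩
    · have := hf y
      exact ⟨y + 1, by omega, le_rfl, by omega⟩

/-- The definition asks for equalities at a lattice point, admissibility only for inequalities.
Along the path each difference changes by at most one in the relevant direction and has the right
sign near one end, so a discrete intermediate value argument turns an inequality into an equality.
-/
theorem exists_point_iff (hb : 0 < b) (hc : 0 < c) (h₁ : 0 < a₁) (h₂ : 0 < a₂) {C₁ C₂ : ℤ → ℤ}
    (u₁ : UnitSteps C₁) (u₂ : UnitSteps C₂) {u w : ℤ}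
    (hu : pathY a₁ a₂ (u + 1) = pathY a₁ a₂ u) (hw : pathY a₁ a₂ (w + 1) = pathY a₁ a₂ w + 1)
    (hk : C₁ (pathX a₁ a₂ u + 1) ≠ C₁ (pathX a₁ a₂ u))
    (hj : C₂ (pathY a₁ a₂ w + 1) ≠ C₂ (pathY a₁ a₂ w)) :
    (∃ t, u < t ∧ t ≤ w ∧
      (pathX a₁ a₂ (w + 1) - pathX a₁ a₂ t =
          b * (C₂ (pathY a₁ a₂ (w + 1)) - C₂ (pathY a₁ a₂ t)) ∨
        pathY a₁ a₂ t - pathY a₁ a₂ u = c * (C₁ (pathX a₁ a₂ t) - C₁ (pathX a₁ a₂ u)))) ↔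
    (∃ j', height a₁ a₂ (pathX a₁ a₂ u) ≤ j' ∧ j' < pathY a₁ a₂ w ∧
      c * (C₁ (abscissa a₁ a₂ j') - C₁ (pathX a₁ a₂ u)) ≤
        j' + 1 - height a₁ a₂ (pathX a₁ a₂ u)) ∨
    ∃ k', pathX a₁ a₂ u < k' ∧ k' < abscissa a₁ a₂ (pathY a₁ a₂ w) ∧
      b * (C₂ (pathY a₁ a₂ w + 1) - C₂ (height a₁ a₂ k')) ≤
        abscissa a₁ a₂ (pathY a₁ a₂ w) - k' := by
  have uY := unitSteps_pathY (a₂ := a₂) h₁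
  have uX := unitSteps_pathX (a₂ := a₂) h₁
  have hXu : pathX a₁ a₂ (u + 1) = pathX a₁ a₂ u + 1 := by unfold pathX; omega
  have hXw : pathX a₁ a₂ (w + 1) = pathX a₁ a₂ w := by unfold pathX; omega
  have hb' : (0 : ℤ) < b := by exact_mod_cast hb
  have hc' : (0 : ℤ) < c := by exact_mod_cast hc
  have sk : C₁ (pathX a₁ a₂ u + 1) = C₁ (pathX a₁ a₂ u) + 1 := (u₁ _).resolve_left hk
  have sj : C₂ (pathY a₁ a₂ w + 1) = C₂ (pathY a₁ a₂ w) + 1 := (u₂ _).resolve_left hj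
  rw [height_pathX h₁ hu, abscissa_pathY h₁ h₂ hw, hXw, hw]
  constructor
  · rintro ⟨t, ht1, ht2, h | h⟩
    -- The edge w is itself counted on AF, so AF has positive width and A lies strictly to the left
    -- of w.
    · right
      have e1 := uX.monotone (show u + 1 ≤ t by omega)
      have e2 := uX.monotone ht2
      refine ⟨pathX a₁ a₂ t, by omega, ?_, ?_⟩
      · rcases e2.lt_or_eq with h' | h'
        · exact h'
        · have e3 := u₂.monotone (uY.monotone ht2)
          have : (0 : ℤ) < b * (C₂ (pathY a₁ a₂ w + 1) - C₂ (pathY a₁ a₂ t)) :=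
            mul_pos hb' (by omega)
          omega
      · rw [h]
        have := u₂.monotone (pathY_le_height (a₂ := a₂) h₁ t)
        exact mul_le_mul_of_nonneg_left (by omega) hb'.le
    · left
      have e1 := u₁.monotone (uX.monotone (show u + 1 ≤ t by omega))
      have e2 := uY.monotone ht2
      have : (0 : ℤ) < c * (C₁ (pathX a₁ a₂ t) - C₁ (pathX a₁ a₂ u)) :=
        mul_pos hc' (by rw [hXu] at e1; omega)
      refine ⟨pathY a₁ a₂ t - 1, by omega, by omega, ?_⟩
      have e3 : abscissa a₁ a₂ (pathY a₁ a₂ t - 1) ≤ pathX a₁ a₂ t := by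
        rw [abscissa_le_iff h₁ h₂]
        have := pathY_le_height (a₂ := a₂) h₁ t
        omega
      have e4 := u₁.monotone e3
      have : c * (C₁ (abscissa a₁ a₂ (pathY a₁ a₂ t - 1)) - C₁ (pathX a₁ a₂ u)) ≤
          c * (C₁ (pathX a₁ a₂ t) - C₁ (pathX a₁ a₂ u)) :=
        mul_le_mul_of_nonneg_left (by omega) hc'.le
      omega
  · rintro (⟨j', h3, h4, h5⟩ | ⟨k', h3, h4, h5⟩)
    · obtain ⟨-, p1⟩ := pathY_vertical (a₁ := a₁) (a₂ := a₂) h₁ h₂ j'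
      set t₀ := j' + abscissa a₁ a₂ j' + 1 with ht₀
      have p2 : pathX a₁ a₂ t₀ = abscissa a₁ a₂ j' := by unfold pathX; omega
      have hle : abscissa a₁ a₂ j' ≤ abscissa a₁ a₂ (pathY a₁ a₂ w) := abscissa_mono h₂ h4.le
      rw [abscissa_pathY h₁ h₂ hw] at hle
      have hlt : pathX a₁ a₂ u < abscissa a₁ a₂ j' := by
        rw [lt_abscissa_iff h₁ h₂, height_pathX h₁ hu]
        exact h3
      have q1 := pathX_add_pathY (a₁ := a₁) (a₂ := a₂) u
      have q2 := pathX_add_pathY (a₁ := a₁) (a₂ := a₂) w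
      -- Just after u the difference is -c: one selected horizontal edge and no vertical edge has
      -- been passed. At the top of j' it is nonnegative.
      obtain ⟨t, ht1, ht2, ht⟩ := exists_eq_zero_of_step_le
        (f := fun t => pathY a₁ a₂ t - pathY a₁ a₂ u -
          c * (C₁ (pathX a₁ a₂ t) - C₁ (pathX a₁ a₂ u))) (x := u + 1) (y := t₀)
        (fun t => by
          have e1 := u₁.monotone (uX.monotone (show t ≤ t + 1 by omega))
          have : c * (C₁ (pathX a₁ a₂ t) - C₁ (pathX a₁ a₂ u)) ≤
            c * (C₁ (pathX a₁ a₂ (t + 1)) - C₁ (pathX a₁ a₂ u)) :=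
            mul_le_mul_of_nonneg_left (by omega) hc'.le
          rcases uY t with h | h <;> simp only [h] <;> omega)
        (by omega) (by simp only [hXu, hu, sk]; nlinarith) (by simp only [p1, p2]; omega)
      exact ⟨t, by omega, by omega, Or.inr (by omega)⟩
    · obtain ⟨p1, -⟩ := pathY_horizontal (a₁ := a₁) (a₂ := a₂) h₁ k'
      set t₀ := k' + height a₁ a₂ k' with ht₀
      have p2 : pathX a₁ a₂ t₀ = k' := by unfold pathX; omega
      have hle : height a₁ a₂ (pathX a₁ a₂ u) ≤ height a₁ a₂ k' := height_mono h₁ h3.le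
      rw [height_pathX h₁ hu] at hle
      have hlt : height a₁ a₂ k' ≤ pathY a₁ a₂ w := by
        rw [← lt_abscissa_iff h₁ h₂, abscissa_pathY h₁ h₂ hw]
        exact h4
      have q1 := pathX_add_pathY (a₁ := a₁) (a₂ := a₂) u
      have q2 := pathX_add_pathY (a₁ := a₁) (a₂ := a₂) w
      obtain ⟨t, ht1, ht2, ht⟩ := exists_eq_zero_of_step_le
        (f := fun t => b * (C₂ (pathY a₁ a₂ w + 1) - C₂ (pathY a₁ a₂ t)) -
          (pathX a₁ a₂ w - pathX a₁ a₂ t)) (x := t₀) (y := w)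
        (fun t => by
          have e1 := u₂.monotone (uY.monotone (show t ≤ t + 1 by omega))
          have : b * (C₂ (pathY a₁ a₂ w + 1) - C₂ (pathY a₁ a₂ (t + 1))) ≤
            b * (C₂ (pathY a₁ a₂ w + 1) - C₂ (pathY a₁ a₂ t)) :=
            mul_le_mul_of_nonneg_left (by omega) hb'.le
          rcases uX t with h | h <;> simp only [h] <;> omega)
        (by omega) (by simp only [p1, p2]; omega) (by simp only [sj]; nlinarith)
      exact ⟨t, by omega, ht2, Or.inl (by omega)⟩

theorem eq_add_subpathLength {N u : ℕ} {w : ℤ} (hu : u < N) (huw : u ≤ w) (hw : w < u + N) :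
    w = u + subpathLength N u (w % N).toNat - 1 := by
  have hr0 := Int.emod_nonneg w (show (N : ℤ) ≠ 0 by omega)
  have : (((w % N).toNat + N - u) % N : ℕ) = (w - u).toNat := by
    zify [show u ≤ (w % N).toNat + N by omega]
    rw [Int.toNat_of_nonneg hr0, Int.toNat_of_nonneg (by omega),
      show w % N + N - u = w % N - u + 1 * N by ring, Int.add_mul_emod_self_right,
      Int.emod_sub_emod]
    exact Int.emod_eq_of_lt (by omega) (by omega)
  rw [subpathLength, this]
  omega

theorem compatible_lift_iff (hb : 0 < b) (hc : 0 < c) (h₁ : 0 < a₁) (h₂ : 0 < a₂)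
    {S₁ S₂ : Finset ℕ} (hS₁ : S₁ ⊆ Finset.range a₁) (hS₂ : S₂ ⊆ Finset.range a₂) :
    Compatible b c a₁ a₂ (horizontalLift a₁ a₂ S₁) (verticalLift a₁ a₂ S₂) ↔
      Admissible b c a₁ a₂ (cum a₁ S₁) (cum a₂ S₂) := by
  have hN : (0 : ℤ) < (a₁ + a₂ : ℕ) := by omega
  have uY := unitSteps_pathY (a₂ := a₂) h₁
  have hH : horizontalEdges a₁ a₂ ⊆ Finset.range (a₁ + a₂) := Finset.filter_subset _ _
  have hV : verticalEdges a₁ a₂ ⊆ Finset.range (a₁ + a₂) := Finset.filter_subset _ _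
  have cH : ∀ t, cum (a₁ + a₂) (horizontalEdges a₁ a₂) t = pathX a₁ a₂ t := fun t => by
    refine congrFun (eq_of_step_eq (g := pathX a₁ a₂) (by rw [cum_zero hH, pathX_zero])
      fun t => ?_) t
    have e := emod_mem_horizontalLift (a₂ := a₂) h₁ (S := Finset.range a₁) t
    have e' : horizontalLift a₁ a₂ (Finset.range a₁) = horizontalEdges a₁ a₂ := by
      refine Finset.filter_true_of_mem fun k hk => ?_
      obtain ⟨k1, k2⟩ := (mem_horizontalEdges h₁).1 hk
      have := pathX_mem h₁ (by omega) (by omega) k2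
      rw [Finset.mem_range]
      omega
    have := Int.emod_nonneg (pathX a₁ a₂ t) (show (a₁ : ℤ) ≠ 0 by omega)
    have := Int.emod_lt_of_pos (pathX a₁ a₂ t) (show (0 : ℤ) < a₁ by omega)
    rw [e', and_iff_left (by rw [Finset.mem_range]; omega)] at e
    rw [cum_succ hH]
    simp only [e]
    unfold pathX
    rcases uY t with h | h <;> simp [h]
  have cV : ∀ t, cum (a₁ + a₂) (verticalEdges a₁ a₂) t = pathY a₁ a₂ t := fun t => by
    refine congrFun (eq_of_step_eq (g := pathY a₁ a₂) (by rw [cum_zero hV, pathY_zero])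
      fun t => ?_) t
    have e := emod_mem_verticalLift (a₂ := a₂) h₁ (S := Finset.range a₂) t
    have e' : verticalLift a₁ a₂ (Finset.range a₂) = verticalEdges a₁ a₂ := by
      refine Finset.filter_true_of_mem fun k hk => ?_
      obtain ⟨k1, k2⟩ := (mem_verticalEdges h₁).1 hk
      have := pathY_mem h₁ (by omega) (by omega) k2
      rw [Finset.mem_range]
      omega
    have := Int.emod_nonneg (pathY a₁ a₂ t) (show (a₂ : ℤ) ≠ 0 by omega)
    have := Int.emod_lt_of_pos (pathY a₁ a₂ t) (show (0 : ℤ) < a₂ by omega)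
    rw [e', and_iff_left (by rw [Finset.mem_range]; omega)] at e
    rw [cum_succ hV]
    simp only [e]
    rcases uY t with h | h <;> simp [h]
  -- the condition for a pair of edges, in terms of the periodic path
  have key : ∀ (u v : ℕ) (w : ℤ), (w = u + subpathLength (a₁ + a₂) u v - 1) →
      ((∃ l ∈ Finset.Ioo 0 (subpathLength (a₁ + a₂) u v),
        edgeCount (a₁ + a₂) (horizontalEdges a₁ a₂) u l (subpathLength (a₁ + a₂) u v) =
          b * edgeCount (a₁ + a₂) (verticalLift a₁ a₂ S₂) u l (subpathLength (a₁ + a₂) u v) ∨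
        edgeCount (a₁ + a₂) (verticalEdges a₁ a₂) u 0 l =
          c * edgeCount (a₁ + a₂) (horizontalLift a₁ a₂ S₁) u 0 l) ↔
      ∃ t, (u : ℤ) < t ∧ t ≤ w ∧
        (pathX a₁ a₂ (w + 1) - pathX a₁ a₂ t =
          b * (cum a₂ S₂ (pathY a₁ a₂ (w + 1)) - cum a₂ S₂ (pathY a₁ a₂ t)) ∨
        pathY a₁ a₂ t - pathY a₁ a₂ u =
          c * (cum a₁ S₁ (pathX a₁ a₂ t) - cum a₁ S₁ (pathX a₁ a₂ u)))) := by
    rintro u v w rfl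
    generalize subpathLength (a₁ + a₂) u v = L
    have aux : ∀ l : ℕ, l ≤ L →
        ((edgeCount (a₁ + a₂) (horizontalEdges a₁ a₂) u l L =
          b * edgeCount (a₁ + a₂) (verticalLift a₁ a₂ S₂) u l L ∨
        edgeCount (a₁ + a₂) (verticalEdges a₁ a₂) u 0 l =
          c * edgeCount (a₁ + a₂) (horizontalLift a₁ a₂ S₁) u 0 l) ↔
        (pathX a₁ a₂ (u + L) - pathX a₁ a₂ (u + l) =
          b * (cum a₂ S₂ (pathY a₁ a₂ (u + L)) - cum a₂ S₂ (pathY a₁ a₂ (u + l))) ∨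
        pathY a₁ a₂ (u + l) - pathY a₁ a₂ u =
          c * (cum a₁ S₁ (pathX a₁ a₂ (u + l)) - cum a₁ S₁ (pathX a₁ a₂ u)))) := fun l hl => by
      rw [← Nat.cast_inj (R := ℤ), ← Nat.cast_inj (R := ℤ)]
      push_cast
      rw [edgeCount_eq hH _ _ hl, edgeCount_eq (verticalLift_subset S₂) _ _ hl,
        edgeCount_eq hV _ _ (Nat.zero_le l),
        edgeCount_eq (horizontalLift_subset S₁) _ _ (Nat.zero_le l)]
      simp only [cH, cV, cum_horizontalLift h₁ hS₁, cum_verticalLift h₁ hS₂, Nat.cast_zero,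
        add_zero]
    constructor
    · rintro ⟨l, hl, h⟩
      rw [Finset.mem_Ioo] at hl
      refine ⟨u + l, by omega, by omega, ?_⟩
      rw [sub_add_cancel]
      exact (aux l hl.2.le).1 h
    · rintro ⟨t, ht1, ht2, h⟩
      refine ⟨(t - u).toNat, by rw [Finset.mem_Ioo]; omega, (aux _ (by omega)).2 ?_⟩
      rw [sub_add_cancel] at h
      rwa [show ((u : ℤ) + (t - u).toNat) = t by omega]
  constructor
  · intro h
    refine admissible_of_window h₁ h₂ hS₁ hS₂ 0 fun k j hk0 hk1 hk hj hlt hle => ?_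
    obtain ⟨p1, p2⟩ := pathY_horizontal (a₁ := a₁) (a₂ := a₂) h₁ k
    obtain ⟨p3, p4⟩ := pathY_vertical (a₁ := a₁) (a₂ := a₂) h₁ h₂ j
    have g1 : 0 ≤ height a₁ a₂ k := by have := height_mono (a₂ := a₂) h₁ hk0; simpa using this
    have g2 := height_mono (a₂ := a₂) h₁ (show k ≤ 0 + (a₁ : ℤ) by omega)
    rw [height_add_period h₁, height_zero] at g2
    have hkj : height a₁ a₂ k ≤ j := (lt_abscissa_iff h₁ h₂).1 hlt
    have hkj' : j < height a₁ a₂ k + a₂ := by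
      rw [← height_add_period h₁, ← abscissa_le_iff h₁ h₂]
      exact hle
    obtain ⟨u, hu⟩ : ∃ u : ℕ, (u : ℤ) = k + height a₁ a₂ k := ⟨(k + height a₁ a₂ k).toNat, by omega⟩
    set w := j + abscissa a₁ a₂ j with hw
    have hXu : pathX a₁ a₂ u = k := by unfold pathX; rw [hu]; omega
    have hr0 := Int.emod_nonneg w hN.ne'
    have hr1 := Int.emod_lt_of_pos w hN
    have hu' : u ∈ horizontalLift a₁ a₂ S₁ := by
      have := (emod_mem_horizontalLift (a₂ := a₂) h₁ (S := S₁) u).2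
        ⟨by rw [hu, p1, p2], by rwa [hXu]⟩
      rwa [Int.emod_eq_of_lt (by omega) (by push_cast; omega), Int.toNat_natCast] at this
    have hv' : (w % (a₁ + a₂ : ℕ)).toNat ∈ verticalLift a₁ a₂ S₂ :=
      (emod_mem_verticalLift (a₂ := a₂) h₁ (S := S₂) w).2 ⟨by rw [p3, p4], by rwa [p3]⟩
    have hlen : w = u + subpathLength (a₁ + a₂) u (w % (a₁ + a₂ : ℕ)).toNat - 1 :=
      eq_add_subpathLength (by omega) (by omega) (by push_cast; omega)
    have := (key u _ w hlen).1 (h u hu' _ hv')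
    rw [exists_point_iff hb hc h₁ h₂ (unitSteps_cum hS₁) (unitSteps_cum hS₂)
      (by rw [hu, p1, p2]) (by rw [p3, p4]) (by rw [hXu]; exact (cum_succ_ne_iff hS₁ k).2 hk)
      (by rw [p3]; exact (cum_succ_ne_iff hS₂ j).2 hj), hXu, p3] at this
    exact this
  · intro h u hu v hv
    have hu0 := hu
    have hv0 := hv
    rw [horizontalLift, Finset.mem_filter, mem_horizontalEdges h₁] at hu0
    rw [verticalLift, Finset.mem_filter, mem_verticalEdges h₁] at hv0
    obtain ⟨⟨hun, hu1⟩, -⟩ := hu0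
    obtain ⟨⟨hvn, hv1⟩, -⟩ := hv0
    have huv : u ≠ v := by rintro rfl; omega
    -- The lift of v that follows u within one period: v itself, or its translate if v comes before
    -- u.
    obtain ⟨w, hw1, hw2, hw3, hlen⟩ : ∃ w : ℤ, u < w ∧ w < u + (a₁ + a₂ : ℕ) ∧
        w % (a₁ + a₂ : ℕ) = v ∧ w = u + subpathLength (a₁ + a₂) u v - 1 := by
      rcases lt_or_gt_of_ne huv with h' | h'
      · refine ⟨v, by omega, by omega, Int.emod_eq_of_lt (by omega) (by omega), ?_⟩
        rw [subpathLength, show v + (a₁ + a₂) - u = (v - u) + (a₁ + a₂) by omega,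
          Nat.add_mod_right, Nat.mod_eq_of_lt (by omega)]
        omega
      · refine ⟨v + (a₁ + a₂ : ℕ), by omega, by omega, ?_, ?_⟩
        · rw [Int.add_emod_right]
          exact Int.emod_eq_of_lt (by omega) (by omega)
        · rw [subpathLength, Nat.mod_eq_of_lt (by omega)]
          omega
    have hu2 : ((u : ℤ) % (a₁ + a₂ : ℕ)).toNat = u := by
      rw [Int.emod_eq_of_lt (by omega) (by omega)]; omega
    have hv2 : (w % (a₁ + a₂ : ℕ)).toNat = v := by omega
    have hu3 := (emod_mem_horizontalLift (a₂ := a₂) h₁ (S := S₁) u).1 (by rwa [hu2])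
    have hv3 := (emod_mem_verticalLift (a₂ := a₂) h₁ (S := S₂) w).1 (by rwa [hv2])
    rw [key u v w hlen, exists_point_iff hb hc h₁ h₂ (unitSteps_cum hS₁) (unitSteps_cum hS₂)
      hu3.1 hv3.1 ((cum_succ_ne_iff hS₁ _).2 hu3.2) ((cum_succ_ne_iff hS₂ _).2 hv3.2)]
    have mX := (unitSteps_pathX (a₂ := a₂) h₁).monotone hw1.le
    have hXu : pathX a₁ a₂ (u + 1) = pathX a₁ a₂ u + 1 := by unfold pathX; omega
    have mX' := (unitSteps_pathX (a₂ := a₂) h₁).monotone (show (u : ℤ) + 1 ≤ w by omega)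
    have mX2 := (unitSteps_pathX (a₂ := a₂) h₁).monotone hw2.le
    rw [pathX_add_period h₁] at mX2
    exact h _ _ ((cum_succ_ne_iff hS₁ _).2 hu3.2) ((cum_succ_ne_iff hS₂ _).2 hv3.2)
      (by rw [abscissa_pathY h₁ h₂ hv3.1]; omega) (by rw [abscissa_pathY h₁ h₂ hv3.1]; omega)

/-- Sums over compatible pairs of functions of the numbers of edges. -/
theorem sum_compatiblePairs {M : Type*} [AddCommMonoid M] (hb : 0 < b) (hc : 0 < c) (h₁ : 0 < a₁)
    (h₂ : 0 < a₂) (F : ℕ → ℕ → M) :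
    ∑ S ∈ compatiblePairs b c a₁ a₂, F S.1.card S.2.card =
      ∑ S ∈ modelPairs b c a₁ a₂, F S.1.card S.2.card := by
  symm
  have hinj₁ : ∀ {S T : Finset ℕ}, S ⊆ Finset.range a₁ → T ⊆ Finset.range a₁ →
      horizontalLift a₁ a₂ S = horizontalLift a₁ a₂ T → S ⊆ T := by
    intro S T hS hT h k hk
    have hka := Finset.mem_range.1 (hS hk)
    obtain ⟨p1, p2⟩ := pathY_horizontal (a₁ := a₁) (a₂ := a₂) h₁ k
    have hX : pathX a₁ a₂ (k + height a₁ a₂ k) = k := by unfold pathX; omega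
    have e := (emod_mem_horizontalLift (a₂ := a₂) h₁ (S := S) (k + height a₁ a₂ k)).2
      ⟨by rw [p1, p2], by rw [hX, Int.emod_eq_of_lt (by omega) (by omega)]; exact hk⟩
    rw [h, emod_mem_horizontalLift h₁, hX, Int.emod_eq_of_lt (by omega) (by omega)] at e
    exact e.2
  have hinj₂ : ∀ {S T : Finset ℕ}, S ⊆ Finset.range a₂ → T ⊆ Finset.range a₂ →
      verticalLift a₁ a₂ S = verticalLift a₁ a₂ T → S ⊆ T := by
    intro S T hS hT h j hj
    have hja := Finset.mem_range.1 (hS hj)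
    obtain ⟨p1, p2⟩ := pathY_vertical (a₁ := a₁) (a₂ := a₂) h₁ h₂ j
    have e := (emod_mem_verticalLift (a₂ := a₂) h₁ (S := S) (j + abscissa a₁ a₂ j)).2
      ⟨by rw [p1, p2], by rw [p1, Int.emod_eq_of_lt (by omega) (by omega)]; exact hj⟩
    rw [h, emod_mem_verticalLift h₁, p1, Int.emod_eq_of_lt (by omega) (by omega)] at e
    exact e.2
  have hsurj₁ : ∀ {T : Finset ℕ}, T ⊆ horizontalEdges a₁ a₂ →
      ∃ S ⊆ Finset.range a₁, horizontalLift a₁ a₂ S = T := by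
    intro T hT
    refine ⟨(Finset.range a₁).filter fun k : ℕ => (k + height a₁ a₂ k).toNat ∈ T,
      Finset.filter_subset _ _, ?_⟩
    ext t
    rw [horizontalLift, Finset.mem_filter, Finset.mem_filter, Finset.mem_range]
    have aux : t ∈ horizontalEdges a₁ a₂ → (pathX a₁ a₂ t).toNat < a₁ ∧
        (((pathX a₁ a₂ t).toNat : ℤ) + height a₁ a₂ ((pathX a₁ a₂ t).toNat : ℤ)).toNat = t := by
      intro h
      obtain ⟨h3, h4⟩ := (mem_horizontalEdges h₁).1 h
      have h5 := pathX_mem (a₂ := a₂) h₁ (t := t) (by omega) (by omega) h4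
      refine ⟨by omega, ?_⟩
      rw [Int.toNat_of_nonneg h5.1, height_pathX h₁ h4, pathX_add_pathY, Int.toNat_natCast]
    constructor
    · rintro ⟨h, -, h'⟩
      rwa [(aux h).2] at h'
    · intro h
      have := aux (hT h)
      exact ⟨hT h, this.1, by rwa [this.2]⟩
  have hsurj₂ : ∀ {T : Finset ℕ}, T ⊆ verticalEdges a₁ a₂ →
      ∃ S ⊆ Finset.range a₂, verticalLift a₁ a₂ S = T := by
    intro T hT
    refine ⟨(Finset.range a₂).filter fun j : ℕ => (j + abscissa a₁ a₂ j).toNat ∈ T,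
      Finset.filter_subset _ _, ?_⟩
    ext t
    rw [verticalLift, Finset.mem_filter, Finset.mem_filter, Finset.mem_range]
    have aux : t ∈ verticalEdges a₁ a₂ → (pathY a₁ a₂ t).toNat < a₂ ∧
        (((pathY a₁ a₂ t).toNat : ℤ) + abscissa a₁ a₂ ((pathY a₁ a₂ t).toNat : ℤ)).toNat = t := by
      intro h
      obtain ⟨h3, h4⟩ := (mem_verticalEdges h₁).1 h
      have h5 := pathY_mem (a₂ := a₂) h₁ (t := t) (by omega) (by omega) h4
      refine ⟨by omega, ?_⟩
      rw [Int.toNat_of_nonneg h5.1, abscissa_pathY h₁ h₂ h4, add_comm, pathX_add_pathY,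
        Int.toNat_natCast]
    constructor
    · rintro ⟨h, -, h'⟩
      rwa [(aux h).2] at h'
    · intro h
      have := aux (hT h)
      exact ⟨hT h, this.1, by rwa [this.2]⟩
  refine Finset.sum_bij (fun S _ => (horizontalLift a₁ a₂ S.1, verticalLift a₁ a₂ S.2))
    ?_ ?_ ?_ ?_
  · intro S hS
    rw [mem_modelPairs] at hS
    rw [compatiblePairs, Finset.mem_filter, Finset.mem_product, Finset.mem_powerset,
      Finset.mem_powerset]
    exact ⟨⟨Finset.filter_subset _ _, Finset.filter_subset _ _⟩,
      (compatible_lift_iff hb hc h₁ h₂ hS.1 hS.2.1).2 hS.2.2⟩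
  · rintro ⟨S₁, S₂⟩ hS ⟨T₁, T₂⟩ hT h
    rw [mem_modelPairs] at hS hT
    rw [Prod.mk.injEq] at h ⊢
    exact ⟨(hinj₁ hS.1 hT.1 h.1).antisymm (hinj₁ hT.1 hS.1 h.1.symm),
      (hinj₂ hS.2.1 hT.2.1 h.2).antisymm (hinj₂ hT.2.1 hS.2.1 h.2.symm)⟩
  · rintro ⟨T₁, T₂⟩ hT
    rw [compatiblePairs, Finset.mem_filter, Finset.mem_product, Finset.mem_powerset,
      Finset.mem_powerset] at hT
    obtain ⟨S₁, hS₁, rfl⟩ := hsurj₁ hT.1.1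
    obtain ⟨S₂, hS₂, rfl⟩ := hsurj₂ hT.1.2
    exact ⟨(S₁, S₂), mem_modelPairs.2 ⟨hS₁, hS₂, (compatible_lift_iff hb hc h₁ h₂ hS₁ hS₂).1 hT.2⟩,
      rfl⟩
  · intro S hS
    rw [mem_modelPairs] at hS
    rw [card_horizontalLift h₁ hS.1, card_verticalLift h₁ h₂ hS.2.1]

end

end RankTwoCluster

/-! ### Expansions of greedy elements, their support, and uniqueness. -/

namespace RankTwoCluster

open Polynomial

/-- The Laurent polynomial with coefficients `F p q` at `y ^ (b q - a₁) * z ^ (c p - a₂)`. -/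
noncomputable def latticeExpansion (b c a₁ a₂ P Q : ℕ) (F : ℕ → ℕ → ℤ) : ℤ × ℤ →₀ ℤ :=
  ∑ p ∈ Finset.range P, ∑ q ∈ Finset.range Q,
    Finsupp.single ((b * q - a₁ : ℤ), (c * p - a₂ : ℤ)) (F p q)

section
variable {b c a₁ a₂ P Q : ℕ} {F : ℕ → ℕ → ℤ} {y z : AmbientField}

theorem latticeExpansion_apply (hb : 0 < b) (hc : 0 < c)
    (hF : ∀ p q, F p q ≠ 0 → p < P ∧ q < Q) (p q : ℕ) :
    latticeExpansion b c a₁ a₂ P Q F (b * q - a₁, c * p - a₂) = F p q := by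
  have key : ∀ p' q' : ℕ, (Finsupp.single ((b * q' - a₁ : ℤ), (c * p' - a₂ : ℤ)) (F p' q'))
      ((b * q - a₁ : ℤ), (c * p - a₂ : ℤ)) = if q' = q then (if p' = p then F p q else 0) else 0 := by
    intro p' q'
    rw [Finsupp.single_apply]
    have hb' : (b : ℤ) ≠ 0 := by positivity
    have hc' : (c : ℤ) ≠ 0 := by positivity
    have : (((b * q' - a₁ : ℤ), (c * p' - a₂ : ℤ)) = ((b * q - a₁ : ℤ), (c * p - a₂ : ℤ))) ↔
        q' = q ∧ p' = p := by
      rw [Prod.mk.injEq, sub_left_inj, sub_left_inj, mul_right_inj' hb', mul_right_inj' hc',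
        Nat.cast_inj, Nat.cast_inj]
    simp only [this]
    split_ifs with h1 h2 h3 h4 h5
    · rw [h1.1, h1.2]
    all_goals first | rfl | tauto
  rw [latticeExpansion, Finsupp.finsetSum_apply]
  simp only [Finsupp.finsetSum_apply, key, Finset.sum_ite_eq', Finset.mem_range]
  by_cases h : F p q = 0
  · simp [h]
  · simp [hF p q h]

theorem exists_of_latticeExpansion_ne_zero {i j : ℤ}
    (h : latticeExpansion b c a₁ a₂ P Q F (i, j) ≠ 0) :
    ∃ p q : ℕ, i = b * q - a₁ ∧ j = c * p - a₂ := by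
  rw [latticeExpansion, Finsupp.finsetSum_apply] at h
  obtain ⟨p, -, hp⟩ := Finset.exists_ne_zero_of_sum_ne_zero h
  rw [Finsupp.finsetSum_apply] at hp
  obtain ⟨q, -, hq⟩ := Finset.exists_ne_zero_of_sum_ne_zero hp
  rw [Finsupp.single_apply] at hq
  split_ifs at hq with h'
  · rw [Prod.mk.injEq] at h'
    exact ⟨p, q, h'.1.symm, h'.2.symm⟩
  · exact absurd rfl hq

theorem swapVars_latticeExpansion : swapVars (latticeExpansion b c a₁ a₂ P Q F) =
    latticeExpansion c b a₂ a₁ Q P (fun q p => F p q) := by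
  ext ⟨i, j⟩
  simp only [swapVars_apply, latticeExpansion, Finsupp.finsetSum_apply]
  rw [Finset.sum_comm]
  refine Finset.sum_congr rfl fun q _ => Finset.sum_congr rfl fun p _ => ?_
  simp only [Finsupp.single_apply, Prod.mk.injEq, and_comm]

theorem evalHom_latticeExpansion_rows (hz : z ≠ 0) (R : ℕ → ℤ[X])
    (hF : ∀ p q, F p q = (R q).coeff p) (hR : ∀ q < Q, (R q).natDegree < P) :
    evalHom y z (latticeExpansion b c a₁ a₂ P Q F) = ∑ q ∈ Finset.range Q,
      y ^ (b * q - a₁ : ℤ) * z ^ (-a₂ : ℤ) * aeval (z ^ c) (R q) := by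
  rw [latticeExpansion, Finset.sum_comm, map_sum]
  refine Finset.sum_congr rfl fun q hq => ?_
  rw [map_sum, aeval_eq_sum_range' (hR q (Finset.mem_range.1 hq)), Finset.mul_sum]
  refine Finset.sum_congr rfl fun p _ => ?_
  rw [evalHom_single, hF, Algebra.smul_def, eq_intCast, ← pow_mul, sub_eq_neg_add (_ * (p : ℤ)), zpow_add₀ hz]
  rw [show (z : AmbientField) ^ (c * p : ℤ) = z ^ (c * p) by exact_mod_cast zpow_natCast z (c * p)]
  ring

theorem evalHom_latticeExpansion_columns (hy : y ≠ 0) (R : ℕ → ℤ[X])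
    (hF : ∀ p q, F p q = (R p).coeff q) (hR : ∀ p < P, (R p).natDegree < Q) :
    evalHom y z (latticeExpansion b c a₁ a₂ P Q F) = ∑ p ∈ Finset.range P,
      z ^ (c * p - a₂ : ℤ) * y ^ (-a₁ : ℤ) * aeval (y ^ b) (R p) := by
  rw [← evalHom_swapVars, swapVars_latticeExpansion, evalHom_latticeExpansion_rows hy R
    (fun q p => hF p q) hR]

end

/-- The Laurent expansion of a greedy element whose type is positive. -/
noncomputable def greedyExpansion (b c a₁ a₂ : ℕ) : ℤ × ℤ →₀ ℤ :=
  latticeExpansion b c a₁ a₂ (a₁ + 1) (a₂ + 1) fun p q => pairCount b c a₁ a₂ p q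

section
variable {b c a₁ a₂ p q : ℕ} {y z w : AmbientField}

theorem exists_of_pairCount_ne_zero (h : pairCount b c a₁ a₂ p q ≠ 0) :
    ∃ S ∈ modelPairs b c a₁ a₂, S.1.card = p ∧ S.2.card = q := by
  rw [pairCount, Finset.card_ne_zero] at h
  obtain ⟨S, hS⟩ := h
  rw [Finset.mem_filter] at hS
  exact ⟨S, hS⟩

theorem le_of_pairCount_ne_zero (h : pairCount b c a₁ a₂ p q ≠ 0) : p ≤ a₁ ∧ q ≤ a₂ := by
  obtain ⟨S, hS, rfl, rfl⟩ := exists_of_pairCount_ne_zero h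
  rw [mem_modelPairs] at hS
  have h1 := Finset.card_le_card hS.1
  have h2 := Finset.card_le_card hS.2.1
  rw [Finset.card_range] at h1 h2
  exact ⟨h1, h2⟩

theorem greedyExpansion_apply (hb : 0 < b) (hc : 0 < c) (p q : ℕ) :
    greedyExpansion b c a₁ a₂ (b * q - a₁, c * p - a₂) = pairCount b c a₁ a₂ p q :=
  latticeExpansion_apply hb hc (fun _ _ h => by
    have := le_of_pairCount_ne_zero (Nat.cast_ne_zero.1 h)
    omega) p q

theorem exists_of_greedyExpansion_ne_zero (hb : 0 < b) (hc : 0 < c) {i j : ℤ}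
    (h : greedyExpansion b c a₁ a₂ (i, j) ≠ 0) :
    ∃ p q : ℕ, i = b * q - a₁ ∧ j = c * p - a₂ ∧ pairCount b c a₁ a₂ p q ≠ 0 := by
  obtain ⟨p, q, rfl, rfl⟩ := exists_of_latticeExpansion_ne_zero h
  rw [greedyExpansion_apply hb hc] at h
  exact ⟨p, q, rfl, rfl, Nat.cast_ne_zero.1 h⟩

theorem swapVars_greedyExpansion (h₁ : 0 < a₁) (h₂ : 0 < a₂) :
    swapVars (greedyExpansion b c a₁ a₂) = greedyExpansion c b a₂ a₁ := by
  simp only [greedyExpansion, swapVars_latticeExpansion, pairCount_reflect h₁ h₂]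

theorem natDegree_rowPoly_le (b c a₁ a₂ q : ℕ) : (rowPoly b c a₁ a₂ q).natDegree ≤ a₁ := by
  rw [natDegree_le_iff_coeff_eq_zero]
  intro p hp
  rw [coeff_rowPoly, Nat.cast_eq_zero]
  by_contra h
  have := le_of_pairCount_ne_zero h
  omega

theorem evalHom_greedyExpansion_rows (hz : z ≠ 0) :
    evalHom y z (greedyExpansion b c a₁ a₂) = ∑ q ∈ Finset.range (a₂ + 1),
      y ^ (b * q - a₁ : ℤ) * z ^ (-a₂ : ℤ) * aeval (z ^ c) (rowPoly b c a₁ a₂ q) :=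
  evalHom_latticeExpansion_rows hz _ (fun _ _ => (coeff_rowPoly _ _ _ _ _ _).symm)
    fun _ _ => Nat.lt_succ_of_le (natDegree_rowPoly_le _ _ _ _ _)

theorem evalHom_greedyExpansion (hy : y ≠ 0) (hz : z ≠ 0) :
    evalHom y z (greedyExpansion b c a₁ a₂) = y ^ (-a₁ : ℤ) * z ^ (-a₂ : ℤ) *
      ∑ S ∈ modelPairs b c a₁ a₂, y ^ (b * S.2.card) * z ^ (c * S.1.card) := by
  rw [evalHom_greedyExpansion_rows hz, Finset.mul_sum,
    ← Finset.sum_fiberwise_of_maps_to (g := fun S : Finset ℕ × Finset ℕ => S.2.card)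
      (t := Finset.range (a₂ + 1))]
  · refine Finset.sum_congr rfl fun q _ => ?_
    rw [rowPoly, map_sum, Finset.mul_sum]
    refine Finset.sum_congr rfl fun S hS => ?_
    rw [(Finset.mem_filter.1 hS).2, map_pow, aeval_X, ← pow_mul, sub_eq_neg_add, zpow_add₀ hy,
      show (y : AmbientField) ^ (b * q : ℤ) = y ^ (b * q) by exact_mod_cast zpow_natCast y (b * q)]
    ring
  · intro S hS
    have := Finset.card_le_card (mem_modelPairs.1 hS).2.1
    rw [Finset.card_range] at this
    exact Finset.mem_range.2 (by omega)

theorem pow_mem_semiLaurent (c : ℕ) (y z : AmbientField) (k : ℕ) :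
    z ^ k ∈ semiLaurent c y z := by
  have := monomial_mem_semiLaurent (c := c) (y := y) (z := z) (i := 0) (e := 0) (by simp) k
  simpa using this

theorem aeval_mem_semiLaurent (y z : AmbientField) (f : ℤ[X]) :
    aeval (z ^ c) f ∈ semiLaurent c y z := by
  rw [aeval_eq_sum_range]
  refine sum_mem fun i _ => ?_
  rw [Algebra.smul_def, eq_intCast, ← pow_mul]
  refine mul_mem (intCast_mem _ _) ?_
  exact pow_mem_semiLaurent _ _ _ _

theorem evalHom_greedyExpansion_mem (hb : 0 < b) (h₁ : 0 < a₁) (h₂ : 0 < a₂) (hz : z ≠ 0) :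
    evalHom y z (greedyExpansion b c a₁ a₂) ∈ semiLaurent c y z := by
  rw [evalHom_greedyExpansion_rows hz]
  refine sum_mem fun q _ => ?_
  rw [rowPoly_eq hb h₁ h₂, map_mul, map_pow, map_add, map_one, aeval_X, ← mul_assoc]
  refine mul_mem (monomial_mem_semiLaurent ?_ _) (aeval_mem_semiLaurent _ _ _)
  omega

theorem evalHom_greedyExpansion_mem' (hc : 0 < c) (h₁ : 0 < a₁) (h₂ : 0 < a₂) (hy : y ≠ 0) :
    evalHom y z (greedyExpansion b c a₁ a₂) ∈ semiLaurent b z y := by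
  rw [← evalHom_swapVars, swapVars_greedyExpansion h₁ h₂]
  exact evalHom_greedyExpansion_mem hc h₂ h₁ hy

theorem evalHom_greedyExpansion_mem_clusterAlgebra (hb : 0 < b) (hc : 0 < c) (h₁ : 0 < a₁)
    (h₂ : 0 < a₂) : evalHom x₁ x₂ (greedyExpansion b c a₁ a₂) ∈ clusterAlgebra b c :=
  (mem_clusterAlgebra_iff hb hc).2 ⟨evalHom_greedyExpansion_mem hb h₁ h₂ base_ne_zero.2,
    evalHom_greedyExpansion_mem' hc h₁ h₂ base_ne_zero.1⟩

/-- The region containing the exponents of a greedy element of type `(a₁, a₂)`. -/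
structure GreedyRegion (b c a₁ a₂ p q : ℕ) : Prop where
  left : p = 0 → q ≤ a₂
  bottom : q = 0 → p ≤ a₁
  row : 0 < q → b * q < a₁ → c * a₁ * (p + b * q) < b * q * a₂ + c * a₁ * a₁
  column : 0 < p → c * p < a₂ → b * a₂ * (q + c * p) < c * p * a₁ + b * a₂ * a₂
  corner : a₁ ≤ b * q → c * p < a₂

theorem exists_localCount_of_pairCount (hb : 0 < b) (h₁ : 0 < a₁) (h₂ : 0 < a₂)
    (h : pairCount b c a₁ a₂ p q ≠ 0) :
    ∃ s, localCount b c a₁ a₂ s q ≠ 0 ∧ p ≤ s + (a₁ - b * q) := by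
  have h' : (rowPoly b c a₁ a₂ q).coeff p ≠ 0 := by rw [coeff_rowPoly]; exact_mod_cast h
  rw [rowPoly_eq hb h₁ h₂, coeff_mul] at h'
  obtain ⟨⟨i, s⟩, hs, hne⟩ := Finset.exists_ne_zero_of_sum_ne_zero h'
  rw [Finset.HasAntidiagonal.mem_antidiagonal] at hs
  have h1 := left_ne_zero_of_mul hne
  have h2 := right_ne_zero_of_mul hne
  rw [coeff_localPoly] at h2
  rw [coeff_one_add_X_pow] at h1
  refine ⟨s, Nat.cast_ne_zero.1 h2, ?_⟩
  by_contra hcon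
  exact h1 (by rw [Nat.choose_eq_zero_of_lt (by omega), Nat.cast_zero])

theorem exists_of_localCount_ne_zero (h : localCount b c a₁ a₂ p q ≠ 0) :
    ∃ S ∈ localPairs b c a₁ a₂, S.1.card = p ∧ S.2.card = q := by
  rw [localCount, Finset.card_ne_zero] at h
  obtain ⟨S, hS⟩ := h
  rw [Finset.mem_filter] at hS
  exact ⟨S, hS⟩

theorem pairCount_ne_zero_of_localCount (h : localCount b c a₁ a₂ p q ≠ 0) : pairCount b c a₁ a₂ p q ≠ 0 := by
  obtain ⟨S, hS, hS'⟩ := exists_of_localCount_ne_zero h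
  rw [pairCount, Finset.card_ne_zero]
  exact ⟨S, Finset.mem_filter.2 ⟨(Finset.mem_filter.1 hS).1, hS'⟩⟩

theorem slope_of_localCount_ne_zero (hb : 0 < b) (h₁ : 0 < a₁) (h₂ : 0 < a₂)
    (h : localCount b c a₁ a₂ p q ≠ 0) (hq : 0 < q) (hlt : b * q < a₁) :
    c * a₁ * p < b * a₂ * q := by
  obtain ⟨S, hS, rfl, rfl⟩ := exists_of_localCount_ne_zero h
  exact slope_of_mem_localPairs hb h₁ h₂ hS hq hlt

theorem row_slope_of_pairCount_ne_zero (hb : 0 < b) (h₁ : 0 < a₁) (h₂ : 0 < a₂)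
    (h : pairCount b c a₁ a₂ p q ≠ 0) (hq : 0 < q) (hlt : b * q < a₁) :
    c * a₁ * (p + b * q) < b * q * a₂ + c * a₁ * a₁ := by
  obtain ⟨s, hs, hps⟩ := exists_localCount_of_pairCount hb h₁ h₂ h
  have h1 := slope_of_localCount_ne_zero hb h₁ h₂ hs hq hlt
  calc c * a₁ * (p + b * q) ≤ c * a₁ * (s + a₁) := Nat.mul_le_mul_left _ (by omega)
    _ = c * a₁ * s + c * a₁ * a₁ := by ring
    _ < b * a₂ * q + c * a₁ * a₁ := by omega
    _ = _ := by ring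

theorem greedyRegion_of_pairCount_ne_zero (hb : 0 < b) (hc : 0 < c) (h₁ : 0 < a₁) (h₂ : 0 < a₂)
    (h : pairCount b c a₁ a₂ p q ≠ 0) : GreedyRegion b c a₁ a₂ p q where
  left _ := (le_of_pairCount_ne_zero h).2
  bottom _ := (le_of_pairCount_ne_zero h).1
  row := row_slope_of_pairCount_ne_zero hb h₁ h₂ h
  column := row_slope_of_pairCount_ne_zero hc h₂ h₁ (by rwa [← pairCount_reflect h₁ h₂])
  corner hge := by
    obtain ⟨S, hS, rfl, rfl⟩ := exists_of_pairCount_ne_zero h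
    exact mul_card_lt_of_mem_modelPairs h₁ h₂ hS hge

/-- A Laurent polynomial satisfying the divisibility conditions and supported in the greedy region
is determined by its coefficient at the corner. -/
theorem eq_zero_of_greedyRegion (hb : 0 < b) (hc : 0 < c) (h₁ : 0 < a₁) (h₂ : 0 < a₂)
    {d : ℤ × ℤ →₀ ℤ} (hr : RowDivisible c d) (hs : RowDivisible b (swapVars d))
    (hd : ∀ i j, d (i, j) ≠ 0 →
      ∃ p q : ℕ, i = b * q - a₁ ∧ j = c * p - a₂ ∧ GreedyRegion b c a₁ a₂ p q)
    (h0 : d (-a₁, -a₂) = 0) : d = 0 := by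
  have hb' : (0 : ℤ) < b := by exact_mod_cast hb
  have hc' : (0 : ℤ) < c := by exact_mod_cast hc
  set D : ℕ → ℕ → Prop := fun p q => d (b * q - a₁, c * p - a₂) ≠ 0 with hD
  have reg : ∀ {p q}, D p q → GreedyRegion b c a₁ a₂ p q := by
    intro p q h
    obtain ⟨p', q', e1, e2, h'⟩ := hd _ _ h
    rw [sub_left_inj, mul_right_inj' hb'.ne', Nat.cast_inj] at e1
    rw [sub_left_inj, mul_right_inj' hc'.ne', Nat.cast_inj] at e2
    rwa [e1, e2]
  have rows : ∀ {p q}, D p q → b * q ≤ a₁ → ∃ p₁ p₂, D p₁ q ∧ D p₂ q ∧ p₁ + a₁ ≤ p₂ + b * q := by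
    intro p q h hq
    obtain ⟨j₁, j₂, h3, h4, h5⟩ := hr.width hc (by zify at hq; omega) h
    obtain ⟨p₁, q₁, e1, e2, -⟩ := hd _ _ h3
    obtain ⟨p₂, q₂, e3, e4, -⟩ := hd _ _ h4
    refine ⟨p₁, p₂, by rwa [e2] at h3, by rwa [e4] at h4, ?_⟩
    rw [e2, e4] at h5
    have : (c : ℤ) * (p₁ + a₁) ≤ c * (p₂ + b * q) := by linarith
    exact_mod_cast le_of_mul_le_mul_left this hc'
  have cols : ∀ {p q}, D p q → c * p ≤ a₂ → ∃ q₁ q₂, D p q₁ ∧ D p q₂ ∧ q₁ + a₂ ≤ q₂ + c * p := by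
    intro p q h hp
    obtain ⟨j₁, j₂, h3, h4, h5⟩ := hs.width hb (i := c * p - a₂) (j := b * q - a₁)
      (by zify at hp; omega) h
    rw [swapVars_apply] at h3 h4
    obtain ⟨p₁, q₁, e1, e2, -⟩ := hd _ _ h3
    obtain ⟨p₂, q₂, e3, e4, -⟩ := hd _ _ h4
    refine ⟨q₁, q₂, by rwa [e1] at h3, by rwa [e3] at h4, ?_⟩
    rw [e1, e3] at h5
    have : (b : ℤ) * (q₁ + a₂) ≤ b * (q₂ + c * p) := by linarith
    exact_mod_cast le_of_mul_le_mul_left this hb'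
  have corner : ¬ D 0 0 := by simp [hD, h0]
  -- A nonzero bottom row would have width at least a₁ inside [0, a₁], and so reach the corner.
  have row0 : ∀ p, ¬ D p 0 := by
    intro p h
    obtain ⟨p₁, p₂, h3, h4, h5⟩ := rows h (by simp)
    have := (reg h4).bottom rfl
    obtain rfl : p₁ = 0 := by omega
    exact corner h3
  have col0 : ∀ q, ¬ D 0 q := by
    intro q h
    obtain ⟨q₁, q₂, h3, h4, h5⟩ := cols h (by simp)
    have := (reg h4).left rfl
    obtain rfl : q₁ = 0 := by omega
    exact corner h3
  -- The width of a nonzero column, against the bound for its upper end, puts its lower end strictly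
  -- under the line b a₂ q = c a₁ p.
  have col : ∀ {p q}, D p q → c * p < a₂ → ∃ q₁, D p q₁ ∧ b * a₂ * q₁ < c * p * a₁ := by
    intro p q h hp
    have hp0 : 0 < p := Nat.pos_of_ne_zero (by rintro rfl; exact col0 _ h)
    obtain ⟨q₁, q₂, h3, h4, h5⟩ := cols h hp.le
    refine ⟨q₁, h3, ?_⟩
    have h6 := (reg h4).column hp0 hp
    have h7 : b * a₂ * (q₁ + a₂) ≤ b * a₂ * (q₂ + c * p) := Nat.mul_le_mul_left _ h5
    have h8 : b * a₂ * (q₁ + a₂) = b * a₂ * q₁ + b * a₂ * a₂ := by ring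
    omega
  -- Infinite descent: the left end of a nonzero row is strictly on the far side of that line, and
  -- the lower end of the column through it lies in a strictly lower row.
  have low : ∀ q, b * q < a₁ → ∀ p, ¬ D p q := by
    intro q
    induction q using Nat.strong_induction_on with
    | _ q ih =>
    intro hq p h
    rcases Nat.eq_zero_or_pos q with rfl | hq0
    · exact row0 _ h
    obtain ⟨p₁, p₂, h3, h4, h5⟩ := rows h hq.le
    have h6 := (reg h4).row hq0 hq
    have h7 : c * a₁ * (p₁ + a₁) ≤ c * a₁ * (p₂ + b * q) := Nat.mul_le_mul_left _ h5
    have h8 : c * a₁ * (p₁ + a₁) = c * a₁ * p₁ + c * a₁ * a₁ := by ring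
    have h9 : c * p₁ * a₁ < b * q * a₂ := by
      have : c * p₁ * a₁ = c * a₁ * p₁ := by ring
      omega
    have h10 : c * p₁ < a₂ := by
      have : b * q * a₂ < a₁ * a₂ := Nat.mul_lt_mul_of_pos_right hq h₂
      by_contra hcon
      have : a₂ * a₁ ≤ c * p₁ * a₁ := Nat.mul_le_mul_right _ (not_lt.1 hcon)
      have : a₂ * a₁ = a₁ * a₂ := mul_comm _ _
      omega
    obtain ⟨q₁, h11, h12⟩ := col h3 h10
    have h13 : q₁ < q := by
      have : b * a₂ * q₁ < b * a₂ * q := by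
        have : b * a₂ * q = b * q * a₂ := by ring
        omega
      exact lt_of_mul_lt_mul_left' this
    have h14 : b * q₁ ≤ b * q := Nat.mul_le_mul_left _ h13.le
    exact ih q₁ h13 (by omega) _ h11
  ext ⟨i, j⟩
  by_contra hne
  obtain ⟨p, q, rfl, rfl, hreg⟩ := hd i j hne
  have hDpq : D p q := hne
  rcases lt_or_ge (b * q) a₁ with hlt | hge
  · exact low q hlt p hDpq
  · have hp := hreg.corner hge
    obtain ⟨q₁, h3, h4⟩ := col hDpq hp
    have h5 : c * p * a₁ < a₂ * a₁ := Nat.mul_lt_mul_of_pos_right hp h₁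
    refine low q₁ ?_ _ h3
    by_contra hcon
    have h6 : a₂ * a₁ ≤ a₂ * (b * q₁) := Nat.mul_le_mul_left _ (not_lt.1 hcon)
    have h7 : a₂ * (b * q₁) = b * a₂ * q₁ := by ring
    omega

end

end RankTwoCluster

/-! ### Mutation of greedy elements. -/

namespace RankTwoCluster

open Polynomial

section
variable {b c a₁ a₂ p q : ℕ} {y z w : AmbientField}

theorem localPoly_zero (hb : 0 < b) (h₁ : 0 < a₁) (h₂ : 0 < a₂) : localPoly b c a₁ a₂ 0 = 1 := by
  have e1 : rowPoly b c a₁ a₂ 0 = (1 + X) ^ a₁ := by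
    ext p
    rw [coeff_rowPoly, pairCount_zero_right h₁ h₂, coeff_one_add_X_pow]
  have e2 := rowPoly_eq (c := c) hb h₁ h₂ 0
  rw [e1, mul_zero, Nat.sub_zero] at e2
  have hne : ((1 + X : ℤ[X]) ^ a₁) ≠ 0 := by
    rw [add_comm]
    exact pow_ne_zero _ (X_add_C_ne_zero 1)
  exact (mul_right_eq_self₀.1 e2.symm).resolve_right hne

/-- The columns of the mutation of a greedy element. -/
noncomputable def mutationPoly (b c a₁ a₂ p : ℕ) : ℤ[X] :=
  if p ≤ a₂ then (1 + X) ^ (b * (a₂ - p) - a₁) * localPoly b c a₁ a₂ (a₂ - p) else 0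

theorem exists_localCount_of_mutationPoly {r : ℕ} (h : (mutationPoly b c a₁ a₂ p).coeff r ≠ 0) :
    ∃ q s, p + q = a₂ ∧ localCount b c a₁ a₂ s q ≠ 0 ∧ s ≤ r ∧ r ≤ s + (b * q - a₁) := by
  rw [mutationPoly] at h
  split_ifs at h with hp
  · rw [coeff_mul] at h
    obtain ⟨⟨i, s⟩, hs, hne⟩ := Finset.exists_ne_zero_of_sum_ne_zero h
    rw [Finset.HasAntidiagonal.mem_antidiagonal] at hs
    have h1 := left_ne_zero_of_mul hne
    have h2 := right_ne_zero_of_mul hne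
    rw [coeff_localPoly] at h2
    rw [coeff_one_add_X_pow] at h1
    refine ⟨a₂ - p, s, by omega, Nat.cast_ne_zero.1 h2, by omega, ?_⟩
    by_contra hcon
    exact h1 (by rw [Nat.choose_eq_zero_of_lt (by omega), Nat.cast_zero])
  · exact absurd (coeff_zero r) h

/-- A coefficient at (p, r) comes from a local pair of sizes (s, q) with q = a₂ - p and s ≤ r ≤ s +
max(bq - a₁, 0). Under q = a₂ - p and a₃ = b a₂ - a₁ the slope bounds of the old type turn into
those of the new one. -/
theorem greedyRegion_of_mutationPoly (hb : 0 < b) (hc : 0 < c) (h₁ : 0 < a₁) (h₂ : 0 < a₂)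
    {a₃ : ℕ} (h : a₁ + a₃ = b * a₂) (h₃ : 0 < a₃) {r : ℕ}
    (hr : (mutationPoly b c a₁ a₂ p).coeff r ≠ 0) : GreedyRegion c b a₂ a₃ p r := by
  obtain ⟨q, s, hpq, hs, hsr, hrs⟩ := exists_localCount_of_mutationPoly hr
  have reg := greedyRegion_of_pairCount_ne_zero hb hc h₁ h₂ (pairCount_ne_zero_of_localCount hs)
  have hs0 : q = 0 → s = 0 := by
    rintro rfl
    by_contra hne
    have : (localPoly b c a₁ a₂ 0).coeff s ≠ 0 := by rw [coeff_localPoly]; exact_mod_cast hs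
    rw [localPoly_zero hb h₁ h₂, coeff_one, if_neg hne] at this
    exact this rfl
  have hmul : b * p + b * q = a₁ + a₃ := by rw [← mul_add, hpq, h]
  refine ⟨?_, fun _ => by omega, ?_, ?_, ?_⟩
  · rintro rfl
    obtain rfl : q = a₂ := by omega
    have hs' : s = 0 := by
      by_contra hne
      have h3 := reg.corner (by omega)
      have h4 := reg.column (by omega) h3
      have h5 : c * s * a₁ ≤ c * s * (b * q) := Nat.mul_le_mul_left _ (by omega)
      have h6 : b * q * (q + c * s) = b * q * q + c * s * (b * q) := by ring
      omega
    omega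
  · intro hr0 hlt
    have key : c * r * a₁ < b * a₂ * q := by
      rcases lt_or_ge (b * q) a₁ with hq | hq
      · obtain rfl : r = s := by omega
        have := slope_of_localCount_ne_zero hb h₁ h₂ hs
          (Nat.pos_of_ne_zero fun h0 => by have := hs0 h0; omega) hq
        calc c * r * a₁ = c * a₁ * r := by ring
          _ < _ := this
      · calc c * r * a₁ < a₂ * a₁ := Nat.mul_lt_mul_of_pos_right hlt h₁
          _ ≤ a₂ * (b * q) := Nat.mul_le_mul_left _ hq
          _ = _ := by ring
    zify at key hpq h ⊢
    have e1 : (p : ℤ) = a₂ - q := by linarith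
    have e2 : (a₃ : ℤ) = b * a₂ - a₁ := by linarith
    rw [e1, e2]
    nlinarith
  · intro hp0 hlt
    have hq : a₁ < b * q := by omega
    have key : c * a₃ * s < b * a₂ * p := by
      rcases Nat.eq_zero_or_pos s with rfl | hs'
      · rw [mul_zero]; positivity
      · have h3 := reg.column hs' (reg.corner hq.le)
        zify at h3 hpq h ⊢
        have e1 : (p : ℤ) = a₂ - q := by linarith
        have e2 : (a₃ : ℤ) = b * a₂ - a₁ := by linarith
        rw [e1, e2]
        nlinarith
    have h5 : r + b * p ≤ s + a₃ := by omega
    calc c * a₃ * (r + b * p) ≤ c * a₃ * (s + a₃) := Nat.mul_le_mul_left _ h5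
      _ = c * a₃ * s + c * a₃ * a₃ := by ring
      _ < b * a₂ * p + c * a₃ * a₃ := by omega
      _ = _ := by ring
  · intro hge
    by_contra hcon
    have hq : b * q ≤ a₁ := by omega
    obtain rfl : r = s := by omega
    rcases hq.lt_or_eq with hq' | hq'
    · rcases Nat.eq_zero_or_pos q with rfl | hq0
      · have := hs0 rfl
        subst this
        omega
      · have h3 := slope_of_localCount_ne_zero hb h₁ h₂ hs hq0 hq'
        have h4 : a₁ * a₂ ≤ a₁ * (c * r) := Nat.mul_le_mul_left _ hge
        have h5 : a₂ * (b * q) ≤ a₂ * a₁ := Nat.mul_le_mul_left _ hq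
        have h6 : a₁ * (c * r) = c * a₁ * r := by ring
        have h7 : a₂ * (b * q) = b * a₂ * q := by ring
        have h8 : a₁ * a₂ = a₂ * a₁ := mul_comm _ _
        omega
    · have := reg.corner hq'.ge
      omega

/-- A degree bound for the polynomials `mutationPoly`. -/
noncomputable def mutationBound (b c a₁ a₂ : ℕ) : ℕ :=
  (Finset.range (a₂ + 1)).sup (fun p => (mutationPoly b c a₁ a₂ p).natDegree) + 1

theorem natDegree_mutationPoly_lt (h : p < a₂ + 1) :
    (mutationPoly b c a₁ a₂ p).natDegree < mutationBound b c a₁ a₂ :=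
  Nat.lt_succ_of_le (Finset.le_sup (f := fun p => (mutationPoly b c a₁ a₂ p).natDegree)
    (Finset.mem_range.2 h))

/-- The mutation of the expansion of a greedy element. -/
noncomputable def mutation (b c a₁ a₂ a₃ : ℕ) : ℤ × ℤ →₀ ℤ :=
  latticeExpansion c b a₂ a₃ (a₂ + 1) (mutationBound b c a₁ a₂) fun p r =>
    (mutationPoly b c a₁ a₂ p).coeff r

theorem mutation_apply {a₃ : ℕ} (hc : 0 < c) (hb : 0 < b) (p r : ℕ) :
    mutation b c a₁ a₂ a₃ (c * r - a₂, b * p - a₃) = (mutationPoly b c a₁ a₂ p).coeff r := by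
  refine latticeExpansion_apply hc hb (fun p r hne => ?_) p r
  obtain ⟨q, s, hpq, -⟩ := exists_localCount_of_mutationPoly hne
  exact ⟨by omega, (le_natDegree_of_ne_zero hne).trans_lt (natDegree_mutationPoly_lt (by omega))⟩

/-- Substituting yw = 1 + z^c exchanges y^(bq - a₁)(1 + z^c)^(a₁ - bq) for w^(a₁ - bq)(1 + z^c)^(bq
- a₁), with truncated exponents of 1 + z^c. The local polynomial is untouched. -/
theorem evalHom_mutation (hb : 0 < b) (h₁ : 0 < a₁) (h₂ : 0 < a₂) {a₃ : ℕ}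
    (h : a₁ + a₃ = b * a₂) (hy : y ≠ 0) (hz : z ≠ 0) (hw : w ≠ 0) (hyw : y * w = 1 + z ^ c) :
    evalHom z w (mutation b c a₁ a₂ a₃) = evalHom y z (greedyExpansion b c a₁ a₂) := by
  rw [mutation, evalHom_latticeExpansion_columns hz _ (fun _ _ => rfl)
    (fun _ => natDegree_mutationPoly_lt), evalHom_greedyExpansion_rows hz,
    ← Finset.sum_range_reflect]
  refine Finset.sum_congr rfl fun q hq => ?_
  rw [Finset.mem_range] at hq
  have hq' : a₂ - (a₂ + 1 - 1 - q) = q := by omega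
  rw [mutationPoly, if_pos (by omega), hq', rowPoly_eq hb h₁ h₂]
  simp only [map_mul, map_pow, map_add, map_one, aeval_X]
  rw [← hyw, show (b : ℤ) * ((a₂ + 1 - 1 - q : ℕ) : ℤ) - a₃ = a₁ - b * q by
    rw [show a₂ + 1 - 1 - q = a₂ - q by omega, Nat.cast_sub (by omega)]
    zify at h
    linarith]
  suffices w ^ (a₁ - b * q : ℤ) * (y * w) ^ (b * q - a₁) =
      y ^ (b * q - a₁ : ℤ) * (y * w) ^ (a₁ - b * q) by
    linear_combination (z ^ (-a₂ : ℤ) * aeval (z ^ c) (localPoly b c a₁ a₂ q)) * this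
  rcases le_total a₁ (b * q) with hle | hle
  · obtain ⟨m, hm⟩ := Nat.exists_eq_add_of_le hle
    rw [show (a₁ : ℤ) - b * q = -m by zify at hm; omega,
      show (b * q : ℤ) - a₁ = m by zify at hm; omega, show b * q - a₁ = m by omega,
      show a₁ - b * q = 0 by omega, zpow_neg, zpow_natCast, zpow_natCast, mul_pow]
    field_simp
  · obtain ⟨m, hm⟩ := Nat.exists_eq_add_of_le hle
    rw [show (a₁ : ℤ) - b * q = m by zify at hm; omega,
      show (b * q : ℤ) - a₁ = -m by zify at hm; omega, show b * q - a₁ = 0 by omega,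
      show a₁ - b * q = m by omega, zpow_neg, zpow_natCast, zpow_natCast, mul_pow]
    field_simp
    rw [mul_pow, mul_comm]

/-- Both sides satisfy the divisibility conditions in the cluster {x₂, x₃}, the left because it
evaluates to an element of the cluster algebra. Both are supported in the region of the new type and
have corner coefficient 1, so uniqueness applies to their difference. -/
theorem mutation_eq (hb : 0 < b) (hc : 0 < c) (h₁ : 0 < a₁) (h₂ : 0 < a₂) {a₃ : ℕ}
    (h : a₁ + a₃ = b * a₂) (h₃ : 0 < a₃) :
    mutation b c a₁ a₂ a₃ = greedyExpansion c b a₂ a₃ := by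
  have n1 : x₁ ≠ 0 := base_ne_zero.1
  have n2 : x₂ ≠ 0 := base_ne_zero.2
  have n3 := clusterVar_ne_zero hb hc 3
  have hinj : Function.Injective (evalHom x₂ (clusterVar b c 3)) :=
    evalHom_clusterVar_injective hb hc 2
  have hrel : x₁ * clusterVar b c 3 = 1 + x₂ ^ c := by
    have := clusterVar_mul hb hc 2
    rwa [exchangeExp, if_neg (by decide)] at this
  have e := evalHom_mutation (c := c) hb h₁ h₂ h n1 n2 n3 hrel
  have hA := evalHom_greedyExpansion_mem_clusterAlgebra hb hc h₁ h₂
  rw [← e] at hA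
  have m1 : evalHom x₂ (clusterVar b c 3) (mutation b c a₁ a₂ a₃) ∈
      semiLaurent b x₂ (clusterVar b c 3) := by
    have := clusterAlgebra_le_semiLaurent hb hc 2 hA
    rwa [exchangeExp, if_pos (by decide)] at this
  have m2 : evalHom x₂ (clusterVar b c 3) (mutation b c a₁ a₂ a₃) ∈
      semiLaurent c (clusterVar b c 3) x₂ := by
    have := clusterAlgebra_le_semiLaurent' hb hc 2 hA
    rwa [exchangeExp, if_neg (by decide)] at this
  have m3 := evalHom_greedyExpansion_mem (b := c) (c := b) (y := x₂) hc h₂ h₃ n3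
  have m4 := evalHom_greedyExpansion_mem' (b := c) (c := b) (z := clusterVar b c 3) hb h₂ h₃ n2
  have hcorner : (mutationPoly b c a₁ a₂ 0).coeff 0 = 1 := by
    have e1 : (rowPoly b c a₁ a₂ a₂).coeff 0 = 1 := by
      rw [coeff_rowPoly, pairCount_zero_left, Nat.choose_self, Nat.cast_one]
    rw [rowPoly_eq hb h₁ h₂, show a₁ - b * a₂ = 0 by omega, pow_zero, one_mul] at e1
    rw [mutationPoly, if_pos (Nat.zero_le _), Nat.sub_zero, mul_coeff_zero, e1, mul_one,
      coeff_one_add_X_pow, Nat.choose_zero_right, Nat.cast_one]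
  rw [← sub_eq_zero]
  refine eq_zero_of_greedyRegion hc hb h₂ h₃ (rowDivisible_of_mem n2 n3 hinj ?_)
    (rowDivisible_swapVars_of_mem n2 n3 hinj ?_) ?_ ?_
  · rw [map_sub]; exact sub_mem m1 m3
  · rw [map_sub]; exact sub_mem m2 m4
  · intro i j hij
    rw [Finsupp.sub_apply] at hij
    by_cases hg : greedyExpansion c b a₂ a₃ (i, j) = 0
    · rw [hg, sub_zero] at hij
      obtain ⟨p, r, rfl, rfl⟩ := exists_of_latticeExpansion_ne_zero hij
      rw [mutation_apply hc hb] at hij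
      exact ⟨p, r, rfl, rfl, greedyRegion_of_mutationPoly hb hc h₁ h₂ h h₃ hij⟩
    · obtain ⟨p, r, rfl, rfl, hne⟩ := exists_of_greedyExpansion_ne_zero hc hb hg
      exact ⟨p, r, rfl, rfl, greedyRegion_of_pairCount_ne_zero hc hb h₂ h₃ hne⟩
  · have e1 := mutation_apply (a₁ := a₁) (a₂ := a₂) (a₃ := a₃) hc hb 0 0
    have e2 := greedyExpansion_apply (a₁ := a₂) (a₂ := a₃) hc hb 0 0
    rw [pairCount_zero_left, Nat.choose_zero_right] at e2
    simp only [Nat.cast_zero, mul_zero, zero_sub] at e1 e2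
    rw [Finsupp.sub_apply, e1, e2, hcorner, Nat.cast_one, sub_self]

/-- Mutation of greedy elements. -/
theorem evalHom_greedyExpansion_succ (hb : 0 < b) (hc : 0 < c) (h₁ : 0 < a₁) (h₂ : 0 < a₂) {a₃ : ℕ}
    (h : a₁ + a₃ = b * a₂) (h₃ : 0 < a₃) (hy : y ≠ 0) (hz : z ≠ 0) (hw : w ≠ 0)
    (hyw : y * w = 1 + z ^ c) :
    evalHom y z (greedyExpansion b c a₁ a₂) = evalHom z w (greedyExpansion c b a₂ a₃) := by
  rw [← mutation_eq hb hc h₁ h₂ h h₃, evalHom_mutation hb h₁ h₂ h hy hz hw hyw]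

/-- A row with bq ≥ a₁ has no free edges, so its row polynomial is already local and reappears,
times a power of 1 + X, as the column a₂ - q of the mutated element. -/
theorem pairCount_mutation (hb : 0 < b) (hc : 0 < c) (h₁ : 0 < a₁) (h₂ : 0 < a₂) {a₃ : ℕ}
    (h : a₁ + a₃ = b * a₂) (h₃ : 0 < a₃) (hpq : p + q = a₂) (hq : a₁ ≤ b * q) (r : ℕ) :
    (pairCount c b a₂ a₃ p r : ℤ) =
      ((1 + X) ^ (b * q - a₁) * rowPoly b c a₁ a₂ q).coeff r := by
  have e1 := mutation_apply (a₁ := a₁) (a₂ := a₂) (a₃ := a₃) hc hb p r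
  rw [← greedyExpansion_apply hc hb, ← mutation_eq hb hc h₁ h₂ h h₃, e1, mutationPoly,
    if_pos (by omega), show a₂ - p = q by omega, rowPoly_eq hb h₁ h₂,
    show a₁ - b * q = 0 by omega, pow_zero, one_mul]

end

end RankTwoCluster

/-! ### Degenerate types and the greedy basis. -/

namespace RankTwoCluster

section
variable {b c n : ℕ}

theorem dyckPoint_zero_right (a₁ k : ℕ) : dyckPoint a₁ 0 k = (k, 0) := by
  induction k with
  | zero => rfl
  | succ k ih => simp [dyckPoint, ih]

theorem dyckPoint_zero_left {a₂ k : ℕ} (hk : k ≤ a₂) : dyckPoint 0 a₂ k = (0, k) := by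
  induction k with
  | zero => rfl
  | succ k ih => simp [dyckPoint, ih (by omega), Nat.lt_of_succ_le hk]

theorem compatiblePairs_zero_right (b c a₁ : ℕ) :
    compatiblePairs b c a₁ 0 = (Finset.range a₁).powerset ×ˢ {∅} := by
  have e1 : horizontalEdges a₁ 0 = Finset.range a₁ := by
    simp [horizontalEdges, dyckPoint_zero_right]
  have e2 : verticalEdges a₁ 0 = ∅ := by
    simp [verticalEdges, dyckPoint_zero_right]
  rw [compatiblePairs, e1, e2, Finset.powerset_empty]
  refine Finset.filter_true_of_mem fun S hS => ?_
  rw [Finset.mem_product, Finset.mem_singleton] at hS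
  intro u _ v hv
  rw [hS.2] at hv
  exact absurd hv (Finset.notMem_empty v)

theorem compatiblePairs_zero_left (b c a₂ : ℕ) :
    compatiblePairs b c 0 a₂ = {∅} ×ˢ (Finset.range a₂).powerset := by
  have key : ∀ k < 0 + a₂, dyckPoint 0 a₂ k = (0, k) ∧ dyckPoint 0 a₂ (k + 1) = (0, k + 1) :=
    fun k hk => ⟨dyckPoint_zero_left (by omega), dyckPoint_zero_left (by omega)⟩
  have e1 : horizontalEdges 0 a₂ = ∅ := by
    refine Finset.filter_false_of_mem fun k hk => ?_
    rw [(key k (Finset.mem_range.1 hk)).1, (key k (Finset.mem_range.1 hk)).2]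
    simp
  have e2 : verticalEdges 0 a₂ = Finset.range a₂ := by
    rw [verticalEdges, Finset.filter_true_of_mem fun k hk => ?_, zero_add]
    rw [(key k (Finset.mem_range.1 hk)).1, (key k (Finset.mem_range.1 hk)).2]
  rw [compatiblePairs, e1, e2, Finset.powerset_empty]
  refine Finset.filter_true_of_mem fun S hS => ?_
  rw [Finset.mem_product, Finset.mem_singleton] at hS
  intro u hu
  rw [hS.1] at hu
  exact absurd hu (Finset.notMem_empty u)

theorem sum_powerset_range {R : Type*} [CommSemiring R] (t : R) (n : ℕ) :
    ∑ S ∈ (Finset.range n).powerset, t ^ S.card = (1 + t) ^ n := by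
  have := Finset.sum_pow_mul_eq_add_pow t 1 (Finset.range n)
  simp only [one_pow, mul_one, Finset.card_range] at this
  rw [this, add_comm]

/-- The Laurent expansion of the greedy element `greedy b c a` in the initial cluster. -/
noncomputable def greedyLaurent (b c : ℕ) (a : ℤ × ℤ) : ℤ × ℤ →₀ ℤ :=
  if 0 < a.1 ∧ 0 < a.2 then greedyExpansion b c a.1.toNat a.2.toNat else standardExpansion b c a

theorem evalHom_greedyLaurent (hb : 0 < b) (hc : 0 < c) (a : ℤ × ℤ) :
    evalHom x₁ x₂ (greedyLaurent b c a) = greedy b c a := by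
  obtain ⟨n1, n2⟩ := base_ne_zero
  obtain ⟨a₁, a₂⟩ := a
  rw [greedyLaurent, greedy]
  split_ifs with h
  · have e := sum_compatiblePairs (a₁ := a₁.toNat) (a₂ := a₂.toNat) hb hc (by omega) (by omega)
      fun p q => x₁ ^ (b * q) * x₂ ^ (c * p)
    simp only at e ⊢ h
    rw [e, evalHom_greedyExpansion n1 n2, Int.toNat_of_nonneg h.1.le, Int.toNat_of_nonneg h.2.le]
  · rw [evalHom_standardExpansion n1 n2]
    simp only at h ⊢
    congr 1
    rcases le_or_gt a₂ 0 with h2 | h2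
    · rw [show a₂.toNat = 0 by omega, compatiblePairs_zero_right, Finset.sum_product]
      simp only [Finset.sum_singleton, Finset.card_empty, pow_zero, one_mul, pow_mul,
        sum_powerset_range]
    · rw [show a₁.toNat = 0 by omega, compatiblePairs_zero_left, Finset.sum_product]
      simp only [Finset.sum_singleton, Finset.card_empty, pow_zero, mul_one, pow_mul,
        sum_powerset_range]

theorem isPointed_greedyLaurent (hb : 0 < b) (hc : 0 < c) (a : ℤ × ℤ) :
    IsPointed b c a (greedyLaurent b c a) := by
  obtain ⟨a₁, a₂⟩ := a
  rw [greedyLaurent]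
  split_ifs with h
  · simp only at h ⊢
    obtain ⟨m₁, rfl⟩ := Int.eq_ofNat_of_zero_le h.1.le
    obtain ⟨m₂, rfl⟩ := Int.eq_ofNat_of_zero_le h.2.le
    simp only [Int.toNat_natCast]
    refine ⟨?_, fun i j hij => ?_⟩
    · have := greedyExpansion_apply (a₁ := m₁) (a₂ := m₂) hb hc 0 0
      rw [pairCount_zero_left, Nat.choose_zero_right] at this
      simpa using this
    · obtain ⟨p, q, rfl, rfl, hne⟩ := exists_of_greedyExpansion_ne_zero hb hc hij
      obtain ⟨hp, hq⟩ := le_of_pairCount_ne_zero hne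
      have h1 : b * q ≤ b * m₂ := Nat.mul_le_mul_left _ hq
      have h2 : c * p ≤ c * m₁ := Nat.mul_le_mul_left _ hp
      zify at h1 h2
      have h3 : (0 : ℤ) ≤ b * q := by positivity
      have h4 : (0 : ℤ) ≤ c * p := by positivity
      simp only [max_eq_left h.1.le, max_eq_left h.2.le]
      omega
  · exact isPointed_standardExpansion hb hc _

theorem greedy_mem (hb : 0 < b) (hc : 0 < c) (a : ℤ × ℤ) : greedy b c a ∈ clusterAlgebra b c := by
  rw [← evalHom_greedyLaurent hb hc, greedyLaurent]
  split_ifs with h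
  · exact evalHom_greedyExpansion_mem_clusterAlgebra hb hc (by omega) (by omega)
  · exact standard_mem b c hb hc a

theorem exists_greedy_basis (hb : 0 < b) (hc : 0 < c) :
    ∃ B : Module.Basis (ℤ × ℤ) ℤ (clusterAlgebra b c),
      ∀ a, (B a : AmbientField) = greedy b c a :=
  exists_basis_of_pointed hb hc (greedy_mem hb hc) fun a =>
    ⟨_, evalHom_greedyLaurent hb hc a, isPointed_greedyLaurent hb hc a⟩

theorem greedy_eq (hb : 0 < b) (hc : 0 < c) {a₁ a₂ : ℕ} (h₁ : 0 < a₁) (h₂ : 0 < a₂) :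
    greedy b c (a₁, a₂) = evalHom x₁ x₂ (greedyExpansion b c a₁ a₂) := by
  rw [← evalHom_greedyLaurent hb hc, greedyLaurent, if_pos (by simp [h₁, h₂])]
  rfl

end

end RankTwoCluster

/-! ### Domination of coefficients along the recursion. -/

namespace RankTwoCluster

open Polynomial

theorem coeff_mul_nonneg {f g : ℤ[X]} (hf : ∀ p, 0 ≤ f.coeff p) (hg : ∀ p, 0 ≤ g.coeff p) (p : ℕ) :
    0 ≤ (f * g).coeff p := by
  rw [coeff_mul]
  exact Finset.sum_nonneg fun x _ => mul_nonneg (hf _) (hg _)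

theorem coeff_mul_le_coeff_mul_shift {f g u : ℤ[X]} {k : ℕ} (hu : ∀ p, 0 ≤ u.coeff p)
    (hg : ∀ p, 0 ≤ g.coeff p) (hfg : ∀ p, f.coeff p ≤ g.coeff (p + k)) (p : ℕ) :
    (u * f).coeff p ≤ (u * g).coeff (p + k) := by
  have h : ∀ p, 0 ≤ (g - X ^ k * f).coeff p := by
    intro p
    rw [coeff_sub, coeff_X_pow_mul']
    split_ifs with hp
    · have := hfg (p - k)
      rw [Nat.sub_add_cancel hp] at this
      linarith
    · rw [sub_zero]; exact hg p
  have := coeff_mul_nonneg hu h (p + k)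
  rw [mul_sub, coeff_sub, show u * (X ^ k * f) = X ^ k * (u * f) by ring, coeff_X_pow_mul] at this
  linarith

section
variable {b c e n h k D : ℕ}

/-- The sequence read backwards, with b and c exchanged, is again a state. This serves the clusters
on the left and, together with reflection, the column p = 0. -/
theorem RecState.reverse (s : RecState b c e n h k D) : RecState c b k h n e D where
  b_pos := s.c_pos
  c_pos := s.b_pos
  e_pos := s.k_pos
  n_pos := s.h_pos
  h_pos := s.n_pos
  D_pos := s.D_pos
  sum := by rw [add_comm]; exact s.sum'
  sum' := by rw [add_comm]; exact s.sum
  disc := by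
    have h1 : (e : ℤ) + h = c * n := by exact_mod_cast s.sum
    have h2 : (n : ℤ) + k = b * h := by exact_mod_cast s.sum'
    have h3 : (b : ℤ) * e * h = c * n ^ 2 + D := by exact_mod_cast s.disc
    have : (c : ℤ) * k * n = b * h ^ 2 + D := by linear_combination c * n * h2 + h3 - b * h * h1
    exact_mod_cast this
  D_le := by rw [mul_comm]; exact s.D_le
  coprime := s.next.coprime'.symm

theorem RecState.le_mul (s : RecState b c e n h k D) : n ≤ b * e := by
  have h3 := s.disc
  have h1 := s.sum
  have hh := s.h_pos
  by_contra hcon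
  have h4 : b * e * h ≤ n * h := Nat.mul_le_mul_right _ (by omega)
  have h5 : n * h ≤ n * (c * n) := Nat.mul_le_mul_left _ (by omega)
  have h6 : n * (c * n) = c * n ^ 2 := by ring
  have := s.D_pos
  omega

/-- The columns `p` with `c p < h` of the greedy element of type `(n, h)` are dominated. -/
def ColumnDominated (b c n h k : ℕ) : Prop :=
  ∀ p q, c * p < h →
    pairCount b c n h p q ≤ pairCount b c (n + b * h) (h + c * k) (p + k) (q + h)

/-- A column p of the new type with bp < k is the mutation of the old row q = h - p, for which bq >
n. The support of that row has ci < h, so its coefficients are dominated already, and both rows are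
multiplied by the same power (1 + X)^(bq - n), which preserves domination. -/
theorem ColumnDominated.next (s : RecState b c e n h k D) (H : ColumnDominated b c n h k) :
    ColumnDominated c b h k (c * k - h) := by
  intro p r hp
  have s' := s.next
  have hle : h ≤ c * k := by have := s'.sum'; omega
  have hsum := s.sum'
  by_cases hne : pairCount c b h k p r = 0
  · rw [hne]; exact Nat.zero_le _
  obtain ⟨q, hq⟩ := Nat.exists_eq_add_of_le (le_of_pairCount_ne_zero hne).1
  have hbq : b * h = b * p + b * q := by rw [← mul_add, ← hq]
  have hB₁ : 0 < n + b * h := by have := s.n_pos; omega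
  have hB₂ : 0 < h + c * k := by have := s.h_pos; omega
  have hB₃ : 0 < k + b * (c * k - h) := by have := s.k_pos; omega
  have hB : n + b * h + (k + b * (c * k - h)) = b * (h + c * k) := by
    obtain ⟨t, ht⟩ := Nat.exists_eq_add_of_le hle
    rw [ht, Nat.add_sub_cancel_left]
    rw [show n + b * h + (k + b * t) = n + k + b * h + b * t by ring, hsum]
    ring
  have e1 := pairCount_mutation s.b_pos s.c_pos s.n_pos s.h_pos hsum s.k_pos hq.symm
    (by omega) r
  have e2 := pairCount_mutation (p := p + (c * k - h)) (q := q + h) s.b_pos s.c_pos hB₁ hB₂ hB hB₃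
    (by omega) (by rw [mul_add]; omega) (r + k)
  rw [show b * (q + h) - (n + b * h) = b * q - n by rw [mul_add]; omega] at e2
  zify
  rw [e1, e2]
  refine coeff_mul_le_coeff_mul_shift (fun i => ?_) (fun i => ?_) (fun i => ?_) r
  · rw [coeff_one_add_X_pow]; positivity
  · rw [coeff_rowPoly]; positivity
  · rw [coeff_rowPoly, coeff_rowPoly]
    by_cases hne' : pairCount b c n h i q = 0
    · rw [hne']; positivity
    have := (greedyRegion_of_pairCount_ne_zero s.b_pos s.c_pos s.n_pos s.h_pos hne').corner
      (by omega)
    exact_mod_cast H i q this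

/-- The quantities controlling the part of the greedy element of type `(n, h)` outside the
dominated columns. -/
def Controlled (b c e n h k D : ℕ) : Prop :=
  (b * e ≤ 2 * n ∧ RecState.Gap b c e n h D) ∨
    n ≤ b ∧ ((c * n ≤ 2 * h ∧ RecState.Gap c b n h k D) ∨
      h ≤ c ∧ b * h ≤ 2 * k ∧ RecState.Gap b c h k (c * k - h) D)

/-- While n ≤ b there is no row with 0 < q and bq < n. The ratio and gap conditions need only hold
from some state at most two steps ahead, and they persist from then on. -/
theorem Controlled.next (s : RecState b c e n h k D) (H : Controlled b c e n h k D) :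
    Controlled c b n h k (c * k - h) D := by
  rcases H with ⟨h1, h2⟩ | ⟨-, h1 | ⟨h1, h2⟩⟩
  · exact Or.inl ⟨s.two_mul_next h1, h2.next s⟩
  · exact Or.inl h1
  · exact Or.inr ⟨h1, Or.inl h2⟩

/-- Outside the dominated columns the support lies in rows with bq < n. Row 0 is binomial and is
bounded by the first larger element; the other rows are transplanted into the second. -/
theorem pairCount_le_add (s : RecState b c e n h k D) (H : ColumnDominated b c n h k)
    (H' : Controlled b c e n h k D) (p q : ℕ) :
    pairCount b c n h p q ≤ pairCount b c (n + b * e) (h + c * n) (p + n) (q + e) +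
      pairCount b c (n + b * h) (h + c * k) (p + k) (q + h) := by
  by_cases hne : pairCount b c n h p q = 0
  · rw [hne]; exact Nat.zero_le _
  have reg := greedyRegion_of_pairCount_ne_zero s.b_pos s.c_pos s.n_pos s.h_pos hne
  rcases lt_or_ge (c * p) h with hp | hp
  · exact (H p q hp).trans (Nat.le_add_left _ _)
  have hq : b * q < n := by
    by_contra hcon
    have := reg.corner (not_lt.1 hcon)
    omega
  rcases Nat.eq_zero_or_pos q with rfl | hq0
  · refine le_trans ?_ (Nat.le_add_right _ _)
    rw [pairCount_zero_right s.n_pos s.h_pos, zero_add]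
    exact choose_le_pairCount s.b_pos s.n_pos s.h_pos s.sum s.disc s.le_mul
      (by have := s.sum'; omega) s.D_pos p
  · rcases H' with ⟨h1, h2⟩ | ⟨h1, -⟩
    · exact (pairCount_le_of_lt s h1 h2 hq0 hq p).trans (Nat.le_add_left _ _)
    · have := Nat.le_mul_of_pos_right b hq0
      omega

/-- The Laurent expansion of the difference of two greedy elements and a third one. -/
noncomputable def differenceExpansion (b c e n h k : ℕ) : ℤ × ℤ →₀ ℤ :=
  greedyExpansion b c (n + b * e) (h + c * n) + greedyExpansion b c (n + b * h) (h + c * k) -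
    greedyExpansion b c n h

theorem differenceExpansion_nonneg (s : RecState b c e n h k D) (H : ColumnDominated b c n h k)
    (H' : Controlled b c e n h k D) (i : ℤ × ℤ) : 0 ≤ differenceExpansion b c e n h k i := by
  obtain ⟨i, j⟩ := i
  have hb := s.b_pos
  have hc := s.c_pos
  have hpos : ∀ a₁ a₂, 0 ≤ greedyExpansion b c a₁ a₂ (i, j) := by
    intro a₁ a₂
    by_cases h0 : greedyExpansion b c a₁ a₂ (i, j) = 0
    · rw [h0]
    · obtain ⟨p, q, rfl, rfl, -⟩ := exists_of_greedyExpansion_ne_zero hb hc h0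
      rw [greedyExpansion_apply hb hc]
      positivity
  rw [differenceExpansion, Finsupp.sub_apply, Finsupp.add_apply]
  by_cases h0 : greedyExpansion b c n h (i, j) = 0
  · rw [h0, sub_zero]
    exact add_nonneg (hpos _ _) (hpos _ _)
  · obtain ⟨p, q, rfl, rfl, -⟩ := exists_of_greedyExpansion_ne_zero hb hc h0
    have e1 := greedyExpansion_apply (a₁ := n + b * e) (a₂ := h + c * n) hb hc (p + n) (q + e)
    have e2 := greedyExpansion_apply (a₁ := n + b * h) (a₂ := h + c * k) hb hc (p + k) (q + h)
    push_cast at e1 e2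
    rw [show (b * (q + e) - (n + b * e) : ℤ) = b * q - n by ring,
      show (c * (p + n) - (h + c * n) : ℤ) = c * p - h by ring] at e1
    rw [show (b * (q + h) - (n + b * h) : ℤ) = b * q - n by ring,
      show (c * (p + k) - (h + c * k) : ℤ) = c * p - h by ring] at e2
    rw [e1, e2, greedyExpansion_apply hb hc, sub_nonneg]
    exact_mod_cast pairCount_le_add s H H' p q

/-- The element `x` has an expansion in `y` and `z` as a difference of greedy elements with the
domination properties. -/
def HasDominatedExpansion (b c : ℕ) (y z x : AmbientField) : Prop :=
  ∃ e n h k D, RecState b c e n h k D ∧ ColumnDominated b c n h k ∧ Controlled b c e n h k D ∧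
    evalHom y z (differenceExpansion b c e n h k) = x

theorem HasDominatedExpansion.next {y z w x : AmbientField} (H : HasDominatedExpansion b c y z x)
    (hy : y ≠ 0) (hz : z ≠ 0) (hw : w ≠ 0) (hyw : y * w = 1 + z ^ c) :
    HasDominatedExpansion c b z w x := by
  obtain ⟨e, n, h, k, D, s, h1, h2, rfl⟩ := H
  refine ⟨n, h, k, c * k - h, D, s.next, h1.next s, h2.next s, ?_⟩
  have hsum := s.sum
  have hsum' := s.sum'
  have hsum'' := s.next.sum'
  have hn := s.n_pos
  have hh := s.h_pos
  have hk := s.k_pos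
  -- The types of the larger elements mutate to (h + cn, k + bh) and (h + ck, k + b(ck - h)), which
  -- are those of the shifted state.
  have eA : n + b * e + (k + b * h) = b * (h + c * n) := by
    rw [show n + b * e + (k + b * h) = n + k + b * (e + h) by ring, hsum, hsum']
    ring
  have eB : n + b * h + (k + b * (c * k - h)) = b * (h + c * k) := by
    rw [show n + b * h + (k + b * (c * k - h)) = n + k + b * (h + (c * k - h)) by ring, hsum'', hsum']
    ring
  rw [differenceExpansion, differenceExpansion, map_sub, map_add, map_sub, map_add,
    evalHom_greedyExpansion_succ s.b_pos s.c_pos (by omega) (by omega) eA (by omega) hy hz hw hyw,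
    evalHom_greedyExpansion_succ s.b_pos s.c_pos (by omega) (by omega) eB (by omega) hy hz hw hyw,
    evalHom_greedyExpansion_succ s.b_pos s.c_pos hn hh hsum' hk hy hz hw hyw]

theorem HasDominatedExpansion.exists_nonneg {y z x : AmbientField}
    (H : HasDominatedExpansion b c y z x) : ∃ f, evalHom y z f = x ∧ ∀ i, 0 ≤ f i := by
  obtain ⟨e, n, h, k, D, s, h1, h2, h3⟩ := H
  exact ⟨_, h3, differenceExpansion_nonneg s h1 h2⟩

/-- An initial state of the recursion. -/
structure InitialState (b c e n h k D : ℕ) : Prop extends RecState b c e n h k D where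
  n_le : n ≤ b
  h_le : h ≤ c
  two_mul_n_le : 2 * n ≤ b * h
  eq_one : e = 1 ∨ n = 1

/-- Since h ≤ c, only the column p = 0 is concerned. It is binomial, and the explicit local pair for
the reversed state, reflected, dominates it. -/
theorem InitialState.columnDominated (s : InitialState b c e n h k D) :
    ColumnDominated b c n h k := by
  intro p q hp
  obtain rfl : p = 0 := by
    by_contra hp0
    have := Nat.le_mul_of_pos_right c (Nat.pos_of_ne_zero hp0)
    have := s.h_le
    omega
  have r := s.toRecState.reverse
  have hn := s.n_pos
  have hh := s.h_pos
  have := choose_le_pairCount r.b_pos r.n_pos r.h_pos r.sum r.disc r.le_mul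
    (by have := r.sum'; omega) r.D_pos q
  rwa [pairCount_zero_left, zero_add, pairCount_reflect (by omega) (by omega)]

/-- The bounds n ≤ b and h ≤ c dispose of the first two states. The gap property of the third is
inherited from a state whose first term is 1, where it is trivial. -/
theorem InitialState.controlled (s : InitialState b c e n h k D) : Controlled b c e n h k D := by
  refine Or.inr ⟨s.n_le, Or.inr ⟨s.h_le, ?_, ?_⟩⟩
  · have := s.sum'
    have := s.two_mul_n_le
    omega
  · rcases s.eq_one with rfl | rfl
    · exact ((RecState.gap_of_eq_one _ _ _ _ _).next s.toRecState).next s.next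
    · exact (RecState.gap_of_eq_one _ _ _ _ _).next s.next

theorem InitialState.hasDominatedExpansion (s : InitialState b c e n h k D) (y z : AmbientField) :
    HasDominatedExpansion b c y z (evalHom y z (differenceExpansion b c e n h k)) :=
  ⟨e, n, h, k, D, s.toRecState, s.columnDominated, s.controlled, rfl⟩

theorem evalHom_differenceExpansion_swap (s : RecState b c e n h k D) (y z : AmbientField) :
    evalHom z y (differenceExpansion c b k h n e) = evalHom y z (differenceExpansion b c e n h k) := by
  have hn := s.n_pos
  have hh := s.h_pos
  simp only [differenceExpansion, map_sub, map_add]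
  rw [← swapVars_greedyExpansion hn hh, ← swapVars_greedyExpansion (b := b) (c := c)
    (a₁ := n + b * h) (by omega) (by omega), ← swapVars_greedyExpansion (b := b) (c := c)
    (a₁ := n + b * e) (by omega) (by omega), evalHom_swapVars, evalHom_swapVars, evalHom_swapVars]
  ring

/-- The quadruples (e, n, h, k) are (c-1, 1, 1, b-1) with D = (b-1)(c-1) - 1, then (1, 2, 1, b-2)
with D = b - 4 if c = 1, and (c-2, 1, 2, 1) with D = c - 4 if b = 1. -/
theorem exists_initialState (hb : 0 < b) (hc : 0 < c) (hbc : 4 < b * c) :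
    ∃ e n h k D, InitialState b c e n h k D ∧ InitialState c b k h n e D ∧
      explicitElement b c = greedy b c ((n + b * e : ℕ), (h + c * n : ℕ)) +
        greedy b c ((n + b * h : ℕ), (h + c * k : ℕ)) - greedy b c ((n : ℕ), (h : ℕ)) := by
  have build : ∀ {e n h k D : ℕ}, RecState b c e n h k D → n ≤ b → h ≤ c → 2 * n ≤ b * h →
      2 * h ≤ c * n → (e = 1 ∨ n = 1) → (k = 1 ∨ h = 1) →
      InitialState b c e n h k D ∧ InitialState c b k h n e D := fun s h1 h2 h3 h4 h5 h6 =>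
    ⟨⟨s, h1, h2, h3, h5⟩, ⟨s.reverse, h2, h1, h4, h6⟩⟩
  by_cases hmin : 1 < min b c
  · obtain ⟨hb2, hc2⟩ := lt_min_iff.1 hmin
    obtain ⟨b', rfl⟩ := Nat.exists_eq_add_of_le' hb
    obtain ⟨c', rfl⟩ := Nat.exists_eq_add_of_le' hc
    have hbc' : 1 < b' * c' := by
      by_contra hcon
      have h1 : b' ≤ b' * c' := Nat.le_mul_of_pos_right _ (by omega)
      have h2 : c' ≤ b' * c' := Nat.le_mul_of_pos_left _ (by omega)
      obtain rfl : b' = 1 := by omega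
      obtain rfl : c' = 1 := by omega
      omega
    have s : RecState (b' + 1) (c' + 1) c' 1 1 b' (b' * c' - 1) :=
      { b_pos := by omega
        c_pos := by omega
        e_pos := by omega
        n_pos := one_pos
        h_pos := one_pos
        D_pos := by omega
        sum := by ring
        sum' := by ring
        disc := by
          obtain ⟨t, ht⟩ := Nat.exists_eq_add_of_le hbc'.le
          rw [add_mul, ht]
          simp only [Nat.add_sub_cancel_left]
          ring
        D_le := by
          rw [show (b' + 1) * (c' + 1) = b' * c' + b' + c' + 1 by ring]
          omega
        coprime := Nat.coprime_one_right _ }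
    obtain ⟨s₁, s₂⟩ := build s (by omega) (by omega) (by omega) (by omega) (Or.inr rfl) (Or.inr rfl)
    refine ⟨_, _, _, _, _, s₁, s₂, ?_⟩
    rw [explicitElement, if_pos hmin]
    congr 3 <;> push_cast <;> rw [Prod.mk.injEq] <;> constructor <;> ring
  · rw [explicitElement, if_neg hmin]
    have hmin' : b = 1 ∨ c = 1 := by
      rw [lt_min_iff] at hmin
      omega
    by_cases hc1 : c = 1
    · subst hc1
      rw [mul_one] at hbc
      obtain ⟨t, rfl⟩ := Nat.exists_eq_add_of_le' hbc
      have s : RecState (t + 4 + 1) 1 1 2 1 (t + 3) (t + 1) :=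
        { b_pos := by omega
          c_pos := by omega
          e_pos := by omega
          n_pos := by omega
          h_pos := one_pos
          D_pos := by omega
          sum := by omega
          sum' := by omega
          disc := by ring
          D_le := by omega
          coprime := Nat.coprime_one_left _ }
      obtain ⟨s₁, s₂⟩ := build s (by omega) (by omega) (by omega) (by omega) (Or.inl rfl)
        (Or.inr rfl)
      refine ⟨_, _, _, _, _, s₁, s₂, ?_⟩
      rw [if_pos rfl]
      congr 3 <;> push_cast <;> rw [Prod.mk.injEq] <;> constructor <;> ring
    · obtain rfl : b = 1 := by omega
      rw [one_mul] at hbc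
      obtain ⟨t, rfl⟩ := Nat.exists_eq_add_of_le' hbc
      have s : RecState 1 (t + 4 + 1) (t + 3) 1 2 1 (t + 1) :=
        { b_pos := by omega
          c_pos := by omega
          e_pos := by omega
          n_pos := by omega
          h_pos := by omega
          D_pos := by omega
          sum := by omega
          sum' := by omega
          disc := by ring
          D_le := by omega
          coprime := Nat.coprime_one_right _ }
      obtain ⟨s₁, s₂⟩ := build s (by omega) (by omega) (by omega) (by omega) (Or.inr rfl)
        (Or.inl rfl)
      refine ⟨_, _, _, _, _, s₁, s₂, ?_⟩
      -- For b = 1 the recursion lists the two larger elements in the opposite order.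
      rw [if_neg hc1, add_comm (greedy 1 (t + 4 + 1) _)]
      congr 3 <;> push_cast <;> rw [Prod.mk.injEq] <;> constructor <;> ring

end

end RankTwoCluster

/-! ### Positivity in all clusters and the negative coefficient. -/

namespace RankTwoCluster

section
variable {b c e n h k D : ℕ}

theorem hasDominatedExpansion_of_one_le (hb : 0 < b) (hc : 0 < c) (s : InitialState b c e n h k D)
    {m : ℤ} (hm : 1 ≤ m) :
    HasDominatedExpansion (exchangeExp b c m) (exchangeExp b c (m + 1)) (clusterVar b c m)
      (clusterVar b c (m + 1)) (evalHom x₁ x₂ (differenceExpansion b c e n h k)) := by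
  induction m, hm using Int.leInduction with
  | base => exact s.hasDominatedExpansion x₁ x₂
  | succ m hm ih =>
    have hrel := clusterVar_mul hb hc (m + 1)
    rw [add_sub_cancel_right] at hrel
    have := ih.next (clusterVar_ne_zero hb hc _) (clusterVar_ne_zero hb hc _)
      (clusterVar_ne_zero hb hc _) hrel
    rwa [show m + 1 + 1 = m + 2 by ring, exchangeExp_add_two, ← show m + 1 + 1 = m + 2 by ring]

theorem hasDominatedExpansion_of_le_one (hb : 0 < b) (hc : 0 < c) (s : InitialState c b k h n e D)
    {m : ℤ} (hm : m ≤ 1) :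
    HasDominatedExpansion (exchangeExp b c (m + 1)) (exchangeExp b c m) (clusterVar b c (m + 1))
      (clusterVar b c m) (evalHom x₂ x₁ (differenceExpansion c b k h n e)) := by
  induction m, hm using Int.leInductionDown with
  | base => exact s.hasDominatedExpansion x₂ x₁
  | pred m hm ih =>
    have hrel := clusterVar_mul hb hc m
    rw [mul_comm] at hrel
    have := ih.next (clusterVar_ne_zero hb hc _) (clusterVar_ne_zero hb hc _)
      (clusterVar_ne_zero hb hc _) hrel
    have e := exchangeExp_add_two (b := b) (c := c) (m - 1)
    rw [show m - 1 + 2 = m + 1 by ring] at e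
    rwa [sub_add_cancel, ← e]

/-- The two larger indices exceed n in the first entry, by be and bh, so nothing cancels the -1 at
(n, h). -/
theorem repr_neg (hb : 0 < b) (s : RecState b c e n h k D)
    (B : Module.Basis (ℤ × ℤ) ℤ (clusterAlgebra b c))
    (hB : ∀ a, (B a : AmbientField) = greedy b c a) {x : clusterAlgebra b c}
    (hx : (x : AmbientField) = greedy b c ((n + b * e : ℕ), (h + c * n : ℕ)) +
      greedy b c ((n + b * h : ℕ), (h + c * k : ℕ)) - greedy b c ((n : ℕ), (h : ℕ))) :
    B.repr x ((n : ℕ), (h : ℕ)) < 0 := by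
  have hx' : x = B ((n + b * e : ℕ), (h + c * n : ℕ)) + B ((n + b * h : ℕ), (h + c * k : ℕ)) -
      B ((n : ℕ), (h : ℕ)) := by
    apply Subtype.ext
    push_cast [hB]
    rw [hx]
    push_cast
    rfl
  have hne : ∀ i t : ℕ, 0 < t → (((n + b * t : ℕ) : ℤ), (i : ℤ)) ≠ ((n : ℤ), (h : ℤ)) := by
    intro i t ht hcon
    have := (Prod.mk.inj hcon).1
    have := Nat.mul_pos hb ht
    omega
  rw [hx', map_sub, map_add, Module.Basis.repr_self, Module.Basis.repr_self,
    Module.Basis.repr_self, Finsupp.sub_apply, Finsupp.add_apply, Finsupp.single_eq_same,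
    Finsupp.single_eq_of_ne (hne _ _ s.e_pos).symm, Finsupp.single_eq_of_ne (hne _ _ s.h_pos).symm]
  norm_num

end

theorem isPositive_explicitElement_and_exists_basis {b c : ℕ} (hb : 0 < b) (hc : 0 < c)
    (hbc : 4 < b * c) : IsPositive b c (explicitElement b c) ∧
    ∃ (B : Module.Basis (ℤ × ℤ) ℤ (clusterAlgebra b c))
      (hp : explicitElement b c ∈ clusterAlgebra b c),
      (∀ a : ℤ × ℤ, (B a : AmbientField) = greedy b c a) ∧
      ∃ a : ℤ × ℤ, B.repr ⟨explicitElement b c, hp⟩ a < 0 := by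
  obtain ⟨e, n, h, k, D, s₁, s₂, hx⟩ := exists_initialState hb hc hbc
  have hp : explicitElement b c ∈ clusterAlgebra b c := by
    rw [hx]
    exact sub_mem (add_mem (greedy_mem hb hc _) (greedy_mem hb hc _)) (greedy_mem hb hc _)
  obtain ⟨B, hB⟩ := exists_greedy_basis hb hc
  have hneg := repr_neg hb s₁.toRecState B hB (x := ⟨explicitElement b c, hp⟩) hx
  have hne : explicitElement b c ≠ 0 := by
    intro h0
    have : (⟨explicitElement b c, hp⟩ : clusterAlgebra b c) = 0 := Subtype.ext h0
    rw [this, map_zero] at hneg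
    exact lt_irrefl _ hneg
  have heval : evalHom x₁ x₂ (differenceExpansion b c e n h k) = explicitElement b c := by
    have hn := s₁.n_pos
    have hh := s₁.h_pos
    rw [hx, differenceExpansion, map_sub, map_add, greedy_eq hb hc (by omega) (by omega),
      greedy_eq hb hc (by omega) (by omega), greedy_eq hb hc hn hh]
  refine ⟨fun m => ⟨hp, hne, ?_⟩, B, hp, hB, _, hneg⟩
  obtain ⟨f, hf, hf0⟩ : ∃ f, evalHom (clusterVar b c m) (clusterVar b c (m + 1)) f =
      explicitElement b c ∧ ∀ i, 0 ≤ f i := by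
    rw [← heval]
    -- To the left of the initial cluster the reversed state is run with the two variables
    -- exchanged.
    rcases le_total 1 m with hm | hm
    · exact (hasDominatedExpansion_of_one_le hb hc s₁ hm).exists_nonneg
    · obtain ⟨f, hf, hf0⟩ := (hasDominatedExpansion_of_le_one hb hc s₂ hm).exists_nonneg
      refine ⟨swapVars f, ?_, fun i => hf0 _⟩
      rw [evalHom_swapVars, hf, evalHom_differenceExpansion_swap s₁.toRecState]
  exact ⟨f, hf, fun i hi => lt_of_le_of_ne (hf0 i) (Finsupp.mem_support_iff.1 hi).symm⟩

end RankTwoCluster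

theorem theorem1p3 (b c : ℕ) (hb : 0 < b) (hc : 0 < c) (hbc : 4 < b * c) :
    RankTwoCluster.IsPositive b c (RankTwoCluster.explicitElement b c) ∧
    ∃ (B : Module.Basis (ℤ × ℤ) ℤ (RankTwoCluster.clusterAlgebra b c))
      (hp : RankTwoCluster.explicitElement b c ∈ RankTwoCluster.clusterAlgebra b c),
      (∀ a : ℤ × ℤ, (B a : RankTwoCluster.AmbientField) = RankTwoCluster.greedy b c a) ∧
      ∃ a : ℤ × ℤ, B.repr ⟨RankTwoCluster.explicitElement b c, hp⟩ a < 0 :=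
  RankTwoCluster.isPositive_explicitElement_and_exists_basis hb hc hbc
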